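/- Let $\mathbb{K}$ be a field of characteristic zero, let $A$ and $B$ be $\mathbb{Z}$-graded graded-commutative unital $\mathbb{K}$-algebras, and let $k$ be an odd integer. Let $t$ be a central variable of (even) degree $1-k$. All signs $\pm$ are Koszul signs, and $S(i_1,\dots,i_r)$ denotes the set of $(i_1,\dots,i_r)$-unshuffles. **Definitions.** For a linear map $f:A\to B$ of degree $0$ with $f(1)=1$ and a homogeneous linear map $D:A\to A$ with $D(1)=0$ (and similarly for $\mathbb{K}[[t]]$-linear maps between the algebras $A[[t]],B[[t]]$) the *cumulants* of $f$ and the *Koszul brackets* of $D$ are $$\kappa(f)_n(a_1,\dots,a_n)=\sum_{I_1\sqcup\cdots\sqcup I_r=\{1,\dots,n\}}\pm(-1)^{r-1}(r-1)!\prod_{j=1}^r f\Big(\prod_{i\in I_j}a_i\Big),$$ $$\mathcal{K}(D)_n(a_1,\dots,a_n)=\sum_{i=1}^n\sum_{s\in S(i,n-i)}\pm(-1)^{n-i}D(a_{s(1)}\cdots a_{s(i)})\,a_{s(i+1)}\cdots a_{s(n)},$$ the first sum being over unordered partitions into nonempty blocks. A *degree $k$ derived BV algebra* structure on $A$ is a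 $\mathbb{K}[[t]]$-linear map $\Delta=\sum_{n\ge0}t^n\Delta_n:A[[t]]\to A[[t]]$ of degree one (that is, $|\Delta_n|=1+n(k-1)$) with $\Delta(1)=0$, $\Delta^2=0$ and $\mathcal{K}(\Delta)_n(a_1,\dots,a_n)\equiv0\pmod{t^{n-1}}$ for all $n\ge2$ and $a_i\in A$. A *morphism* $(A,\Delta)\to(B,\Delta')$ of such algebras is a $\mathbb{K}[[t]]$-linear map $f=\sum_n t^nf_n:A[[t]]\to B[[t]]$ of degree zero with $f(1)=1$, $f\Delta=\Delta'f$ and $\kappa(f)_n(a_1,\dots,a_n)\equiv0\pmod{t^{n-1}}$ for all $n\ge2$ and $a_i\in A$. A *degree $k$ derived Poisson algebra* structure on $A$ is an $L_\infty[1]$ algebra structure on $A[1-k]$ with Taylor coefficients $q_n$, $n\ge1$, which are multiderivations: $q_n(\dots,bc)=q_n(\dots,b)c+(-1)^{|b||c|}q_n(\dots,c)b$. A *morphism* of such algebras is an $L_\infty[1]$ morphism with Taylor coefficients $f_n$ satisfying, for all $n\ge0$, $$f_{n+1}(a_1,\dots,a_n,bc)=\sum_{i=0}^n\sum_{s\in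 S(i,n-i)}\pm f_{i+1}(a_{s(1)},\dots,a_{s(i)},b)\,f_{n-i+1}(a_{s(i+1)},\dots,a_{s(n)},c).$$ For a derived BV structure $\Delta$ let $\mathcal{P}(\Delta)$ have Taylor coefficients $\mathcal{P}(\Delta)_n=\mathcal{K}(\Delta_{n-1})_n$, and for a morphism $f$ of derived BV algebras let $\mathcal{P}(f)_n(a_1,\dots,a_n)$ be the coefficient of $t^{n-1}$ in $\kappa(f)_n(a_1,\dots,a_n)$, for $n\ge1$ and $a_i\in A$. A *contraction* $(\sigma,\tau,h)$ of a complex $(A,d_A)$ onto a complex $(B,d_B)$ consists of chain maps $\sigma:A\to B$, $\tau:B\to A$ of degree $0$ and a linear map $h:A\to A$ of degree $-1$ such that $\sigma\tau=\mathrm{id}_B$, $hd_A+d_Ah=\tau\sigma-\mathrm{id}_A$, $\sigma h=0$, $h\tau=0$, $h^2=0$. It is a *semifull DG algebra contraction* if moreover $d_A$ is a derivation, $d_A(1)=0$, $d_B(1)=0$, and for all $a,b\in A$, $x,y\in B$ $$h(h(a)h(b))=h(h(a)\tau(x))=h(\tau(x)\tau(y))=h(1)=0,$$ $$\sigma(h(a)h(b))=\sigma(h(a)\tau(x))=0,\quad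 \sigma(\tau(x)\tau(y))=xy,\quad \sigma(1)=1.$$ **Theorem.** Let $\Delta=\sum_{n\ge0}t^n\Delta_n$ be a degree $k$ derived BV algebra structure on $A$, put $d_A=\Delta_0$ and $\Delta_+=\sum_{n\ge1}t^n\Delta_n$, and let $(\sigma,\tau,h)$ be a semifull DG algebra contraction of $(A,d_A)$ onto $(B,d_B)$. Extend $d_B,\sigma,\tau,h$ $\mathbb{K}[[t]]$-linearly and put $$\Delta'=d_B+\sum_{m\ge0}\sigma\Delta_+(h\Delta_+)^m\tau,\quad \breve\sigma=\sum_{m\ge0}\sigma(\Delta_+h)^m,\quad \breve\tau=\sum_{m\ge0}(h\Delta_+)^m\tau,\quad \breve h=\sum_{m\ge0}(h\Delta_+)^mh.$$ Then: 1. $(\breve\sigma,\breve\tau,\breve h)$ is a contraction of $(A[[t]],\Delta)$ onto $(B[[t]],\Delta')$. 2. $\Delta'$ is a degree $k$ derived BV algebra structure on $B$. 3. $\breve\tau$ is a morphism of derived BV algebras from $(B,\Delta')$ to $(A,\Delta)$. 4. $\mathcal{P}(\Delta)$ and $\mathcal{P}(\Delta')$ are degree $k$ derived Poisson algebra structures on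 $A$ and $B$, and $\mathcal{P}(\breve\tau)$ is a morphism of derived Poisson algebras from $(B,\mathcal{P}(\Delta'))$ to $(A,\mathcal{P}(\Delta))$. 5. $\mathcal{P}(\Delta')$ and $\mathcal{P}(\breve\tau)$ coincide with the structure $(r_n)_{n\ge1}$ and the morphism $(f_n)_{n\ge1}$ obtained from $q_n=\mathcal{P}(\Delta)_n$ by homotopy transfer along $(\sigma,\tau,h)$, that is, $f_1=\tau$, $r_1=d_B$ and, for $n\ge2$, $$f_n=\sum_{p=2}^n h\,q_p\,F^p_n,\qquad r_n=\sum_{p=2}^n\sigma\,q_p\,F^p_n,$$ where $F^p_n(x_1\odot\cdots\odot x_n)=\sum_{i_1+\cdots+i_p=n,\ i_j\ge1}\frac1{p!}\sum_{s\in S(i_1,\dots,i_p)}\pm f_{i_1}(x_{s(1)},\dots)\odot\cdots\odot f_{i_p}(\dots,x_{s(n)})$. -/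

import Mathlib

open scoped PowerSeries

namespace DerivedBV

noncomputable section

/-! ### Koszul signs, blocks of a tuple -/

/-- The Koszul sign of the stable rearrangement of a tuple of homogeneous elements of parities
`p 0, …, p (n-1)` that lists first the elements with smallest label `φ`, then the next label, and so
on (elements with equal label keep their order): one factor `(-1)^(p i * p j)` for every
inversion `i < j`, `φ j < φ i`. -/
def koszulSign {n : ℕ} {κ : Type*} [LinearOrder κ] (p : Fin n → ZMod 2) (φ : Fin n → κ) : ℤ :=
  ∏ i : Fin n, ∏ j : Fin n, if i < j ∧ φ j < φ i ∧ p i = 1 ∧ p j = 1 then -1 else 1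

/-- The block of indices with label `j`. -/
def block {n : ℕ} {κ : Type*} [LinearOrder κ] (φ : Fin n → κ) (j : κ) : Finset (Fin n) :=
  Finset.univ.filter (fun i => φ i = j)

/-- The subtuple of `a` indexed by `I`, in increasing order of indices. -/
def restrict {n : ℕ} {R : Type*} (I : Finset (Fin n)) (a : Fin n → R) : Fin I.card → R :=
  fun i => a (I.orderEmbOfFin rfl i)

/-- The product of the elements `a i`, `i ∈ I`, in increasing order of indices. -/
def blockProd {n : ℕ} {R : Type*} [Monoid R] (I : Finset (Fin n)) (a : Fin n → R) : R :=
  ((I.sort (· ≤ ·)).map a).prod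

/-- The labelling of the `(i, n - i)`-unshuffle that puts the elements of `I` first. -/
def unshuffle {n : ℕ} (I : Finset (Fin n)) : Fin n → Fin 2 := fun i => if i ∈ I then 0 else 1

/-- In a decomposition into at least two nonempty blocks, every block is smaller than the whole. -/
theorem card_block_lt {n m : ℕ} (φ : {φ : Fin n → Fin (m + 2) // Function.Surjective φ})
    (j : Fin (m + 2)) : (block φ.1 j).card < n := by
  obtain ⟨j', hj'⟩ := exists_ne j
  obtain ⟨i, hi⟩ := φ.2 j'
  have h : block φ.1 j ⊂ Finset.univ := by
    rw [Finset.ssubset_univ_iff]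
    intro h
    have h1 : i ∈ block φ.1 j := by rw [h]; exact Finset.mem_univ i
    simp only [block, Finset.mem_filter, Finset.mem_univ, true_and] at h1
    exact hj' (hi.symm.trans h1)
  simpa using Finset.card_lt_card h

variable {K : Type*} [Field K]

/-! ### Graded algebras -/

section Graded

variable {A : Type*} [Ring A] [Algebra K A]

/-- Graded commutativity: `a b = (-1)^(|a||b|) b a`. -/
def IsGradedCommutative (𝒜 : ℤ → Submodule K A) : Prop :=
  ∀ (i j : ℤ) (a b : A), a ∈ 𝒜 i → b ∈ 𝒜 j → a * b = (Int.negOnePow (i * j) : ℤ) • (b * a)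

/-- A graded derivation of degree one. -/
def IsGradedDerivation (𝒜 : ℤ → Submodule K A) (d : A →ₗ[K] A) : Prop :=
  ∀ (i : ℤ) (a b : A), a ∈ 𝒜 i → d (a * b) = d a * b + (Int.negOnePow i : ℤ) • (a * d b)

/-- The projection of `A` onto its part of even (`e = 0`), respectively odd (`e = 1`), degree. -/
def parityProj (𝒜 : ℤ → Submodule K A) [GradedAlgebra 𝒜] (e : ZMod 2) : A →ₗ[K] A :=
  DirectSum.coeLinearMap 𝒜 ∘ₗ
    DFinsupp.filterLinearMap K (fun i => 𝒜 i) (fun i : ℤ => (i : ZMod 2) = e) ∘ₗ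
      (DirectSum.decomposeLinearEquiv 𝒜).toLinearMap

/-- A linear map that is homogeneous of degree `e`. -/
def HasDegree {B : Type*} [Ring B] [Algebra K B] (𝒜 : ℤ → Submodule K A) (ℬ : ℤ → Submodule K B)
    (e : ℤ) (f : A →ₗ[K] B) : Prop :=
  ∀ (i : ℤ) (a : A), a ∈ 𝒜 i → f a ∈ ℬ (i + e)

end Graded

/-! ### Cumulants and Koszul brackets

Both are multilinear, with Koszul signs determined on homogeneous arguments. In the definitions an
arbitrary argument is decomposed into its even and odd parts (by `π 0` and `π 1`), and the sum over
`p` runs over the parities chosen for the arguments. -/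

section CumulantsKoszul

variable {R S : Type*} [Ring R] [Algebra K R] [Ring S] [Algebra K S]

/-- The `n`-th cumulant of `f`, i.e. the `n`-th Taylor coefficient of `L ∘ S(f) ∘ E`, where the
coalgebra automorphism `E` has Taylor coefficients `a₁ ⊙ ⋯ ⊙ aₙ ↦ a₁ ⋯ aₙ` and its inverse `L` has
Taylor coefficients `a₁ ⊙ ⋯ ⊙ aₙ ↦ (-1)^(n-1) (n-1)! a₁ ⋯ aₙ`:
the sum over unordered partitions of the arguments into `k` nonempty blocks `I₁, …, I_k` of
`± (-1)^(k-1) (k-1)! f(a_{I₁}) ⋯ f(a_{I_k})`. Unordered partitions are written as surjections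
`φ : Fin n → Fin k` together with a factor `1 / k!`. -/
def cumulant (π : ZMod 2 → R →ₗ[K] R) (f : R →ₗ[K] S) (n : ℕ) (a : Fin n → R) : S :=
  ∑ p : Fin n → ZMod 2, ∑ k ∈ Finset.Icc 1 n,
    ((-1 : K) ^ (k - 1) * ((k - 1).factorial : K) / (k.factorial : K)) •
      ∑ φ : {φ : Fin n → Fin k // Function.Surjective φ},
        koszulSign p φ.1 •
          (List.ofFn (fun j : Fin k =>
            f (blockProd (block φ.1 j) (fun i => π (p i) (a i))))).prod

/-- The `n`-th Koszul bracket of `D`: the sum over `i = 1, …, n` and `(i, n-i)`-unshuffles of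
`± (-1)^(n-i) D(a_{σ(1)} ⋯ a_{σ(i)}) a_{σ(i+1)} ⋯ a_{σ(n)}`. -/
def koszulBracket (π : ZMod 2 → R →ₗ[K] R) (D : R →ₗ[K] R) (n : ℕ) (a : Fin n → R) : R :=
  ∑ p : Fin n → ZMod 2, ∑ I : Finset (Fin n) with I.Nonempty,
    (koszulSign p (unshuffle I) * (-1) ^ (n - I.card)) •
      (D (blockProd I (fun i => π (p i) (a i))) * blockProd Iᶜ (fun i => π (p i) (a i)))

end CumulantsKoszul

/-! ### Linear maps of formal power series -/

section Formal

variable {A B C : Type*} [Ring A] [Algebra K A] [Ring B] [Algebra K B] [Ring C] [Algebra K C]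

/-- A `K[[t]]`-linear map `A[[t]] → B[[t]]`, written as `∑ₙ tⁿ Fₙ` with `Fₙ : A → B` linear. -/
abbrev FormalMap (K A B : Type*) [Field K] [Ring A] [Algebra K A] [Ring B] [Algebra K B] : Type _ :=
  ℕ → A →ₗ[K] B

namespace FormalMap

/-- The map `A[[t]] → B[[t]]` given by `∑ₙ tⁿ Fₙ`. -/
def toPowerSeries (F : FormalMap K A B) : A⟦X⟧ →ₗ[K] B⟦X⟧ where
  toFun x := PowerSeries.mk fun n =>
    ∑ ij ∈ Finset.HasAntidiagonal.antidiagonal n, F ij.1 (PowerSeries.coeff ij.2 x)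
  map_add' x y := by
    ext n
    simp [Finset.sum_add_distrib]
  map_smul' c x := by
    ext n
    have h : ∀ m, PowerSeries.coeff m (c • x) = c • PowerSeries.coeff m x := fun _ => rfl
    have h' : ∀ (m : ℕ) (y : B⟦X⟧), PowerSeries.coeff m (c • y) = c • PowerSeries.coeff m y :=
      fun _ _ => rfl
    simp [h, h', Finset.smul_sum]

/-- The `K[[t]]`-linear extension of a linear map. -/
def const (f : A →ₗ[K] B) : FormalMap K A B := fun n => if n = 0 then f else 0

/-- Composition of `K[[t]]`-linear maps. -/
def comp (G : FormalMap K B C) (F : FormalMap K A B) : FormalMap K A C :=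
  fun n => ∑ ij ∈ Finset.HasAntidiagonal.antidiagonal n, G ij.1 ∘ₗ F ij.2

/-- The part `∑_{n ≥ 1} tⁿ Fₙ` of a `K[[t]]`-linear map. -/
def plus (F : FormalMap K A B) : FormalMap K A B := fun n => if n = 0 then 0 else F n

/-- The iterates of a `K[[t]]`-linear endomorphism. -/
def pow (F : FormalMap K A A) : ℕ → FormalMap K A A
  | 0 => const LinearMap.id
  | m + 1 => comp F (pow F m)

/-- The sum `∑_{m ≥ 0} F m` of a family in which `F m` is divisible by `tᵐ`: in the coefficient
of `tⁿ` only the terms with `m ≤ n` contribute. -/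
def series (F : ℕ → FormalMap K A B) : FormalMap K A B :=
  fun n => ∑ m ∈ Finset.range (n + 1), F m n

/-- The `m`-th power of a map divisible by `t` is divisible by `tᵐ`. -/
theorem pow_apply_eq_zero {F : FormalMap K A A} (hF : F 0 = 0) (m n : ℕ) (h : n < m) :
    pow F m n = 0 := by
  induction m generalizing n with
  | zero => omega
  | succ m ih =>
    change ∑ ij ∈ Finset.HasAntidiagonal.antidiagonal n, F ij.1 ∘ₗ pow F m ij.2 = 0
    refine Finset.sum_eq_zero fun ij hij => ?_
    rw [Finset.HasAntidiagonal.mem_antidiagonal] at hij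
    rcases Nat.eq_zero_or_pos ij.1 with h0 | h0
    · rw [h0, hF, LinearMap.zero_comp]
    · rw [ih ij.2 (by omega), LinearMap.comp_zero]

end FormalMap

/-- The even and odd projections of `A[[t]]` (the variable `t` has even degree). -/
def seriesParityProj (𝒜 : ℤ → Submodule K A) [GradedAlgebra 𝒜] (e : ZMod 2) : A⟦X⟧ →ₗ[K] A⟦X⟧ :=
  FormalMap.toPowerSeries (FormalMap.const (parityProj 𝒜 e))

end Formal

/-! ### Contractions -/

section Contractions

variable {A B : Type*} [Ring A] [Algebra K A] [Ring B] [Algebra K B]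

/-- A contraction `(σ, τ, h)` of the DG space `(A, dA)` onto the DG space `(B, dB)`. -/
structure IsContraction (𝒜 : ℤ → Submodule K A) (ℬ : ℤ → Submodule K B)
    (dA : A →ₗ[K] A) (dB : B →ₗ[K] B)
    (σ : A →ₗ[K] B) (τ : B →ₗ[K] A) (h : A →ₗ[K] A) : Prop where
  degree_dA : HasDegree 𝒜 𝒜 1 dA
  degree_dB : HasDegree ℬ ℬ 1 dB
  degree_σ : HasDegree 𝒜 ℬ 0 σ
  degree_τ : HasDegree ℬ 𝒜 0 τ
  degree_h : HasDegree 𝒜 𝒜 (-1) h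
  dA_dA : dA ∘ₗ dA = 0
  dB_dB : dB ∘ₗ dB = 0
  σ_dA : σ ∘ₗ dA = dB ∘ₗ σ
  dA_τ : dA ∘ₗ τ = τ ∘ₗ dB
  σ_τ : σ ∘ₗ τ = LinearMap.id
  homotopy : h ∘ₗ dA + dA ∘ₗ h = τ ∘ₗ σ - LinearMap.id
  σ_h : σ ∘ₗ h = 0
  h_τ : h ∘ₗ τ = 0
  h_h : h ∘ₗ h = 0

/-- A semifull DG algebra contraction of `(A, dA)` onto `(B, dB)`. -/
structure IsSemifullDGContraction (𝒜 : ℤ → Submodule K A) (ℬ : ℤ → Submodule K B)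
    (dA : A →ₗ[K] A) (dB : B →ₗ[K] B)
    (σ : A →ₗ[K] B) (τ : B →ₗ[K] A) (h : A →ₗ[K] A) : Prop
    extends IsContraction 𝒜 ℬ dA dB σ τ h where
  dA_one : dA 1 = 0
  dB_one : dB 1 = 0
  derivation : IsGradedDerivation 𝒜 dA
  h_hh : ∀ a b : A, h (h a * h b) = 0
  h_hτ : ∀ (a : A) (x : B), h (h a * τ x) = 0
  h_ττ : ∀ x y : B, h (τ x * τ y) = 0
  h_one : h 1 = 0
  σ_hh : ∀ a b : A, σ (h a * h b) = 0
  σ_hτ : ∀ (a : A) (x : B), σ (h a * τ x) = 0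
  σ_ττ : ∀ x y : B, σ (τ x * τ y) = x * y
  σ_one : σ 1 = 1

open FormalMap in
/-- A `K[[t]]`-linear contraction of `(A[[t]], D)` onto `(B[[t]], D')`, where `t` has
degree `1 - k`, so that a map `∑ₙ tⁿ Fₙ` has degree `e` when `Fₙ` has degree `e + n (k - 1)`. -/
structure IsFormalContraction (𝒜 : ℤ → Submodule K A) (ℬ : ℤ → Submodule K B) (k : ℤ)
    (D : FormalMap K A A) (D' : FormalMap K B B)
    (s : FormalMap K A B) (u : FormalMap K B A) (H : FormalMap K A A) : Prop where
  degree_D : ∀ n : ℕ, HasDegree 𝒜 𝒜 (1 + n * (k - 1)) (D n)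
  degree_D' : ∀ n : ℕ, HasDegree ℬ ℬ (1 + n * (k - 1)) (D' n)
  degree_s : ∀ n : ℕ, HasDegree 𝒜 ℬ (n * (k - 1)) (s n)
  degree_u : ∀ n : ℕ, HasDegree ℬ 𝒜 (n * (k - 1)) (u n)
  degree_H : ∀ n : ℕ, HasDegree 𝒜 𝒜 (-1 + n * (k - 1)) (H n)
  D_D : comp D D = 0
  D'_D' : comp D' D' = 0
  s_D : comp s D = comp D' s
  D_u : comp D u = comp u D'
  s_u : comp s u = const LinearMap.id
  homotopy : comp H D + comp D H = comp u s - const LinearMap.id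
  s_H : comp s H = 0
  H_u : comp H u = 0
  H_H : comp H H = 0

end Contractions

/-! ### The data given by the standard perturbation lemma -/

section Perturbation

open FormalMap

variable {A B : Type*} [Ring A] [Algebra K A] [Ring B] [Algebra K B]

/-- The perturbed differential `Δ' = dB + ∑_{m ≥ 0} σ Δ₊ (h Δ₊)ᵐ τ`. -/
def perturbedDifferential (Δ : FormalMap K A A) (dB : B →ₗ[K] B)
    (σ : A →ₗ[K] B) (τ : B →ₗ[K] A) (h : A →ₗ[K] A) : FormalMap K B B :=
  const dB + series fun m =>
    comp (const σ) (comp (plus Δ) (comp (pow (comp (const h) (plus Δ)) m) (const τ)))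

/-- The perturbed projection `∑_{m ≥ 0} σ (Δ₊ h)ᵐ`. -/
def perturbedProjection (Δ : FormalMap K A A) (σ : A →ₗ[K] B) (h : A →ₗ[K] A) :
    FormalMap K A B :=
  series fun m => comp (const σ) (pow (comp (plus Δ) (const h)) m)

/-- The perturbed inclusion `∑_{m ≥ 0} (h Δ₊)ᵐ τ`. -/
def perturbedInclusion (Δ : FormalMap K A A) (τ : B →ₗ[K] A) (h : A →ₗ[K] A) :
    FormalMap K B A :=
  series fun m => comp (pow (comp (const h) (plus Δ)) m) (const τ)

/-- The perturbed homotopy `∑_{m ≥ 0} (h Δ₊)ᵐ h`. -/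
def perturbedHomotopy (Δ : FormalMap K A A) (h : A →ₗ[K] A) : FormalMap K A A :=
  series fun m => comp (pow (comp (const h) (plus Δ)) m) (const h)

end Perturbation

/-! ### Derived BV algebras and their morphisms -/

section BV

open FormalMap

variable {A B : Type*} [Ring A] [Algebra K A] [Ring B] [Algebra K B]

/-- A degree `k` derived BV algebra structure `Δ = ∑ₙ tⁿ Δₙ` on `A`. -/
structure IsDerivedBV (𝒜 : ℤ → Submodule K A) [GradedAlgebra 𝒜] (k : ℤ)
    (Δ : FormalMap K A A) : Prop where
  degree : ∀ n : ℕ, HasDegree 𝒜 𝒜 (1 + n * (k - 1)) (Δ n)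
  map_one : ∀ n : ℕ, Δ n 1 = 0
  square_zero : comp Δ Δ = 0
  /-- The `n`-th Koszul bracket vanishes modulo `t^(n-1)`. -/
  koszul_mod : ∀ (n : ℕ), 2 ≤ n → ∀ (a : Fin n → A) (m : ℕ), m < n - 1 →
    PowerSeries.coeff m
      (koszulBracket (seriesParityProj 𝒜) Δ.toPowerSeries n (fun i => PowerSeries.C (a i))) = 0

/-- A morphism `f = ∑ₙ tⁿ fₙ` of degree `k` derived BV algebras from `(A, Δ)` to `(B, Δ')`. -/
structure IsDerivedBVMorphism (𝒜 : ℤ → Submodule K A) [GradedAlgebra 𝒜]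
    (ℬ : ℤ → Submodule K B) (k : ℤ)
    (Δ : FormalMap K A A) (Δ' : FormalMap K B B) (f : FormalMap K A B) : Prop where
  degree : ∀ n : ℕ, HasDegree 𝒜 ℬ (n * (k - 1)) (f n)
  map_one : f.toPowerSeries 1 = 1
  commutes : comp f Δ = comp Δ' f
  /-- The `n`-th cumulant vanishes modulo `t^(n-1)`. -/
  cumulant_mod : ∀ (n : ℕ), 2 ≤ n → ∀ (a : Fin n → A) (m : ℕ), m < n - 1 →
    PowerSeries.coeff m
      (cumulant (seriesParityProj 𝒜) f.toPowerSeries n (fun i => PowerSeries.C (a i))) = 0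

/-- The Taylor coefficients of `𝒫(Δ)`: the `n`-th one is the `n`-th Koszul bracket
of `Δ_{n-1}` for `n ≥ 1`, and the zeroth one vanishes. -/
def poissonStructure (𝒜 : ℤ → Submodule K A) [GradedAlgebra 𝒜] (Δ : FormalMap K A A) :
    (n : ℕ) → (Fin n → A) → A
  | 0 => 0
  | n + 1 => koszulBracket (parityProj 𝒜) (Δ n) (n + 1)

/-- The Taylor coefficients of `𝒫(f)`: the `n`-th one is the coefficient of `t^(n-1)` in
the `n`-th cumulant of `f` for `n ≥ 1`, and the zeroth one vanishes. -/
def poissonMorphism (𝒜 : ℤ → Submodule K A) [GradedAlgebra 𝒜] (f : FormalMap K A B) :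
    (n : ℕ) → (Fin n → A) → B
  | 0 => 0
  | n + 1 => fun a => PowerSeries.coeff n
      (cumulant (seriesParityProj 𝒜) f.toPowerSeries (n + 1) (fun i => PowerSeries.C (a i)))

end BV

/-! ### Derived Poisson algebras and their morphisms

A coderivation of `S(A[1-k])`, or a coalgebra morphism `S(A[1-k]) → S(B[1-k])`, is given by its Taylor
coefficients, which are written as maps on tuples of elements of `A`. As `k` is odd, Koszul signs
are the same for `A` and for `A[1-k]`. A map of degree `e` from the `n`-th symmetric power of
`A[1-k]` to `B[1-k]` has degree `e + (n - 1) (k - 1)` with respect to the gradings of `A` and `B`. -/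

section Poisson

variable {A B : Type*} [Ring A] [Algebra K A] [Ring B] [Algebra K B]

/-- A family `qₙ : A[1-k]^{⊙ n} → B[1-k]`, `n ≥ 1`, of graded symmetric multilinear maps of
degree `e` (with `q₀ = 0`). -/
structure IsTaylorFamily (𝒜 : ℤ → Submodule K A) (ℬ : ℤ → Submodule K B) (k e : ℤ)
    (q : (n : ℕ) → (Fin n → A) → B) : Prop where
  zero : q 0 = 0
  map_add : ∀ (n : ℕ) (a : Fin n → A) (i : Fin n) (x y : A),
    q n (Function.update a i (x + y)) = q n (Function.update a i x) + q n (Function.update a i y)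
  map_smul : ∀ (n : ℕ) (a : Fin n → A) (i : Fin n) (c : K) (x : A),
    q n (Function.update a i (c • x)) = c • q n (Function.update a i x)
  degree : ∀ (n : ℕ) (d : Fin n → ℤ) (a : Fin n → A), (∀ i, a i ∈ 𝒜 (d i)) →
    q n a ∈ ℬ (∑ i, d i + (e + ((n : ℤ) - 1) * (k - 1)))
  symm : ∀ (n : ℕ) (d : Fin n → ℤ) (a : Fin n → A), (∀ i, a i ∈ 𝒜 (d i)) →
    ∀ s : Equiv.Perm (Fin n),
      q n (fun i => a (s i)) = koszulSign (fun i => (d (s i) : ZMod 2)) (fun i => s i) • q n a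

/-- The `n`-th Taylor coefficient of `Q ∘ R` on homogeneous arguments of parities `p`, where `R` is the
coderivation with Taylor coefficients `r` and `Q` is the coderivation, or the coalgebra morphism, with
Taylor coefficients `q`: the sum over `i = 1, …, n` and `(i, n-i)`-unshuffles of
`± q_{n-i+1} (r_i (a_{σ(1)}, …, a_{σ(i)}), a_{σ(i+1)}, …, a_{σ(n)})`. -/
def compCoder (q : (n : ℕ) → (Fin n → A) → B) (r : (n : ℕ) → (Fin n → A) → A)
    (n : ℕ) (p : Fin n → ZMod 2) (a : Fin n → A) : B :=
  ∑ I : Finset (Fin n) with I.Nonempty, koszulSign p (unshuffle I) •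
    q (Iᶜ.card + 1) (Fin.cons (r I.card (restrict I a)) (restrict Iᶜ a))

/-- The `n`-th Taylor coefficient of `R ∘ F` on homogeneous arguments of parities `p`, where `F` is the
coalgebra morphism with Taylor coefficients `f` and `R` is a coderivation with Taylor coefficients `r`:
the sum over `k, i₁, …, i_k ≥ 1` with `i₁ + ⋯ + i_k = n` and over `(i₁, …, i_k)`-unshuffles
of `± (1 / k!) r_k (f_{i₁}(…), …, f_{i_k}(…))`. The unshuffles are encoded by the
surjections `φ : Fin n → Fin k`. -/
def compMorphism (r : (n : ℕ) → (Fin n → B) → B) (f : (n : ℕ) → (Fin n → A) → B)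
    (n : ℕ) (p : Fin n → ZMod 2) (a : Fin n → A) : B :=
  ∑ k ∈ Finset.Icc 1 n, (1 / (k.factorial : K)) •
    ∑ φ : {φ : Fin n → Fin k // Function.Surjective φ}, koszulSign p φ.1 •
      r k (fun j => f (block φ.1 j).card (restrict (block φ.1 j) a))

/-- A degree `k` derived Poisson algebra structure on `A`: an `L_∞[1]` algebra structure on
`A[1-k]` whose Taylor coefficients are multiderivations. -/
structure IsDerivedPoisson (𝒜 : ℤ → Submodule K A) (k : ℤ)
    (q : (n : ℕ) → (Fin n → A) → A) : Prop where
  taylor : IsTaylorFamily 𝒜 𝒜 k 1 q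
  jacobi : ∀ (n : ℕ) (d : Fin n → ℤ) (a : Fin n → A), (∀ i, a i ∈ 𝒜 (d i)) →
    compCoder q q n (fun i => (d i : ZMod 2)) a = 0
  multiderivation : ∀ (n : ℕ) (a : Fin n → A) (i j : ℤ) (b c : A), b ∈ 𝒜 i → c ∈ 𝒜 j →
    q (n + 1) (Fin.snoc a (b * c)) = q (n + 1) (Fin.snoc a b) * c +
      (Int.negOnePow (i * j) : ℤ) • (q (n + 1) (Fin.snoc a c) * b)

/-- A morphism of degree `k` derived Poisson algebras from `(A, q)` to `(B, r)`: an `L_∞[1]`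
morphism from `A[1-k]` to `B[1-k]` such that
`f_{n+1}(a₁, …, aₙ, bc)` is the sum over `i = 0, …, n` and `(i, n-i)`-unshuffles of
`± f_{i+1}(a_{σ(1)}, …, a_{σ(i)}, b) f_{n-i+1}(a_{σ(i+1)}, …, a_{σ(n)}, c)`. -/
structure IsDerivedPoissonMorphism (𝒜 : ℤ → Submodule K A) (ℬ : ℤ → Submodule K B) (k : ℤ)
    (q : (n : ℕ) → (Fin n → A) → A) (r : (n : ℕ) → (Fin n → B) → B)
    (f : (n : ℕ) → (Fin n → A) → B) : Prop where
  taylor : IsTaylorFamily 𝒜 ℬ k 0 f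
  commutes : ∀ (n : ℕ) (d : Fin n → ℤ) (a : Fin n → A), (∀ i, a i ∈ 𝒜 (d i)) →
    compCoder f q n (fun i => (d i : ZMod 2)) a =
      compMorphism (K := K) r f n (fun i => (d i : ZMod 2)) a
  multiplicative : ∀ (n : ℕ) (d : Fin n → ℤ) (a : Fin n → A) (i j : ℤ) (b c : A),
    (∀ l, a l ∈ 𝒜 (d l)) → b ∈ 𝒜 i → c ∈ 𝒜 j →
    f (n + 1) (Fin.snoc a (b * c)) =
      ∑ I : Finset (Fin n),
        koszulSign (Fin.snoc (fun l => (d l : ZMod 2)) (i : ZMod 2) : Fin (n + 1) → ZMod 2)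
          (Fin.snoc (fun l => if l ∈ I then 0 else 2) 1 : Fin (n + 1) → Fin 3) •
        (f (I.card + 1) (Fin.snoc (restrict I a) b) *
          f (Iᶜ.card + 1) (Fin.snoc (restrict Iᶜ a) c))

end Poisson

/-! ### Homotopy transfer of `L_∞[1]` structures -/

section Transfer

variable {A B : Type*} [Ring A] [Algebra K A] [Ring B] [Algebra K B]

/-- The Taylor coefficients of the `L_∞[1]` morphism from `B` to `A` obtained by homotopy transfer
of the `L_∞[1]` structure `q` on `A` along a contraction `(σ, τ, h)`: `f₁ = τ` and
`fₙ = ∑_{k=2}^{n} h q_k F^k_n` for `n ≥ 2`, where `F^k_n` is the component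
`B^{⊙ n} → A^{⊙ k}` of the coalgebra morphism with Taylor coefficients `f`
(here `k = m + 2`, and the sum over `p` decomposes the arguments into even and odd parts). -/
def transferMorphism (ℬ : ℤ → Submodule K B) [GradedAlgebra ℬ] (q : (n : ℕ) → (Fin n → A) → A)
    (τ : B →ₗ[K] A) (h : A →ₗ[K] A) : (n : ℕ) → (Fin n → B) → A
  | 0 => 0
  | 1 => fun x => τ (x 0)
  | n + 2 => fun x =>
      ∑ p : Fin (n + 2) → ZMod 2, ∑ m ∈ Finset.range (n + 1),
        (1 / ((m + 2).factorial : K)) •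
          ∑ φ : {φ : Fin (n + 2) → Fin (m + 2) // Function.Surjective φ}, koszulSign p φ.1 •
            h (q (m + 2) (fun j => transferMorphism ℬ q τ h (block φ.1 j).card
              (restrict (block φ.1 j) (fun i => parityProj ℬ (p i) (x i)))))
  termination_by n => n
  decreasing_by exact card_block_lt φ j

/-- The Taylor coefficients of the `L_∞[1]` structure on `B` obtained by homotopy transfer
of `q`: `r₁ = dB` and `rₙ = ∑_{k=2}^{n} σ q_k F^k_n` for `n ≥ 2`. -/
def transferStructure (ℬ : ℤ → Submodule K B) [GradedAlgebra ℬ] (q : (n : ℕ) → (Fin n → A) → A)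
    (dB : B →ₗ[K] B) (σ : A →ₗ[K] B) (τ : B →ₗ[K] A) (h : A →ₗ[K] A) :
    (n : ℕ) → (Fin n → B) → B
  | 0 => 0
  | 1 => fun x => dB (x 0)
  | n + 2 => fun x =>
      ∑ p : Fin (n + 2) → ZMod 2, ∑ m ∈ Finset.range (n + 1),
        (1 / ((m + 2).factorial : K)) •
          ∑ φ : {φ : Fin (n + 2) → Fin (m + 2) // Function.Surjective φ}, koszulSign p φ.1 •
            σ (q (m + 2) (fun j => transferMorphism ℬ q τ h (block φ.1 j).card
              (restrict (block φ.1 j) (fun i => parityProj ℬ (p i) (x i)))))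

end Transfer

end

end DerivedBV

/-! Generating functions. Fix arguments `a i` of parities `p i` and adjoin one formal square-zero
variable ε_i of parity `p i` for each argument. The resulting algebra is `SetFun p R`: an element is
a function of subsets T, the coefficients of the monomials ε_T. Elements whose coefficients have the
parity of their monomials commute with each other, so exponentials and logarithms behave as in a
commutative algebra. For x = ∑ a_i ε_i the coefficients of e^x are the products of the arguments
over subsets. Hence the cumulant of f is the top coefficient of log f(e^x), and the Koszul bracket
of D is the top coefficient of D(e^x) e^(-x) (`SetFun.signedCumulant_eq`, `SetFun.signedKoszul_eq`).

In this language the combinatorial identities become calculus. Composing with a coderivation is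
differentiation in the direction of an odd variable times the generating function of its brackets;
inserting cumulants L = log f(e^x) into brackets gives D(e^L) e^(-L) = D(f(e^x)) f(e^x)^(-1). So D²
= 0 yields the higher Jacobi identities, and f D = D' f says that the cumulants form an L_∞ morphism
from the brackets of D to those of D'. First-order expansions in two further variables give
`SetFun.koszulBracket_mul` and `SetFun.cumulant_mul`: the Leibniz rule and the product rule hold up
to the bracket, or cumulant, with one more argument. Under the divisibility conditions that extra
term is of higher order in t, so the leading coefficients form derived Poisson structures and
morphisms.

The transfer rests on one observation. For a semifull contraction, ker h is a subalgebra and σ is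
multiplicative on it, since every a in ker h equals τσa − h d a
(`IsSemifullDGContraction.map_mul_ker`). The perturbed inclusion T takes values in ker h, so all
powers of c − 1, where c = T(e^x), lie in ker h and can be rebuilt from their images under σ and h
d. As d is a derivation, summing the logarithmic series gives (`SetFun.perturbed_eq`) log c = τ x +
h(Δ₊(c) c^(-1)), Δ'(e^x) e^(-x) = d_B x + σ(Δ₊(c) c^(-1)). Here Δ₊(c) c^(-1) is the generating
function of the Koszul brackets of Δ₊ evaluated on the cumulants of T. Thus the cumulants of T
satisfy the recursion of homotopy transfer, except for one additional term hΔ₊(κ_n) coming from the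
unary bracket.

That term is harmless because Δ₊ is divisible by t. The brackets with p ≥ 2 arguments contribute
t^(p-1) ∏ t^(i_j - 1) = t^(n-1), and the unary term improves any known divisibility of κ_n by one
power of t; a nested induction gives divisibility of κ_n by t^(n-1), and then of the brackets of Δ'.
In degree t^(n-1) the unary term has disappeared, and what remains is exactly the transfer
recursion. The contraction identities themselves are the homological perturbation lemma, purely
linear algebra with the resolvents of hΔ₊ and Δ₊h. -/

namespace DerivedBV

noncomputable section

/-! ### Signs -/

/-- The sign `(-1)^(a b)` of the transposition of two elements of parities `a` and `b`. -/
def swapSign (a b : ZMod 2) : ℤ := if a = 1 ∧ b = 1 then -1 else 1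

theorem swapSign_comm (a b : ZMod 2) : swapSign a b = swapSign b a := by
  revert a b; decide

theorem swapSign_mul_self (a b : ZMod 2) : swapSign a b * swapSign a b = 1 := by
  revert a b; decide

theorem swapSign_add_left (a b c : ZMod 2) :
    swapSign (a + b) c = swapSign a c * swapSign b c := by
  revert a b c; decide

@[simp] theorem swapSign_zero_left (a : ZMod 2) : swapSign 0 a = 1 := by
  revert a; decide

theorem swapSign_sum_left {ι : Type*} (s : Finset ι) (f : ι → ZMod 2) (b : ZMod 2) :
    swapSign (∑ i ∈ s, f i) b = ∏ i ∈ s, swapSign (f i) b := by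
  classical
  induction s using Finset.induction_on with
  | empty => simp
  | insert a s ha ih => rw [Finset.sum_insert ha, Finset.prod_insert ha, swapSign_add_left, ih]

theorem swapSign_sum_right {ι : Type*} (s : Finset ι) (f : ι → ZMod 2) (b : ZMod 2) :
    swapSign b (∑ i ∈ s, f i) = ∏ i ∈ s, swapSign b (f i) := by
  rw [swapSign_comm, swapSign_sum_left]
  exact Finset.prod_congr rfl fun i _ => swapSign_comm _ _

/-- The sign of the inversion, if any, of the positions `i` and `j`. -/
def inversionSign {n : ℕ} (p : Fin n → ZMod 2) (i j : Fin n) : ℤ :=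
  if j < i then swapSign (p i) (p j) else 1

theorem inversionSign_mul_self {n : ℕ} (p : Fin n → ZMod 2) (i j : Fin n) :
    inversionSign p i j * inversionSign p i j = 1 := by
  unfold inversionSign; split_ifs
  · exact swapSign_mul_self _ _
  · rfl

theorem inversionSign_mul_swap {n : ℕ} (p : Fin n → ZMod 2) {i j : Fin n} (h : i ≠ j) :
    inversionSign p i j * inversionSign p j i = swapSign (p i) (p j) := by
  unfold inversionSign
  rcases lt_or_gt_of_ne h with h | h
  · simp [h, h.not_gt, swapSign_comm (p j)]
  · simp [h, h.not_gt]

/-- The sign of the unshuffle that lists first `T` and then `U`. -/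
def crossSign {n : ℕ} (p : Fin n → ZMod 2) (T U : Finset (Fin n)) : ℤ :=
  ∏ i ∈ T, ∏ j ∈ U, inversionSign p i j

section crossSign

variable {n : ℕ} (p : Fin n → ZMod 2)

@[simp] theorem crossSign_empty_left (U : Finset (Fin n)) : crossSign p ∅ U = 1 := by
  simp [crossSign]

@[simp] theorem crossSign_empty_right (U : Finset (Fin n)) : crossSign p U ∅ = 1 := by
  simp [crossSign]

theorem crossSign_mul_self (T U : Finset (Fin n)) : crossSign p T U * crossSign p T U = 1 := by
  simp only [crossSign, ← Finset.prod_mul_distrib, inversionSign_mul_self, Finset.prod_const_one]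

theorem crossSign_union_left {T T' : Finset (Fin n)} (h : Disjoint T T') (U : Finset (Fin n)) :
    crossSign p (T ∪ T') U = crossSign p T U * crossSign p T' U :=
  Finset.prod_union h

theorem crossSign_union_right {U U' : Finset (Fin n)} (h : Disjoint U U') (T : Finset (Fin n)) :
    crossSign p T (U ∪ U') = crossSign p T U * crossSign p T U' := by
  simp only [crossSign, ← Finset.prod_mul_distrib]
  exact Finset.prod_congr rfl fun i _ => Finset.prod_union h

theorem crossSign_biUnion {k : ℕ} (S : Fin k → Finset (Fin n))
    (hS : ∀ i j, i ≠ j → Disjoint (S i) (S j)) (T U : Finset (Fin k)) :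
    crossSign p (T.biUnion S) (U.biUnion S) = ∏ i ∈ T, ∏ j ∈ U, crossSign p (S i) (S j) := by
  have h : ∀ T : Finset (Fin k), Set.PairwiseDisjoint (T : Set (Fin k)) S :=
    fun T i _ j _ hij => hS i j hij
  unfold crossSign
  rw [Finset.prod_biUnion (h T)]
  refine Finset.prod_congr rfl fun i _ => ?_
  rw [Finset.prod_comm]
  simp_rw [Finset.prod_biUnion (h U)]
  rw [Finset.prod_congr rfl fun j _ => Finset.prod_comm]

/-- Every pair from T × U is an inversion in exactly one of the two orders. This is the sign that
lets even elements of the set-function algebra commute. -/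
theorem crossSign_mul_swap {T U : Finset (Fin n)} (h : Disjoint T U) :
    crossSign p T U * crossSign p U T = swapSign (∑ i ∈ T, p i) (∑ i ∈ U, p i) := by
  rw [swapSign_sum_left]
  unfold crossSign
  rw [Finset.prod_comm (s := U), ← Finset.prod_mul_distrib]
  refine Finset.prod_congr rfl fun i hi => ?_
  rw [swapSign_sum_right, ← Finset.prod_mul_distrib]
  refine Finset.prod_congr rfl fun j hj => inversionSign_mul_swap p ?_
  rintro rfl
  exact Finset.disjoint_left.mp h hi hj

theorem crossSign_eq_one_of_lt {T U : Finset (Fin n)} (h : ∀ i ∈ T, ∀ j ∈ U, i < j) :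
    crossSign p T U = 1 :=
  Finset.prod_eq_one fun i hi => Finset.prod_eq_one fun j hj => by
    simp [inversionSign, (h i hi j hj).not_gt]

theorem koszulSign_eq_prod {κ : Type*} [LinearOrder κ] (φ : Fin n → κ) :
    koszulSign p φ = ∏ i, ∏ j, if φ i < φ j then inversionSign p i j else 1 := by
  unfold koszulSign
  rw [Finset.prod_comm]
  refine Finset.prod_congr rfl fun i _ => Finset.prod_congr rfl fun j _ => ?_
  unfold inversionSign swapSign
  by_cases h1 : j < i <;> by_cases h2 : φ i < φ j <;> by_cases h3 : p i = 1 <;>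
    by_cases h4 : p j = 1 <;> simp [h1, h2, h3, h4]

theorem koszulSign_unshuffle (I : Finset (Fin n)) :
    koszulSign p (unshuffle I) = crossSign p I Iᶜ := by
  rw [koszulSign_eq_prod, crossSign, ← Finset.prod_subset (Finset.subset_univ I)]
  · refine Finset.prod_congr rfl fun i hi => ?_
    rw [← Finset.prod_subset (Finset.subset_univ Iᶜ)]
    · refine Finset.prod_congr rfl fun j hj => ?_
      simp [unshuffle, hi, Finset.mem_compl.mp hj]
    · intro j _ hj
      have : j ∈ I := by simpa using hj
      simp [unshuffle, hi, this]
  · intro i _ hi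
    refine Finset.prod_eq_one fun j _ => ?_
    by_cases hj : j ∈ I <;> simp [unshuffle, hi, hj]

theorem sum_block {k : ℕ} {M : Type*} [CommMonoid M] (φ : Fin n → Fin k) (f : Fin n → M) :
    ∏ i, f i = ∏ j, ∏ i ∈ block φ j, f i := by
  unfold block
  rw [Finset.prod_fiberwise]

/-- Indices with equal label are never exchanged, so only pairs of distinct blocks contribute. -/
theorem koszulSign_eq_prod_block {k : ℕ} (φ : Fin n → Fin k) :
    koszulSign p φ = ∏ a, ∏ b, if a < b then crossSign p (block φ a) (block φ b) else 1 := by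
  rw [koszulSign_eq_prod, sum_block φ]
  refine Finset.prod_congr rfl fun a _ => ?_
  rw [Finset.prod_comm, sum_block φ]
  refine Finset.prod_congr rfl fun b _ => ?_
  unfold crossSign
  rw [Finset.prod_comm]
  split_ifs with h
  · refine Finset.prod_congr rfl fun i hi => Finset.prod_congr rfl fun j hj => ?_
    simp only [block, Finset.mem_filter, Finset.mem_univ, true_and] at hi hj
    simp [hi, hj, h]
  · refine Finset.prod_eq_one fun i hi => Finset.prod_eq_one fun j hj => ?_
    simp only [block, Finset.mem_filter, Finset.mem_univ, true_and] at hi hj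
    simp [hi, hj, h]

end crossSign

/-! ### The algebra of set functions with the signed shuffle product -/

/-- Functions on the finite subsets of `Fin n` with values in `R`: the elements of the tensor product of
`R` with the free graded commutative algebra on square-zero variables `ε i` of parity `p i`. -/
structure SetFun {n : ℕ} (p : Fin n → ZMod 2) (R : Type*) where
  /-- The coefficients. -/
  toFun : Finset (Fin n) → R

namespace SetFun

variable {K : Type*} [Field K] {n : ℕ} {p : Fin n → ZMod 2}

instance {R : Type*} : CoeFun (SetFun p R) (fun _ => Finset (Fin n) → R) := ⟨toFun⟩

@[ext] theorem ext {R : Type*} {α β : SetFun p R} (h : ∀ T, α T = β T) : α = β := by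
  cases α; cases β; congr 1; exact funext h

theorem toFun_injective {R : Type*} :
    Function.Injective (toFun : SetFun p R → Finset (Fin n) → R) :=
  fun _ _ h => ext (congrFun h)

section Basic

variable {R S : Type*} [Ring R] [Algebra K R] [Ring S] [Algebra K S]

instance : Zero (SetFun p R) := ⟨⟨0⟩⟩
instance : Add (SetFun p R) := ⟨fun α β => ⟨α.toFun + β.toFun⟩⟩
instance : Neg (SetFun p R) := ⟨fun α => ⟨-α.toFun⟩⟩
instance : Sub (SetFun p R) := ⟨fun α β => ⟨α.toFun - β.toFun⟩⟩
instance {M : Type*} [SMul M R] : SMul M (SetFun p R) := ⟨fun c α => ⟨c • α.toFun⟩⟩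

instance : AddCommGroup (SetFun p R) :=
  toFun_injective.addCommGroup toFun rfl (fun _ _ => rfl) (fun _ => rfl) (fun _ _ => rfl)
    (fun _ _ => rfl) (fun _ _ => rfl)

/-- The coefficients as an additive homomorphism. -/
def toFunHom : SetFun p R →+ (Finset (Fin n) → R) := ⟨⟨toFun, rfl⟩, fun _ _ => rfl⟩

instance : Module K (SetFun p R) :=
  toFun_injective.module K toFunHom (fun _ _ => rfl)

@[simp] theorem add_apply (α β : SetFun p R) (T) : (α + β) T = α T + β T := rfl
@[simp] theorem sub_apply (α β : SetFun p R) (T) : (α - β) T = α T - β T := rfl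
@[simp] theorem neg_apply (α : SetFun p R) (T) : (-α) T = -α T := rfl
@[simp] theorem zero_apply (T) : (0 : SetFun p R) T = 0 := rfl
@[simp] theorem smul_apply (c : K) (α : SetFun p R) (T) : (c • α) T = c • α T := rfl
@[simp] theorem zsmul_apply (c : ℤ) (α : SetFun p R) (T) : (c • α) T = c • α T := rfl

@[simp] theorem sum_apply {ι : Type*} (s : Finset ι) (f : ι → SetFun p R) (T) :
    (∑ i ∈ s, f i) T = ∑ i ∈ s, f i T := by
  change toFunHom (∑ i ∈ s, f i) T = _
  rw [map_sum, Finset.sum_apply]; rfl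

/-- The set function supported at `T` with value `r`. -/
def single (T : Finset (Fin n)) (r : R) : SetFun p R := ⟨fun S => if S = T then r else 0⟩

theorem single_apply (T S : Finset (Fin n)) (r : R) :
    (single T r : SetFun p R) S = if S = T then r else 0 := rfl

@[simp] theorem single_same (T : Finset (Fin n)) (r : R) : (single T r : SetFun p R) T = r :=
  if_pos rfl

@[simp] theorem single_zero (T : Finset (Fin n)) : (single T 0 : SetFun p R) = 0 := by
  ext; simp [single_apply]

theorem single_add (T : Finset (Fin n)) (r s : R) :
    (single T (r + s) : SetFun p R) = single T r + single T s := by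
  ext S; simp only [single_apply, add_apply]; split_ifs <;> simp

theorem single_smul (T : Finset (Fin n)) (c : K) (r : R) :
    (single T (c • r) : SetFun p R) = c • single T r := by
  ext S; simp only [single_apply, smul_apply]; split_ifs <;> simp

theorem single_zsmul (T : Finset (Fin n)) (c : ℤ) (r : R) :
    (single T (c • r) : SetFun p R) = c • single T r := by
  ext S; simp only [single_apply, zsmul_apply]; split_ifs <;> simp

theorem eq_sum_single (α : SetFun p R) : α = ∑ T, single T (α T) := by
  ext S
  rw [sum_apply]
  simp only [single_apply]
  exact (Fintype.sum_ite_eq S fun T => α T).symm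

/-- The tensor product here is the ungraded one: no sign is introduced when a coefficient passes a
monomial. For coefficients of the same parity as their monomials the commutation signs of the two
tensor factors cancel, which is all that is needed later. -/
instance : Mul (SetFun p R) where
  mul α β := ⟨fun S => ∑ T, ∑ U, if Disjoint T U ∧ T ∪ U = S then
    crossSign p T U • (α T * β U) else 0⟩

theorem mul_apply (α β : SetFun p R) (S : Finset (Fin n)) :
    (α * β) S = ∑ T, ∑ U, if Disjoint T U ∧ T ∪ U = S then
      crossSign p T U • (α T * β U) else 0 := rfl

instance : One (SetFun p R) := ⟨single ∅ 1⟩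

theorem one_def : (1 : SetFun p R) = single ∅ 1 := rfl

instance : NonUnitalNonAssocRing (SetFun p R) where
  left_distrib α β γ := by
    ext S
    simp only [mul_apply, add_apply, ← Finset.sum_add_distrib]
    refine Finset.sum_congr rfl fun T _ => Finset.sum_congr rfl fun U _ => ?_
    split_ifs <;> simp [mul_add]
  right_distrib α β γ := by
    ext S
    simp only [mul_apply, add_apply, ← Finset.sum_add_distrib]
    refine Finset.sum_congr rfl fun T _ => Finset.sum_congr rfl fun U _ => ?_
    split_ifs <;> simp [add_mul]
  zero_mul α := by ext S; simp [mul_apply]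
  mul_zero α := by ext S; simp [mul_apply]

theorem single_mul_single (T U : Finset (Fin n)) (r s : R) :
    (single T r * single U s : SetFun p R) =
      if Disjoint T U then single (T ∪ U) (crossSign p T U • (r * s)) else 0 := by
  ext S
  rw [mul_apply, Finset.sum_eq_single T, Finset.sum_eq_single U]
  · split_ifs with h1 h2 h2
    · simp [h1.2]
    · exact absurd h1.1 h2
    · simp only [single_apply]
      rw [if_neg]
      rintro rfl; exact h1 ⟨h2, rfl⟩
    · rfl
  · intro V _ hV; simp [single_apply, hV]
  · simp
  · intro V _ hV; simp [single_apply, hV]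
  · simp

theorem single_mul_single_of_disjoint {T U : Finset (Fin n)} (h : Disjoint T U) (r s : R) :
    (single T r * single U s : SetFun p R) = single (T ∪ U) (crossSign p T U • (r * s)) := by
  rw [single_mul_single, if_pos h]

/-- Associativity is the bimultiplicativity of `crossSign` under disjoint unions; if two of the sets
meet, both sides vanish. -/
theorem single_mul_assoc (T U V : Finset (Fin n)) (r s t : R) :
    (single T r * single U s * single V t : SetFun p R) =
      single T r * (single U s * single V t) := by
  rw [single_mul_single T U, single_mul_single U V]
  by_cases h1 : Disjoint T U <;> by_cases h2 : Disjoint U V <;> by_cases h3 : Disjoint T V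
  all_goals simp only [h1, h2, if_true, if_false, mul_zero, zero_mul, single_mul_single,
    Finset.disjoint_union_left, Finset.disjoint_union_right, h3, and_self, and_true, and_false]
  rw [crossSign_union_left p h1, crossSign_union_right p h2, Finset.union_assoc]
  congr 1
  simp only [smul_mul_assoc, mul_smul_comm, smul_smul, mul_assoc]
  congr 1; ring

instance : Ring (SetFun p R) where
  __ := (inferInstance : NonUnitalNonAssocRing (SetFun p R))
  mul_assoc α β γ := by
    rw [eq_sum_single α, eq_sum_single β, eq_sum_single γ]
    simp only [Finset.sum_mul, Finset.mul_sum, single_mul_assoc]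
  one := 1
  one_mul α := by
    rw [eq_sum_single α, Finset.mul_sum]
    refine Finset.sum_congr rfl fun T _ => ?_
    rw [one_def, single_mul_single]; simp
  mul_one α := by
    rw [eq_sum_single α, Finset.sum_mul]
    refine Finset.sum_congr rfl fun T _ => ?_
    rw [one_def, single_mul_single]; simp

instance : Algebra K (SetFun p R) := Algebra.ofModule
  (fun c α β => by
    ext S
    simp only [mul_apply, smul_apply, Finset.smul_sum]
    refine Finset.sum_congr rfl fun T _ => Finset.sum_congr rfl fun U _ => ?_
    split_ifs <;> simp)
  (fun c α β => by
    ext S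
    simp only [mul_apply, smul_apply, Finset.smul_sum]
    refine Finset.sum_congr rfl fun T _ => Finset.sum_congr rfl fun U _ => ?_
    split_ifs <;> simp)

theorem one_apply (T : Finset (Fin n)) : (1 : SetFun p R) T = if T = ∅ then 1 else 0 := rfl

@[simp] theorem one_apply_empty : (1 : SetFun p R) ∅ = 1 := rfl

theorem mul_apply_univ (α β : SetFun p R) :
    (α * β) Finset.univ = ∑ I, crossSign p I Iᶜ • (α I * β Iᶜ) := by
  rw [mul_apply]
  refine Finset.sum_congr rfl fun I _ => ?_
  rw [Finset.sum_eq_single Iᶜ]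
  · rw [if_pos ⟨disjoint_compl_right, Finset.union_compl I⟩]
  · intro U _ hU
    rw [if_neg]
    rintro ⟨h1, h2⟩
    exact hU (IsCompl.compl_eq ⟨h1, codisjoint_iff.mpr h2⟩).symm
  · simp

theorem mul_apply_empty (α β : SetFun p R) : (α * β) ∅ = α ∅ * β ∅ := by
  rw [mul_apply, Finset.sum_eq_single ∅, Finset.sum_eq_single ∅]
  · simp
  · intro U _ hU; rw [if_neg]; simpa using hU
  · simp
  · intro T _ hT
    refine Finset.sum_eq_zero fun U _ => ?_
    rw [if_neg]
    rintro ⟨_, h⟩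
    exact hT (Finset.union_eq_empty.mp h).1
  · simp

theorem mul_apply_congr {α α' β β' : SetFun p R} {S : Finset (Fin n)}
    (h1 : ∀ T U, Disjoint T U → T ∪ U = S → α T * β U = α' T * β' U) :
    (α * β) S = (α' * β') S := by
  rw [mul_apply, mul_apply]
  refine Finset.sum_congr rfl fun T _ => Finset.sum_congr rfl fun U _ => ?_
  split_ifs with h
  · rw [h1 T U h.1 h.2]
  · rfl

/-- The map of set functions induced by a linear map of the values. -/
def map (p : Fin n → ZMod 2) (f : R →ₗ[K] S) : SetFun p R →ₗ[K] SetFun p S where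
  toFun α := ⟨fun T => f (α T)⟩
  map_add' α β := by ext T; exact f.map_add _ _
  map_smul' c α := by ext T; exact f.map_smul _ _

@[simp] theorem map_apply (f : R →ₗ[K] S) (α : SetFun p R) (T) : map p f α T = f (α T) := rfl

theorem map_single (f : R →ₗ[K] S) (T : Finset (Fin n)) (r : R) :
    map p f (single T r) = single T (f r) := by
  ext U; simp only [map_apply, single_apply]; split_ifs <;> simp

theorem map_one {f : R →ₗ[K] S} (hf : f 1 = 1) : map p f 1 = 1 := by
  rw [one_def, map_single, hf]; rfl

theorem map_one_eq_zero {f : R →ₗ[K] S} (hf : f 1 = 0) : map p f 1 = 0 := by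
  rw [one_def, map_single, hf, single_zero]

end Basic

end SetFun

end

end DerivedBV

/-! ### Calculus of nilpotent exponentials and unipotent logarithms. -/

namespace DerivedBV

noncomputable section

/-! ### Exponential and logarithm of nilpotent and unipotent elements -/

section Nil

variable {K : Type*} [Field K] {E F : Type*} [Ring E] [Algebra K E] [Ring F] [Algebra K F]

/-- The value of a formal power series at a nilpotent element. -/
def nilSeries (c : ℕ → K) (x : E) : E := ∑ i ∈ Finset.range (nilpotencyClass x), c i • x ^ i

/-- Any exponent that kills `x` may serve as truncation length, so that series at different elements
can be compared at a common length. -/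
theorem nilSeries_eq_sum (c : ℕ → K) {x : E} {k : ℕ} (h : x ^ k = 0) :
    nilSeries c x = ∑ i ∈ Finset.range k, c i • x ^ i := by
  unfold nilSeries
  refine Finset.sum_subset (Finset.range_subset_range.mpr (csInf_le' h)) fun i _ hi => ?_
  rw [pow_eq_zero_of_le (by simpa using hi) (pow_nilpotencyClass ⟨k, h⟩), smul_zero]

theorem map_nilSeries (c : ℕ → K) (f : E →ₐ[K] F) {x : E} (hx : IsNilpotent x) :
    f (nilSeries c x) = nilSeries c (f x) := by
  obtain ⟨k, hk⟩ := hx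
  have hk' : f x ^ k = 0 := by rw [← map_pow, hk, map_zero]
  rw [nilSeries_eq_sum c hk, nilSeries_eq_sum c hk', map_sum]
  simp

theorem commute_nilSeries {x y : E} (h : Commute x y) (c : ℕ → K) :
    Commute x (nilSeries c y) :=
  Commute.sum_right _ _ _ fun i _ => (h.pow_right i).smul_right (c i)

theorem isNilpotent_nilSeries {c : ℕ → K} (hc : c 0 = 0) {x : E} (hx : IsNilpotent x) :
    IsNilpotent (nilSeries c x) := by
  obtain ⟨k, hk⟩ := hx
  have hk' : x ^ (k + 1) = 0 := by rw [pow_succ, hk, zero_mul]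
  rw [nilSeries_eq_sum c hk', Finset.sum_range_succ', hc]
  have : ∑ i ∈ Finset.range k, c (i + 1) • x ^ (i + 1) =
      x * ∑ i ∈ Finset.range k, c (i + 1) • x ^ i := by
    simp [Finset.mul_sum, pow_succ']
  rw [this, zero_smul, add_zero]
  refine Commute.isNilpotent_mul_right ?_ ⟨k, hk⟩
  exact Commute.sum_right _ _ _ fun i _ => ((Commute.refl x).pow_right i).smul_right (c (i + 1))

variable (K) in
/-- The exponential of a nilpotent element. -/
def nilExp (x : E) : E := nilSeries (fun i => ((i.factorial : K))⁻¹) x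

variable (K) in
/-- The logarithm of a unipotent element. -/
def nilLog (g : E) : E := nilSeries (fun i => (-1 : K) ^ (i - 1) / i) (g - 1)

theorem map_nilExp (f : E →ₐ[K] F) {x : E} (hx : IsNilpotent x) :
    f (nilExp K x) = nilExp K (f x) := map_nilSeries _ f hx

theorem map_nilLog (f : E →ₐ[K] F) {g : E} (hg : IsNilpotent (g - 1)) :
    f (nilLog K g) = nilLog K (f g) := by
  rw [nilLog, map_nilSeries _ f hg, map_sub, map_one]; rfl

theorem isNilpotent_nilLog {g : E} (hg : IsNilpotent (g - 1)) : IsNilpotent (nilLog K g) :=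
  -- The constant coefficient of the logarithm is (-1)^(0-1)/0, which is zero because division by
  -- zero gives zero.
  isNilpotent_nilSeries (by simp) hg

theorem commute_nilExp {x y : E} (h : Commute x y) : Commute x (nilExp K y) :=
  commute_nilSeries h _

theorem commute_nilLog {x y : E} (h : Commute x y) : Commute x (nilLog K y) :=
  commute_nilSeries (Commute.sub_right h (Commute.one_right x)) _

theorem nilExp_zero : nilExp K (0 : E) = 1 := by
  rw [nilExp, nilSeries_eq_sum _ (k := 1) (by simp)]; simp

theorem nilExp_of_mul_self_eq_zero {x : E} (h : x * x = 0) : nilExp K x = 1 + x := by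
  rw [nilExp, nilSeries_eq_sum _ (k := 2) (by rw [pow_two, h])]
  simp [Finset.sum_range_succ]

variable [CharZero K]

theorem nilExp_add {x y : E} (h : Commute x y) (hx : IsNilpotent x) (hy : IsNilpotent y) :
    nilExp K (x + y) = nilExp K x * nilExp K y := by
  -- Restricting scalars along ℚ → K identifies `nilExp` with `IsNilpotent.exp`, for which the
  -- addition theorem is available.
  let _ : Module ℚ E := Module.compHom E (algebraMap ℚ K)
  have key : ∀ z : E, nilExp K z = IsNilpotent.exp z := fun z => by
    unfold nilExp nilSeries IsNilpotent.exp
    refine Finset.sum_congr rfl fun i _ => ?_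
    change _ = (algebraMap ℚ K (i.factorial : ℚ)⁻¹) • z ^ i
    simp
  rw [key, key, key, IsNilpotent.exp_add_of_commute h hx hy]

theorem nilExp_mul_nilExp_neg {x : E} (hx : IsNilpotent x) : nilExp K x * nilExp K (-x) = 1 := by
  rw [← nilExp_add (Commute.refl x).neg_right hx hx.neg, add_neg_cancel, nilExp_zero]

theorem nilExp_neg_mul_nilExp {x : E} (hx : IsNilpotent x) : nilExp K (-x) * nilExp K x = 1 := by
  rw [← nilExp_add (Commute.refl x).neg_left hx.neg hx, neg_add_cancel, nilExp_zero]

-- Here e^x − 1 = x(1 + xy) with y a polynomial in x; the second factor is a unit because xy is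
-- nilpotent.
omit [CharZero K] in
theorem eq_zero_of_nilExp_eq_one {x : E} (hx : IsNilpotent x) (h : nilExp K x = 1) : x = 0 := by
  obtain ⟨k, hk⟩ := hx
  have hk' : x ^ (k + 2) = 0 := pow_eq_zero_of_le (by omega) hk
  rw [nilExp, nilSeries_eq_sum _ hk', Finset.sum_range_succ', Finset.sum_range_succ'] at h
  set y : E := ∑ i ∈ Finset.range k, (((i + 1 + 1).factorial : K))⁻¹ • x ^ i with hy
  have h1 : ∑ i ∈ Finset.range k, (((i + 1 + 1).factorial : K))⁻¹ • x ^ (i + 1 + 1) =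
      x * (x * y) := by
    simp [hy, Finset.mul_sum, pow_succ']
  have h2 : x * (1 + x * y) = 0 := by
    rw [h1] at h
    simp only [Nat.factorial_zero, Nat.factorial_one, Nat.cast_one, inv_one, one_smul, pow_zero,
      zero_add, pow_one] at h
    rw [mul_add, mul_one, add_comm]
    exact add_eq_right.mp h
  have hc : Commute x y :=
    Commute.sum_right _ _ _ fun i _ => ((Commute.refl x).pow_right i).smul_right _
  have h3 : IsUnit (1 + x * y) := (Commute.isNilpotent_mul_right hc ⟨k, hk⟩).isUnit_one_add
  exact h3.mul_left_eq_zero.mp h2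

theorem nilExp_injective {x y : E} (h : Commute x y) (hx : IsNilpotent x) (hy : IsNilpotent y)
    (hxy : nilExp K x = nilExp K y) : x = y := by
  rw [← sub_eq_zero]
  refine eq_zero_of_nilExp_eq_one (K := K) (h.isNilpotent_sub hx hy) ?_
  rw [sub_eq_add_neg, nilExp_add h.neg_right hx hy.neg, hxy, nilExp_mul_nilExp_neg hy]

open Polynomial in
/-- The truncations of the exponential and the logarithm are inverse to each other. -/
theorem truncated_exp_log (N : ℕ) :
    (X : K[X]) ^ (N + 1) ∣ (∑ m ∈ Finset.range (N + 1), C ((m.factorial : K)⁻¹) *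
      (∑ i ∈ Finset.range (N + 1), C ((-1 : K) ^ (i - 1) / i) * X ^ i) ^ m) - (1 + X) := by
  set P : K[X] := ∑ i ∈ Finset.range (N + 1), C ((-1 : K) ^ (i - 1) / i) * X ^ i with hP
  set Z : K[X] := ∑ m ∈ Finset.range (N + 1), C ((m.factorial : K)⁻¹) * P ^ m with hZ
  have hPX : X ∣ P := by
    rw [hP]
    refine Finset.dvd_sum fun i _ => ?_
    rcases i with _ | i
    · simp
    · exact Dvd.dvd.mul_left (dvd_pow_self X (by omega)) _
  -- The derivative of the truncated logarithm is a geometric sum, so (1 + X) P' = 1 holds up to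
  -- X^N.
  have hP' : (1 + X) * derivative P = 1 - (-X) ^ N := by
    have : derivative P = ∑ i ∈ Finset.range N, (-X) ^ i := by
      rw [hP, Finset.sum_range_succ', derivative_add, derivative_sum]
      simp only [derivative_C_mul, derivative_X_pow, Nat.add_sub_cancel]
      rw [Nat.cast_zero, C_0, zero_mul, mul_zero, add_zero]
      refine Finset.sum_congr rfl fun i _ => ?_
      have hi : ((i + 1 : ℕ) : K) ≠ 0 := Nat.cast_ne_zero.mpr (by omega)
      rw [← mul_assoc, ← C_mul, div_mul_cancel₀ _ hi, neg_pow (X : K[X]) i]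
      simp
    rw [this]
    have h := mul_neg_geom_sum (-X : K[X]) N
    rwa [sub_neg_eq_add] at h
  have hZ' : derivative Z = derivative P * (Z - C ((N.factorial : K)⁻¹) * P ^ N) := by
    rw [hZ, Finset.sum_range_succ, add_sub_cancel_right, ← Finset.sum_range_succ,
      Finset.sum_range_succ', derivative_add, derivative_sum]
    simp only [derivative_C_mul, derivative_pow, pow_zero, mul_one, derivative_C, add_zero,
      Finset.mul_sum]
    refine Finset.sum_congr rfl fun i _ => ?_
    have hi : ((i + 1 : ℕ) : K) ≠ 0 := Nat.cast_ne_zero.mpr (by omega)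
    have hi2 : (i.factorial : K) ≠ 0 := Nat.cast_ne_zero.mpr (Nat.factorial_ne_zero i)
    have : C (((i + 1).factorial : K)⁻¹) * C ((i + 1 : ℕ) : K) = C ((i.factorial : K)⁻¹) := by
      rw [← C_mul, Nat.factorial_succ, Nat.cast_mul]
      congr 1
      field_simp
    rw [Nat.add_sub_cancel, ← mul_assoc, ← mul_assoc, this]
    ring
  have hdiv : X ^ N ∣ (1 + X) * derivative Z - Z := by
    have : (1 + X) * derivative Z - Z =
        P ^ N * (-(1 - (-X) ^ N) * C ((N.factorial : K)⁻¹)) + X ^ N * (-(-1) ^ N * Z) := by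
      rw [hZ', ← mul_assoc, hP', neg_pow]; ring
    rw [this]
    exact dvd_add (Dvd.dvd.mul_right (pow_dvd_pow_of_dvd hPX N) _) (dvd_mul_right _ _)
  rw [X_pow_dvd_iff] at hdiv
  -- Coefficientwise reading of the differential equation (1 + X) Z' = Z modulo X^N. The factor 1 −
  -- i vanishes at i = 1, so the coefficient of X² and then all later ones are zero, leaving Z = 1 +
  -- X.
  have hrec : ∀ i, i < N → ((i + 1 : ℕ) : K) * Z.coeff (i + 1) = (1 - i) * Z.coeff i := by
    intro i hi
    have h := hdiv i hi
    rw [coeff_sub, add_mul, one_mul, coeff_add, coeff_derivative] at h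
    rcases i with _ | i
    · rw [mul_coeff_zero] at h
      simp at h
      simp
      linear_combination h
    · rw [coeff_X_mul, coeff_derivative] at h
      push_cast at h ⊢
      linear_combination h
  have h0 : Z.coeff 0 = 1 := by
    have : P.coeff 0 = 0 := by rwa [← X_dvd_iff]
    rw [hZ, finsetSum_coeff, Finset.sum_range_succ']
    simp [coeff_zero_eq_eval_zero] at this ⊢
    simp [this]
  have hge : ∀ i, i + 2 ≤ N → Z.coeff (i + 2) = 0 := by
    intro i
    induction i with
    | zero => 
      intro hi
      have h := hrec 1 (by omega)
      simpa using h
    | succ i ih =>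
      intro hi
      have h := hrec (i + 2) (by omega)
      rw [ih (by omega), mul_zero] at h
      exact (mul_eq_zero.mp h).resolve_left (Nat.cast_ne_zero.mpr (by omega))
  rw [X_pow_dvd_iff]
  intro i hi
  rw [coeff_sub, coeff_add, coeff_one, coeff_X]
  rcases i with _ | _ | i
  · simp [h0]
  · have h := hrec 0 (by omega)
    simp [h0] at h
    simp [h]
  · rw [hge i (by omega)]; simp

/-- The polynomial congruence is evaluated at u = g − 1, where X^(N+1) becomes zero. -/
theorem nilExp_nilLog {g : E} (hg : IsNilpotent (g - 1)) : nilExp K (nilLog K g) = g := by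
  obtain ⟨N, hN⟩ := hg
  set u := g - 1 with hu
  have hN' : u ^ (N + 1) = 0 := by rw [pow_succ, hN, zero_mul]
  have hl : nilLog K g = Polynomial.aeval u
      (∑ i ∈ Finset.range (N + 1), Polynomial.C ((-1 : K) ^ (i - 1) / i) * Polynomial.X ^ i) := by
    rw [nilLog, nilSeries_eq_sum _ hN', map_sum]
    simp [Algebra.smul_def]
  have hl' : nilLog K g ^ (N + 1) = 0 := by
    have hd : Polynomial.X ∣ (∑ i ∈ Finset.range (N + 1),
        Polynomial.C ((-1 : K) ^ (i - 1) / i) * Polynomial.X ^ i) := by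
      refine Finset.dvd_sum fun i _ => ?_
      rcases i with _ | i
      · simp
      · exact Dvd.dvd.mul_left (dvd_pow_self _ (by omega)) _
    obtain ⟨Q, hQ⟩ := hd
    rw [hl, ← map_pow, hQ, mul_pow, map_mul, map_pow, Polynomial.aeval_X, hN', zero_mul]
  obtain ⟨Q, hQ⟩ := truncated_exp_log (K := K) N
  have := congrArg (Polynomial.aeval u) hQ
  rw [map_sub, map_mul, map_pow, Polynomial.aeval_X, hN', zero_mul, sub_eq_zero] at this
  rw [nilExp, nilSeries_eq_sum _ hl']
  have h1 : ∑ i ∈ Finset.range (N + 1), ((i.factorial : K))⁻¹ • nilLog K g ^ i = 1 + u := by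
    rw [map_add, map_one, Polynomial.aeval_X] at this
    rw [← this, map_sum, hl]
    simp only [map_mul, map_pow, Polynomial.aeval_C, Algebra.smul_def]
  rw [h1, hu]; abel

omit [CharZero K] in
theorem isNilpotent_nilExp_sub_one {x : E} (hx : IsNilpotent x) :
    IsNilpotent (nilExp K x - 1) := by
  have h : nilExp K x - 1 = nilSeries (fun i => if i = 0 then 0 else ((i.factorial : K))⁻¹) x := by
    obtain ⟨k, hk⟩ := hx
    have hk' : x ^ (k + 1) = 0 := by rw [pow_succ, hk, zero_mul]
    rw [nilExp, nilSeries_eq_sum _ hk', nilSeries_eq_sum _ hk', Finset.sum_range_succ',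
      Finset.sum_range_succ']
    simp
  rw [h]
  exact isNilpotent_nilSeries (by simp) hx

/-- Injectivity of the exponential on commuting nilpotents turns the other composite into this one,
without a second polynomial identity. -/
theorem nilLog_nilExp {x : E} (hx : IsNilpotent x) : nilLog K (nilExp K x) = x := by
  have h := isNilpotent_nilExp_sub_one (K := K) hx
  exact nilExp_injective (K := K) (commute_nilLog (commute_nilExp (Commute.refl x))).symm
    (isNilpotent_nilLog h) hx (nilExp_nilLog h)

/-- First-order expansion of the logarithm: 1 + w = e^w when w² = 0. It computes how a cumulant
depends on one additional argument. -/
theorem nilLog_mul_one_add {g w : E} (hg : IsNilpotent (g - 1)) (hgw : Commute g w)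
    (hw : w * w = 0) : nilLog K (g * (1 + w)) = nilLog K g + w := by
  have hc : Commute w (nilLog K g) := commute_nilLog hgw.symm
  have hwn : IsNilpotent w := ⟨2, by rw [pow_two, hw]⟩
  have hl := isNilpotent_nilLog (K := K) hg
  conv_lhs => rw [← nilExp_nilLog (K := K) hg, ← nilExp_of_mul_self_eq_zero (K := K) hw,
    ← nilExp_add hc.symm hl hwn]
  exact nilLog_nilExp (hc.symm.isNilpotent_add hl hwn)

/-- The derivative of the logarithm is the inverse. -/
theorem sum_log_derivative {g gi : E} (hgi : g * gi = 1) {N : ℕ} (hN : (g - 1) ^ N = 0) :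
    ∑ i ∈ Finset.range N, (((-1 : K) ^ i / ((i + 1 : ℕ) : K)) * ((i + 1 : ℕ) : K)) • (g - 1) ^ i =
      gi := by
  -- The unsimplified coefficient is that of (g − 1)^(i+1) in the logarithm times the exponent i +
  -- 1, as a derivation applied termwise produces it.
  have h1 : ∀ i ∈ Finset.range N, (((-1 : K) ^ i / ((i + 1 : ℕ) : K)) * ((i + 1 : ℕ) : K)) •
      (g - 1) ^ i = (-(g - 1)) ^ i := by
    intro i _
    rw [div_mul_cancel₀ _ (Nat.cast_ne_zero.mpr (by omega)), neg_pow (g - 1) i,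
      Algebra.smul_def]
    simp
  rw [Finset.sum_congr rfl h1]
  have h := geom_sum_mul_neg (-(g - 1)) N
  rw [neg_pow (g - 1), hN, mul_zero, sub_zero, sub_neg_eq_add, add_sub_cancel] at h
  calc _ = (∑ i ∈ Finset.range N, (-(g - 1)) ^ i) * (g * gi) := by rw [hgi, mul_one]
    _ = gi := by rw [← mul_assoc, h, one_mul]

end Nil

end

end DerivedBV

/-! ### Brackets and cumulants as coefficients of exponentials and logarithms. -/

namespace DerivedBV

noncomputable section

variable {K : Type*} [Field K]

/-! ### Ordered products over blocks -/

section BlockProd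

variable {k : ℕ} {M : Type*} [Monoid M]

@[simp] theorem blockProd_empty (a : Fin k → M) : blockProd ∅ a = 1 := by
  simp [blockProd]

theorem blockProd_insert {m : Fin k} {T : Finset (Fin k)} (h : ∀ i ∈ T, m < i) (a : Fin k → M) :
    blockProd (insert m T) a = a m * blockProd T a := by
  unfold blockProd
  rw [Finset.sort_insert (r := (· ≤ ·)) (fun b hb => (h b hb).le) (fun hm => (h m hm).ne rfl)]
  simp

theorem blockProd_univ (a : Fin k → M) : blockProd Finset.univ a = (List.ofFn a).prod := by
  rw [blockProd, Fin.sort_univ, List.ofFn_eq_map]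

theorem blockProd_const (I : Finset (Fin k)) (x : M) : blockProd I (fun _ => x) = x ^ I.card := by
  rw [blockProd, List.map_const', List.prod_replicate, Finset.length_sort]

theorem blockProd_congr {I : Finset (Fin k)} {a b : Fin k → M} (h : ∀ i ∈ I, a i = b i) :
    blockProd I a = blockProd I b := by
  unfold blockProd
  congr 1
  exact List.map_congr_left fun i hi => h i (by simpa using hi)

theorem map_blockProd {N F : Type*} [Monoid N] [FunLike F M N] [MonoidHomClass F M N] (f : F)
    (I : Finset (Fin k)) (a : Fin k → M) :
    f (blockProd I a) = blockProd I (fun i => f (a i)) := by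
  simp [blockProd, map_list_prod, Function.comp_def]

/-- An index of the block occurs exactly once in its sorted list. This normal form is the source of
additivity in each argument and of compatibility with scalars and with t, for brackets and cumulants
alike. -/
theorem exists_blockProd_update {I : Finset (Fin k)} {i : Fin k} (hi : i ∈ I) (a : Fin k → M) :
    ∃ L R : M, ∀ x, blockProd I (Function.update a i x) = L * x * R := by
  have hi' : i ∈ I.sort (· ≤ ·) := by simpa using hi
  obtain ⟨l1, l2, hl⟩ := List.append_of_mem hi'
  have hn : (l1 ++ i :: l2).Nodup := hl ▸ Finset.sort_nodup I (· ≤ ·)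
  rw [List.nodup_append] at hn
  obtain ⟨-, h2, h3⟩ := hn
  refine ⟨(l1.map a).prod, (l2.map a).prod, fun x => ?_⟩
  unfold blockProd
  rw [hl, List.map_append, List.map_cons, List.prod_append, List.prod_cons, Function.update_self,
    mul_assoc]
  congr 2
  · refine List.map_congr_left fun j hj => Function.update_of_ne ?_ _ _
    exact h3 j hj i (by simp)
  · congr 1
    refine List.map_congr_left fun j hj => Function.update_of_ne ?_ _ _
    rintro rfl
    exact (List.nodup_cons.mp h2).1 hj

theorem blockProd_update_of_notMem {I : Finset (Fin k)} {i : Fin k} (hi : i ∉ I) (a : Fin k → M)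
    (x : M) : blockProd I (Function.update a i x) = blockProd I a :=
  blockProd_congr fun j hj => Function.update_of_ne (by rintro rfl; exact hi hj) _ _

end BlockProd

section BlockProdLinear

variable {k : ℕ} {R : Type*} [Ring R] [Algebra K R]

/-- The multilinear map `a ↦ D(a_I) a_{Iᶜ}`. -/
def blockMultilinear (I : Finset (Fin k)) (D : R →ₗ[K] R) :
    MultilinearMap K (fun _ : Fin k => R) R where
  toFun a := D (blockProd I a) * blockProd Iᶜ a
  map_update_add' {inst} a i x y := by
    obtain rfl : inst = instDecidableEqFin k := Subsingleton.elim _ _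
    by_cases hi : i ∈ I
    · obtain ⟨l, r, h⟩ := exists_blockProd_update hi a
      have hi' : i ∉ Iᶜ := by simpa using hi
      simp only [h, blockProd_update_of_notMem hi', mul_add, add_mul, map_add]
    · have hi' : i ∈ Iᶜ := by simpa using hi
      obtain ⟨l, r, h⟩ := exists_blockProd_update hi' a
      simp only [h, blockProd_update_of_notMem hi, mul_add, add_mul]
  map_update_smul' {inst} a i c x := by
    obtain rfl : inst = instDecidableEqFin k := Subsingleton.elim _ _
    by_cases hi : i ∈ I
    · obtain ⟨l, r, h⟩ := exists_blockProd_update hi a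
      have hi' : i ∉ Iᶜ := by simpa using hi
      simp only [h, blockProd_update_of_notMem hi', mul_smul_comm, smul_mul_assoc, map_smul]
    · have hi' : i ∈ Iᶜ := by simpa using hi
      obtain ⟨l, r, h⟩ := exists_blockProd_update hi' a
      simp only [h, blockProd_update_of_notMem hi, mul_smul_comm, smul_mul_assoc]

theorem blockMultilinear_apply (I : Finset (Fin k)) (D : R →ₗ[K] R) (a : Fin k → R) :
    blockMultilinear I D a = D (blockProd I a) * blockProd Iᶜ a := rfl

theorem blockProd_neg (I : Finset (Fin k)) (a : Fin k → R) :
    blockProd I (fun i => -a i) = (-1) ^ I.card * blockProd I a := by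
  induction I using Finset.induction_on_min with
  | empty => simp
  | insert m I hm ih =>
    rw [blockProd_insert hm, blockProd_insert hm, ih, Finset.card_insert_of_notMem
      fun h => (hm m h).ne rfl, pow_succ]
    rcases neg_one_pow_eq_or R I.card with h | h <;> simp [h]

/-- The exponential of a sum of commuting square-zero elements is the product of the factors 1 +
z_i, expanded over subsets. -/
theorem nilExp_sum_of_mul_self_eq_zero [CharZero K] {z : Fin k → R} (hz : ∀ i, z i * z i = 0)
    (hc : ∀ i j, Commute (z i) (z j)) (T : Finset (Fin k)) :
    IsNilpotent (∑ i ∈ T, z i) ∧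
      nilExp K (∑ i ∈ T, z i) = ∑ I ∈ T.powerset, blockProd I z := by
  induction T using Finset.induction_on_min with
  | empty => exact ⟨by simp, by simp [nilExp_zero]⟩
  | insert m T hm ih =>
    have hmT : m ∉ T := fun h => (hm m h).ne rfl
    have hcm : Commute (z m) (∑ i ∈ T, z i) := Commute.sum_right _ _ _ fun i _ => hc m i
    have hnm : IsNilpotent (z m) := ⟨2, by rw [pow_two, hz]⟩
    rw [Finset.sum_insert hmT]
    refine ⟨hcm.isNilpotent_add hnm ih.1, ?_⟩
    rw [nilExp_add hcm hnm ih.1, ih.2, nilExp_of_mul_self_eq_zero (hz m),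
      Finset.sum_powerset_insert hmT, add_mul, one_mul, Finset.mul_sum]
    congr 1
    refine Finset.sum_congr rfl fun I hI => ?_
    rw [blockProd_insert fun i hi => hm i (Finset.mem_powerset.mp hI hi)]

end BlockProdLinear

/-! ### Homogeneous Koszul brackets and cumulants -/

section Signed

variable {R S : Type*} [Ring R] [Algebra K R] [Ring S] [Algebra K S] {n : ℕ}

/-- The Koszul bracket on arguments of parities `p`. -/
def signedKoszul (p : Fin n → ZMod 2) (D : R →ₗ[K] R) (a : Fin n → R) : R :=
  ∑ I : Finset (Fin n) with I.Nonempty, (koszulSign p (unshuffle I) * (-1) ^ (n - I.card)) •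
    (D (blockProd I a) * blockProd Iᶜ a)

/-- The cumulant on arguments of parities `p`. -/
def signedCumulant (p : Fin n → ZMod 2) (f : R →ₗ[K] S) (a : Fin n → R) : S :=
  ∑ k ∈ Finset.Icc 1 n, ((-1 : K) ^ (k - 1) * ((k - 1).factorial : K) / (k.factorial : K)) •
    ∑ φ : {φ : Fin n → Fin k // Function.Surjective φ}, koszulSign p φ.1 •
      (List.ofFn (fun j : Fin k => f (blockProd (block φ.1 j) a))).prod

theorem koszulBracket_eq_sum (π : ZMod 2 → R →ₗ[K] R) (D : R →ₗ[K] R) (a : Fin n → R) :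
    koszulBracket π D n a = ∑ p, signedKoszul p D (fun i => π (p i) (a i)) := rfl

theorem cumulant_eq_sum (π : ZMod 2 → R →ₗ[K] R) (f : R →ₗ[K] S) (a : Fin n → R) :
    cumulant π f n a = ∑ p, signedCumulant p f (fun i => π (p i) (a i)) := rfl

theorem signedKoszul_eq_sum (p : Fin n → ZMod 2) {D : R →ₗ[K] R} (hD : D 1 = 0) (a : Fin n → R) :
    signedKoszul p D a = ∑ I, ((-1 : ℤ) ^ Iᶜ.card) • (crossSign p I Iᶜ •
      (D (blockProd I a) * blockProd Iᶜ a)) := by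
  rw [signedKoszul]
  refine Eq.trans (Finset.sum_congr rfl fun I _ => ?_) (Finset.sum_subset (Finset.subset_univ _) ?_)
  · rw [koszulSign_unshuffle, mul_comm, mul_smul, Finset.card_compl, Fintype.card_fin]
  · intro I _ hI
    have : I = ∅ := by simpa using hI
    simp [this, hD]

end Signed

/-! ### Families of disjoint subsets -/

section Family

variable {n k : ℕ} (p : Fin n → ZMod 2) (S : Fin k → Finset (Fin n))

/-- The sign of the rearrangement that lists the subsets `S j`, `j ∈ T`, one after the other. -/
def famSign (T : Finset (Fin k)) : ℤ :=
  ∏ a ∈ T, ∏ b ∈ T, if a < b then crossSign p (S a) (S b) else 1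

/-- The parities of the monomials of the subsets `S j`. -/
def famParity (j : Fin k) : ZMod 2 := ∑ i ∈ S j, p i

@[simp] theorem famSign_empty : famSign p S ∅ = 1 := by simp [famSign]

@[simp] theorem famSign_singleton (j : Fin k) : famSign p S {j} = 1 := by simp [famSign]

variable {S} (hS : ∀ i j, i ≠ j → Disjoint (S i) (S j))
include hS

/-- This is the cocycle identity that makes the substitution of ε_(S j) for ε_j multiplicative. A
pair (a, b) in T × U with b < a is listed in the opposite order in T ∪ U, and the correcting sign is
the one for swapping two monomials of parities `famParity`. -/
theorem famSign_union {T U : Finset (Fin k)} (h : Disjoint T U) :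
    famSign p S (T ∪ U) * crossSign (famParity p S) T U =
      crossSign p (T.biUnion S) (U.biUnion S) * (famSign p S T * famSign p S U) := by
  have key : (∏ a ∈ T, ∏ b ∈ U, if a < b then crossSign p (S a) (S b) else 1) *
      (∏ a ∈ U, ∏ b ∈ T, if a < b then crossSign p (S a) (S b) else 1) *
      crossSign (famParity p S) T U = crossSign p (T.biUnion S) (U.biUnion S) := by
    rw [crossSign_biUnion p S hS, Finset.prod_comm (s := U)]
    unfold crossSign
    rw [← Finset.prod_mul_distrib, ← Finset.prod_mul_distrib]
    refine Finset.prod_congr rfl fun a ha => ?_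
    rw [← Finset.prod_mul_distrib, ← Finset.prod_mul_distrib]
    refine Finset.prod_congr rfl fun b hb => ?_
    have hab : a ≠ b := by rintro rfl; exact Finset.disjoint_left.mp h ha hb
    rw [← crossSign, ← crossSign]
    unfold inversionSign
    rcases lt_or_gt_of_ne hab with hlt | hlt
    · simp [hlt, hlt.not_gt]
    · simp only [hlt, hlt.not_gt, if_true, if_false, one_mul]
      unfold famParity
      rw [← crossSign_mul_swap p (hS a b hab), mul_comm, mul_assoc, crossSign_mul_self, mul_one]
  rw [← key]
  unfold famSign
  rw [Finset.prod_union h]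
  simp_rw [Finset.prod_union h, Finset.prod_mul_distrib]
  ring

theorem famSign_insert {m : Fin k} {T : Finset (Fin k)} (h : ∀ i ∈ T, m < i) :
    famSign p S (insert m T) = crossSign p (S m) (T.biUnion S) * famSign p S T := by
  have hm : m ∉ T := fun hmT => (h m hmT).ne rfl
  have h1 := famSign_union p hS (T := {m}) (U := T) (by simpa using hm)
  rw [crossSign_eq_one_of_lt _ (by simpa using h)] at h1
  simpa [Finset.singleton_union] using h1

omit hS in
theorem famSign_univ_block (φ : Fin n → Fin k) :
    famSign p (block φ) Finset.univ = koszulSign p φ :=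
  (koszulSign_eq_prod_block p φ).symm

omit hS in
theorem block_disjoint (φ : Fin n → Fin k) (i j : Fin k) (h : i ≠ j) :
    Disjoint (block φ i) (block φ j) := by
  rw [Finset.disjoint_left]
  intro x hx hy
  simp only [block, Finset.mem_filter, Finset.mem_univ, true_and] at hx hy
  exact h (hx.symm.trans hy)

omit hS in
theorem biUnion_block (φ : Fin n → Fin k) : Finset.univ.biUnion (block φ) = Finset.univ := by
  ext i; simp [block]

omit hS in
theorem block_nonempty {φ : Fin n → Fin k} (h : Function.Surjective φ) (j : Fin k) :
    (block φ j).Nonempty := by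
  obtain ⟨i, hi⟩ := h j
  exact ⟨i, by simp [block, hi]⟩

theorem disjoint_biUnion {T U : Finset (Fin k)} (h : Disjoint T U) :
    Disjoint (T.biUnion S) (U.biUnion S) := by
  rw [Finset.disjoint_biUnion_left]
  intro i hi
  rw [Finset.disjoint_biUnion_right]
  intro j hj
  refine hS i j ?_
  rintro rfl
  exact Finset.disjoint_left.mp h hi hj

end Family

namespace SetFun

variable {n k : ℕ} {p : Fin n → ZMod 2} {R : Type*} [Ring R] [Algebra K R]

theorem blockProd_single {S : Fin k → Finset (Fin n)} (hS : ∀ i j, i ≠ j → Disjoint (S i) (S j))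
    (b : Fin k → R) (T : Finset (Fin k)) :
    blockProd T (fun j => (single (S j) (b j) : SetFun p R)) =
      single (T.biUnion S) (famSign p S T • blockProd T b) := by
  induction T using Finset.induction_on_min with
  | empty => simp [one_def]
  | insert m T hm ih =>
    have hmT : m ∉ T := fun h => (hm m h).ne rfl
    have hd : Disjoint (S m) (T.biUnion S) := by
      simpa using disjoint_biUnion hS (T := {m}) (U := T) (by simpa using hmT)
    rw [blockProd_insert hm, blockProd_insert hm, ih, single_mul_single_of_disjoint hd,
      famSign_insert p hS hm, Finset.biUnion_insert, mul_smul_comm, smul_smul]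

/-- Since the variables square to zero, only families of disjoint sets survive; this discards the
spurious terms of the multinomial expansion. -/
theorem blockProd_single_ne_zero {S : Fin k → Finset (Fin n)} {b : Fin k → R}
    {T : Finset (Fin k)} {V : Finset (Fin n)}
    (h : blockProd T (fun j => (single (S j) (b j) : SetFun p R)) V ≠ 0) :
    V = T.biUnion S ∧ ∀ i ∈ T, ∀ j ∈ T, i ≠ j → Disjoint (S i) (S j) := by
  induction T using Finset.induction_on_min generalizing V with
  | empty => 
    rw [blockProd_empty, one_apply] at h
    exact ⟨by simpa using fun h' => h (if_neg h'), by simp⟩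
  | insert m T hm ih =>
    rw [blockProd_insert hm, mul_apply] at h
    obtain ⟨V1, -, h⟩ := Finset.exists_ne_zero_of_sum_ne_zero h
    obtain ⟨V2, -, h⟩ := Finset.exists_ne_zero_of_sum_ne_zero h
    have h1 : Disjoint V1 V2 ∧ V1 ∪ V2 = V := by
      by_contra h'; exact h (if_neg h')
    rw [if_pos h1] at h
    have h2 : V1 = S m := by
      by_contra h'
      rw [single_apply, if_neg h', zero_mul, smul_zero] at h
      exact h rfl
    obtain ⟨rfl, h3⟩ := ih (V := V2) (fun h' => by rw [h', mul_zero, smul_zero] at h; exact h rfl)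
    subst h2
    have h4 : ∀ j ∈ T, Disjoint (S m) (S j) := fun j hj =>
      h1.1.mono_right (Finset.subset_biUnion_of_mem S hj)
    refine ⟨by rw [Finset.biUnion_insert, h1.2], ?_⟩
    intro i hi j hj hij
    rcases Finset.mem_insert.mp hi with rfl | hi' <;> rcases Finset.mem_insert.mp hj with rfl | hj'
    · exact absurd rfl hij
    · exact h4 j hj'
    · exact (h4 i hi').symm
    · exact h3 i hi' j hj' hij

/-- Every factor of a nonzero term uses at least one index, because the coefficient at ∅ vanishes.
-/
theorem pow_apply_eq_zero {α : SetFun p R} (hα : α ∅ = 0) (k : ℕ) (T : Finset (Fin n))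
    (hT : T.card < k) : (α ^ k) T = 0 := by
  induction k generalizing T with
  | zero => omega
  | succ k ih =>
    rw [pow_succ, mul_apply]
    refine Finset.sum_eq_zero fun U _ => Finset.sum_eq_zero fun V _ => ?_
    split_ifs with h
    · rcases V.eq_empty_or_nonempty with rfl | hV
      · rw [hα, mul_zero, smul_zero]
      · have := Finset.card_union_of_disjoint h.1
        rw [h.2] at this
        have := hV.card_pos
        rw [ih U (by omega), zero_mul, smul_zero]
    · rfl

theorem pow_eq_zero {α : SetFun p R} (hα : α ∅ = 0) : α ^ (n + 1) = 0 := by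
  ext T
  refine pow_apply_eq_zero hα _ T ?_
  have := T.card_le_univ
  simp at this
  omega

theorem isNilpotent {α : SetFun p R} (hα : α ∅ = 0) : IsNilpotent α := ⟨n + 1, pow_eq_zero hα⟩

/-- Expansion of a monomial in a set function over ordered decompositions into blocks. -/
theorem map_pow_mul_pow_univ {α : SetFun p R} (hα : α ∅ = 0) (I : Finset (Fin k))
    (D : R →ₗ[K] R) :
    (map p D (α ^ I.card) * α ^ Iᶜ.card) Finset.univ =
      ∑ φ : {φ : Fin n → Fin k // Function.Surjective φ}, koszulSign p φ.1 •
        (crossSign (famParity p (block φ.1)) I Iᶜ •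
          (D (blockProd I fun j => α (block φ.1 j)) * blockProd Iᶜ fun j => α (block φ.1 j))) := by
  have h1 : map p D (α ^ I.card) * α ^ Iᶜ.card =
      ∑ r : Fin k → Finset (Fin n), blockMultilinear I (map p D)
        (fun j => (single (r j) (α (r j)) : SetFun p R)) := by
    rw [← blockProd_const I α, ← blockProd_const Iᶜ α, ← blockMultilinear_apply]
    conv_lhs => rw [eq_sum_single α]
    exact MultilinearMap.map_sum (blockMultilinear I (map p D)) _
  rw [h1, sum_apply]
  symm
  refine Finset.sum_of_injOn (fun φ => block φ.1) ?_ (fun _ _ => Finset.mem_univ _) ?_ ?_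
  · intro φ _ ψ _ h
    ext i
    have : i ∈ block φ.1 (φ.1 i) := by simp [block]
    dsimp only at h
    rw [h] at this
    simp only [block, Finset.mem_filter, Finset.mem_univ, true_and] at this
    rw [this]
  -- A choice of sets that contributes to the top coefficient consists of nonempty sets, as α ∅ = 0,
  -- which are disjoint and cover all indices. Such a choice is the family of fibres of a unique
  -- surjection.
  · intro r _ hr
    by_contra hne
    apply hr
    have hemp : ∀ j, (r j).Nonempty := by
      intro j
      by_contra hj
      rw [Finset.not_nonempty_iff_eq_empty] at hj
      refine hne ?_
      rw [MultilinearMap.map_coord_zero _ j (by simp [hj, hα])]; rfl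
    rw [blockMultilinear_apply, mul_apply_univ] at hne
    obtain ⟨J, -, hJ⟩ := Finset.exists_ne_zero_of_sum_ne_zero hne
    have e1 := blockProd_single_ne_zero (p := p) (S := r) (b := fun j => α (r j)) (T := I) (V := J)
      (fun h' => by rw [map_apply, h', map_zero, zero_mul, smul_zero] at hJ; exact hJ rfl)
    have e2 := blockProd_single_ne_zero (p := p) (S := r) (b := fun j => α (r j)) (T := Iᶜ)
      (V := Jᶜ) (fun h' => by rw [h', mul_zero, smul_zero] at hJ; exact hJ rfl)
    have hd : ∀ i j, i ≠ j → Disjoint (r i) (r j) := by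
      have hcr : ∀ i ∈ I, ∀ j ∈ Iᶜ, Disjoint (r i) (r j) := fun i hi j hj => by
        have := (disjoint_compl_right : Disjoint J Jᶜ)
        rw [e2.1] at this
        exact (this.mono_left (e1.1 ▸ Finset.subset_biUnion_of_mem r hi)).mono_right
          (Finset.subset_biUnion_of_mem r hj)
      intro i j hij
      by_cases hi : i ∈ I <;> by_cases hj : j ∈ I
      · exact e1.2 i hi j hj hij
      · exact hcr i hi j (by simpa using hj)
      · exact (hcr j hj i (by simpa using hi)).symm
      · exact e2.2 i (by simpa using hi) j (by simpa using hj) hij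
    have hcov : ∀ i, ∃ j, i ∈ r j := by
      intro i
      by_cases hi : i ∈ J
      · rw [e1.1] at hi
        obtain ⟨j, -, hj⟩ := Finset.mem_biUnion.mp hi
        exact ⟨j, hj⟩
      · have hi' : i ∈ Jᶜ := by simpa using hi
        rw [e2.1] at hi'
        obtain ⟨j, -, hj⟩ := Finset.mem_biUnion.mp hi'
        exact ⟨j, hj⟩
    choose φ hφ using hcov
    have huniq : ∀ i j, i ∈ r j → φ i = j := fun i j hij => by
      by_contra hne'
      exact Finset.disjoint_left.mp (hd _ _ hne') (hφ i) hij
    refine ⟨⟨φ, fun j => ?_⟩, by simp, ?_⟩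
    · obtain ⟨i, hi⟩ := hemp j
      exact ⟨i, huniq i j hi⟩
    · funext j
      ext i
      simp only [block, Finset.mem_filter, Finset.mem_univ, true_and]
      exact ⟨fun h => h ▸ hφ i, huniq i j⟩
  · intro φ _
    have hS := block_disjoint φ.1
    rw [blockMultilinear_apply, blockProd_single hS, blockProd_single hS, map_single,
      single_mul_single_of_disjoint (disjoint_biUnion hS disjoint_compl_right),
      ← Finset.union_biUnion, Finset.union_compl, biUnion_block, single_same, map_zsmul,
      smul_mul_smul_comm, smul_smul, smul_smul]
    have h2 := famSign_union p hS (disjoint_compl_right (a := I))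
    rw [Finset.union_compl, famSign_univ_block] at h2
    rw [h2]

/-- In generating functions this reads ∑ (1/k!) K(D)_k(α, …, α) = D(e^α) e^(-α). The subsets I of k
places are counted by cardinality, and the binomial coefficient splits 1/k! into 1/i! and 1/(k −
i)!. No commutativity of the values is used. -/
theorem sum_signedKoszul [CharZero K] {α : SetFun p R} (hα : α ∅ = 0) {D : R →ₗ[K] R}
    (hD : D 1 = 0) :
    ∑ k ∈ Finset.Icc 1 n, (1 / (k.factorial : K)) •
      ∑ φ : {φ : Fin n → Fin k // Function.Surjective φ}, koszulSign p φ.1 •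
        signedKoszul (famParity p (block φ.1)) D (fun j => α (block φ.1 j)) =
      (map p D (nilExp K α) * nilExp K (-α)) Finset.univ := by
  have hα' : (-α) ^ (n + 1) = 0 := by rw [neg_pow, pow_eq_zero hα, mul_zero]
  set G : ℕ → ℕ → R := fun i j => (((i.factorial : K))⁻¹ * ((j.factorial : K))⁻¹) •
    ((-1 : ℤ) ^ j • (map p D (α ^ i) * α ^ j) Finset.univ) with hG
  -- The powers α^i and α^j need at least i + j indices, so the square of index pairs in the product
  -- of the two truncated exponentials reduces to the triangle i + j ≤ n.
  have hG0 : ∀ i j, n < i + j → G i j = 0 := by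
    intro i j hij
    have : (map p D (α ^ i) * α ^ j) Finset.univ = 0 := by
      rw [mul_apply_univ]
      refine Finset.sum_eq_zero fun I _ => ?_
      have hc := Finset.card_compl I
      have hc' := I.card_le_univ
      rw [Fintype.card_fin] at hc hc'
      rcases lt_or_ge I.card i with h | h
      · rw [map_apply, pow_apply_eq_zero hα i I h, map_zero, zero_mul, smul_zero]
      · rw [pow_apply_eq_zero hα j Iᶜ (by omega), mul_zero, smul_zero]
    simp [hG, this]
  have hL : ∀ k ∈ Finset.Icc 1 n, (1 / (k.factorial : K)) •
      ∑ φ : {φ : Fin n → Fin k // Function.Surjective φ}, koszulSign p φ.1 •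
        signedKoszul (famParity p (block φ.1)) D (fun j => α (block φ.1 j)) =
      ∑ ij ∈ Finset.HasAntidiagonal.antidiagonal k, G ij.1 ij.2 := by
    intro k _
    have h1 : ∑ φ : {φ : Fin n → Fin k // Function.Surjective φ}, koszulSign p φ.1 •
        signedKoszul (famParity p (block φ.1)) D (fun j => α (block φ.1 j)) =
        ∑ I : Finset (Fin k), (-1 : ℤ) ^ (k - I.card) •
          (map p D (α ^ I.card) * α ^ (k - I.card)) Finset.univ := by
      simp_rw [signedKoszul_eq_sum _ hD, Finset.smul_sum]
      rw [Finset.sum_comm]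
      refine Finset.sum_congr rfl fun I _ => ?_
      have hc : Iᶜ.card = k - I.card := by rw [Finset.card_compl, Fintype.card_fin]
      rw [← hc, map_pow_mul_pow_univ hα, Finset.smul_sum]
      exact Finset.sum_congr rfl fun φ _ => smul_comm _ _ _
    have h2 := Finset.sum_powerset_apply_card (x := (Finset.univ : Finset (Fin k))) (fun i =>
      (-1 : ℤ) ^ (k - i) • (map p D (α ^ i) * α ^ (k - i)) Finset.univ)
    rw [Finset.powerset_univ, Finset.card_univ, Fintype.card_fin] at h2
    rw [h1, h2, Finset.Nat.sum_antidiagonal_eq_sum_range_succ G, Finset.smul_sum]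
    refine Finset.sum_congr rfl fun i hi => ?_
    have hi' : i ≤ k := by simpa [Nat.lt_succ_iff] using hi
    rw [← Nat.cast_smul_eq_nsmul K, smul_smul, hG]
    dsimp only
    congr 1
    rw [Nat.cast_choose K hi']
    have hk0 : (k.factorial : K) ≠ 0 := Nat.cast_ne_zero.mpr (Nat.factorial_ne_zero k)
    field_simp
  rw [Finset.sum_congr rfl hL]
  have hR : (map p D (nilExp K α) * nilExp K (-α)) Finset.univ =
      ∑ i ∈ Finset.range (n + 1), ∑ j ∈ Finset.range (n + 1), G i j := by
    rw [nilExp, nilExp, nilSeries_eq_sum _ (pow_eq_zero hα), nilSeries_eq_sum _ hα', map_sum,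
      Finset.sum_mul, sum_apply]
    refine Finset.sum_congr rfl fun i _ => ?_
    rw [Finset.mul_sum, sum_apply]
    refine Finset.sum_congr rfl fun j _ => ?_
    rw [map_smul, smul_mul_smul_comm, smul_apply, hG]
    dsimp only
    congr 1
    rcases neg_one_pow_eq_or ℤ j with h | h
    all_goals
      have h' : ((-1 : SetFun p R)) ^ j = (((-1 : ℤ) ^ j : ℤ) : SetFun p R) := by simp
      rw [neg_pow, h', h]
      simp
  rw [hR, ← Finset.sum_product' _ _ (fun i j => G i j)]
  have h3 : ∑ x ∈ Finset.range (n + 1) ×ˢ Finset.range (n + 1), G x.1 x.2 =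
      ∑ x ∈ (Finset.range (n + 1) ×ˢ Finset.range (n + 1)).filter (fun x => x.1 + x.2 ≤ n),
        G x.1 x.2 := by
    symm
    refine Finset.sum_subset (Finset.filter_subset _ _) fun x hx hx' => hG0 _ _ ?_
    simp only [Finset.mem_filter, not_and, not_le] at hx'
    exact hx' hx
  rw [h3, ← Finset.sum_fiberwise_of_maps_to (g := fun x : ℕ × ℕ => x.1 + x.2)
    (t := Finset.range (n + 1)) (fun x hx => by
      simp only [Finset.mem_filter, Finset.mem_range] at hx ⊢; omega)]
  have h4 : ∀ k ∈ Finset.range (n + 1), ∑ x ∈ ((Finset.range (n + 1) ×ˢ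
      Finset.range (n + 1)).filter (fun x => x.1 + x.2 ≤ n)).filter (fun x => x.1 + x.2 = k),
        G x.1 x.2 = ∑ ij ∈ Finset.HasAntidiagonal.antidiagonal k, G ij.1 ij.2 := by
    intro k hk
    refine Finset.sum_congr ?_ fun _ _ => rfl
    ext x
    simp only [Finset.mem_filter, Finset.mem_product, Finset.mem_range,
      Finset.HasAntidiagonal.mem_antidiagonal] at hk ⊢
    omega
  rw [Finset.sum_congr rfl h4, Finset.range_eq_Ico, Finset.sum_eq_sum_Ico_succ_bot (by omega)]
  have h5 : ∑ ij ∈ Finset.HasAntidiagonal.antidiagonal 0, G ij.1 ij.2 = 0 := by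
    simp [hG, map_one_eq_zero hD]
  rw [h5, zero_add]
  rfl

/-- The sum over surjections onto k blocks is the top coefficient of (f(e) − 1)^k, and (-1)^(k-1)
(k-1)!/k! is the k-th coefficient of the logarithm. Only the values of `e` enter, so its
identification with an exponential is postponed. -/
theorem signedCumulant_eq [CharZero K] {R' : Type*} [Ring R'] [Algebra K R'] {f : R →ₗ[K] R'}
    (hf : f 1 = 1) (a : Fin n → R) {e : SetFun p R} (he : ∀ T, e T = blockProd T a) :
    signedCumulant p f a = nilLog K (map p f e) Finset.univ := by
  set u : SetFun p R' := map p f e - 1 with hu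
  have hu0 : u ∅ = 0 := by simp [hu, he, hf]
  have huT : ∀ T : Finset (Fin n), T.Nonempty → u T = f (blockProd T a) := by
    intro T hT
    simp [hu, he, one_apply, hT.ne_empty]
  rw [nilLog, nilSeries_eq_sum _ (pow_eq_zero hu0), sum_apply, signedCumulant,
    Finset.range_eq_Ico, Finset.sum_eq_sum_Ico_succ_bot (by omega)]
  simp only [Nat.cast_zero, div_zero, zero_smul, zero_apply, zero_add, smul_apply]
  refine Finset.sum_congr rfl fun k hk => ?_
  have hk1 : 1 ≤ k := (Finset.mem_Icc.mp hk).1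
  have h1 := map_pow_mul_pow_univ (p := p) hu0 (Finset.univ : Finset (Fin k))
    (LinearMap.id : R' →ₗ[K] R')
  have h2 : (map p (LinearMap.id : R' →ₗ[K] R') (u ^ (Finset.univ : Finset (Fin k)).card) *
      u ^ (Finset.univ : Finset (Fin k))ᶜ.card) = u ^ k := by
    rw [Finset.compl_univ, Finset.card_empty, pow_zero, mul_one, Finset.card_univ,
      Fintype.card_fin]; rfl
  rw [h2] at h1
  rw [h1]
  congr 1
  · obtain ⟨k, rfl⟩ := Nat.exists_eq_add_of_le' hk1
    have : (k.factorial : K) ≠ 0 := Nat.cast_ne_zero.mpr (Nat.factorial_ne_zero k)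
    have : ((k + 1 : ℕ) : K) ≠ 0 := Nat.cast_ne_zero.mpr (by omega)
    rw [Nat.add_sub_cancel, Nat.factorial_succ, Nat.cast_mul]
    field_simp
  · refine Finset.sum_congr rfl fun φ _ => ?_
    congr 1
    rw [Finset.compl_univ, crossSign_empty_right, blockProd_empty, one_smul, mul_one,
      LinearMap.id_apply, blockProd_univ]
    congr 2
    funext j
    rw [huT _ (block_nonempty φ.2 j)]

end SetFun

end

end DerivedBV

/-! ### Functoriality, evenness and graded symmetry. -/

namespace DerivedBV

noncomputable section

variable {K : Type*} [Field K]

/-! ### Supercommutative algebras -/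

/-- A supercommutative algebra, with the projections `π 0` and `π 1` onto its even and odd parts. -/
structure IsSuperCommutative {R : Type*} [Ring R] [Algebra K R] (π : ZMod 2 → R →ₗ[K] R) : Prop where
  sum_proj : ∀ a, π 0 a + π 1 a = a
  proj_proj : ∀ e a, π e (π e a) = π e a
  proj_of_ne : ∀ e e' a, e ≠ e' → π e (π e' a) = 0
  one : π 0 1 = 1
  mul : ∀ e e' a b, π e a = a → π e' b = b → π (e + e') (a * b) = a * b
  comm : ∀ e e' a b, π e a = a → π e' b = b → a * b = swapSign e e' • (b * a)

/-- The sign identity behind the vanishing of squares of odd elements. -/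
theorem swapSign_add_one (t u : ZMod 2) :
    swapSign t 1 = -(swapSign u 1 * swapSign t u * swapSign (u + 1) (t + 1)) := by
  revert t u; decide

namespace SetFun

section Hom

variable {n k : ℕ} {p : Fin n → ZMod 2} {R : Type*} [Ring R] [Algebra K R]
variable {R' : Type*} [Ring R'] [Algebra K R']

variable (K) in
/-- Restriction of a set function to the subsets of `W`. -/
def res (W : Finset (Fin n)) : SetFun p R →ₐ[K] SetFun p R :=
  AlgHom.ofLinearMap
    { toFun := fun α => ⟨fun T => if T ⊆ W then α T else 0⟩
      map_add' := fun α β => by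
        ext T
        simp only [add_apply]
        split_ifs <;> simp
      map_smul' := fun c α => by
        ext T
        simp only [smul_apply, RingHom.id_apply]
        split_ifs <;> simp }
    (by
      ext T; change (if T ⊆ W then _ else _) = _
      split_ifs with h
      · rfl
      · rw [one_apply, if_neg]; rintro rfl; simp at h)
    (fun α β => by
      ext T
      change (if T ⊆ W then (α * β) T else 0) = _
      rw [mul_apply, mul_apply]
      split_ifs with h
      · refine Finset.sum_congr rfl fun U _ => Finset.sum_congr rfl fun V _ => ?_
        split_ifs with h'
        · have hU : U ⊆ W := (Finset.subset_union_left.trans h'.2.le).trans h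
          have hV : V ⊆ W := (Finset.subset_union_right.trans h'.2.le).trans h
          change _ = _ • ((if U ⊆ W then _ else _) * if V ⊆ W then _ else _)
          rw [if_pos hU, if_pos hV]
        · rfl
      · symm
        refine Finset.sum_eq_zero fun U _ => Finset.sum_eq_zero fun V _ => ?_
        split_ifs with h'
        · change _ • ((if U ⊆ W then _ else _) * if V ⊆ W then _ else _) = 0
          by_cases hU : U ⊆ W
          · rw [if_neg (fun hV => h (h'.2 ▸ Finset.union_subset hU hV)), mul_zero, smul_zero]
          · rw [if_neg hU, zero_mul, smul_zero]
        · rfl)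

theorem res_apply (W : Finset (Fin n)) (α : SetFun p R) (T) :
    res K W α T = if T ⊆ W then α T else 0 := rfl

theorem res_single (W T : Finset (Fin n)) (r : R) :
    res K W (single T r : SetFun p R) = if T ⊆ W then single T r else 0 := by
  ext U
  rw [res_apply, single_apply]
  by_cases h : U = T
  · subst h; by_cases hU : U ⊆ W <;> simp [hU]
  · by_cases hU : T ⊆ W <;> simp [h, hU, single_apply]

theorem map_res (W : Finset (Fin n)) (f : R →ₗ[K] R') (α : SetFun p R) :
    map p f (res K W α) = res K W (map p f α) := by
  ext T; rw [map_apply, res_apply, res_apply, map_apply]; split_ifs <;> simp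

variable (K) in
/-- The linear map given by a family of disjoint subsets. -/
def transportLin (P : Fin k → ZMod 2)
    (S : Fin k → Finset (Fin n)) : SetFun P R →ₗ[K] SetFun p R where
  toFun α := ∑ T, single (T.biUnion S) (famSign p S T • α T)
  map_add' α β := by
    simp only [add_apply, smul_add, single_add, Finset.sum_add_distrib]
  map_smul' c α := by
    simp only [smul_apply, Finset.smul_sum, RingHom.id_apply, ← single_smul, smul_comm c]

theorem transportLin_apply (P : Fin k → ZMod 2) (S : Fin k → Finset (Fin n)) (α : SetFun P R) :
    transportLin K (p := p) P S α = ∑ T, single (T.biUnion S) (famSign p S T • α T) := rfl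

theorem transportLin_single (P : Fin k → ZMod 2) (S : Fin k → Finset (Fin n))
    (T : Finset (Fin k)) (r : R) :
    transportLin K (p := p) P S (single T r) = single (T.biUnion S) (famSign p S T • r) := by
  rw [transportLin_apply, Finset.sum_eq_single T]
  · simp
  · intro U _ hU; simp [single_apply, hU]
  · simp

theorem map_transportLin (P : Fin k → ZMod 2) (S : Fin k → Finset (Fin n)) (f : R →ₗ[K] R')
    (α : SetFun P R) :
    map p f (transportLin K P S α) = transportLin K P S (map P f α) := by
  simp only [transportLin_apply, map_sum, map_single, map_zsmul, map_apply]

/-- A family of disjoint nonempty subsets together with its parities. -/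
structure IsFamily (p : Fin n → ZMod 2) (P : Fin k → ZMod 2) (S : Fin k → Finset (Fin n)) :
    Prop where
  disjoint : ∀ i j, i ≠ j → Disjoint (S i) (S j)
  nonempty : ∀ i, (S i).Nonempty
  parity : ∀ j, P j = famParity p S j

theorem IsFamily.biUnion_disjoint_iff {P : Fin k → ZMod 2} {S : Fin k → Finset (Fin n)}
    (hS : IsFamily p P S) (T U : Finset (Fin k)) :
    Disjoint (T.biUnion S) (U.biUnion S) ↔ Disjoint T U := by
  refine ⟨fun h => ?_, disjoint_biUnion hS.disjoint⟩
  rw [Finset.disjoint_left]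
  intro i hi hi'
  obtain ⟨x, hx⟩ := hS.nonempty i
  exact Finset.disjoint_left.mp h (Finset.mem_biUnion.mpr ⟨i, hi, hx⟩)
    (Finset.mem_biUnion.mpr ⟨i, hi', hx⟩)

variable (K) in
/-- The algebra homomorphism given by a family of disjoint subsets. -/
def transport {P : Fin k → ZMod 2}
    {S : Fin k → Finset (Fin n)} (hS : IsFamily p P S) : SetFun P R →ₐ[K] SetFun p R :=
  AlgHom.ofLinearMap (transportLin K P S)
    (by rw [one_def, transportLin_single]; simp [one_def])
    (fun α β => by
      rw [eq_sum_single α, eq_sum_single β]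
      simp only [Finset.sum_mul, Finset.mul_sum, map_sum]
      refine Finset.sum_congr rfl fun U _ => Finset.sum_congr rfl fun T _ => ?_
      rw [transportLin_single, transportLin_single, single_mul_single, single_mul_single]
      by_cases h : Disjoint T U
      · rw [if_pos h, if_pos ((hS.biUnion_disjoint_iff T U).mpr h), transportLin_single,
          ← Finset.union_biUnion, smul_mul_smul_comm, smul_smul, smul_smul]
        have h1 := famSign_union p hS.disjoint h
        have h2 : P = famParity p S := funext hS.parity
        rw [← h2] at h1
        rw [h1]
      · rw [if_neg h, if_neg (fun h' => h ((hS.biUnion_disjoint_iff T U).mp h')), map_zero])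

theorem transport_single {P : Fin k → ZMod 2} {S : Fin k → Finset (Fin n)} (hS : IsFamily p P S)
    (T : Finset (Fin k)) (r : R) :
    transport K hS (single T r) = single (T.biUnion S) (famSign p S T • r) :=
  transportLin_single (K := K) P S T r

theorem map_transport {P : Fin k → ZMod 2} {S : Fin k → Finset (Fin n)} (hS : IsFamily p P S)
    (f : R →ₗ[K] R') (α : SetFun P R) :
    map p f (transport K hS α) = transport K hS (map P f α) :=
  map_transportLin P S f α

/-- As the sets are disjoint and nonempty, no smaller subfamily has the same union; the top
coefficient is therefore carried over with a single sign. -/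
theorem transport_apply_univ {P : Fin k → ZMod 2} {S : Fin k → Finset (Fin n)}
    (hS : IsFamily p P S) (α : SetFun P R) :
    transport K hS α (Finset.univ.biUnion S) = famSign p S Finset.univ • α Finset.univ := by
  change (transportLin K P S α) _ = _
  rw [transportLin_apply, sum_apply, Finset.sum_eq_single Finset.univ]
  · simp
  · intro T _ hT
    rw [single_apply, if_neg]
    intro h
    apply hT
    have h1 := (hS.biUnion_disjoint_iff T Tᶜ).mpr disjoint_compl_right
    rw [← h, hS.biUnion_disjoint_iff] at h1
    have h2 : Tᶜ = ∅ := by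
      rw [← Finset.disjoint_self_iff_empty]
      exact h1.mono_left (Finset.subset_univ _)
    simpa using h2
  · simp

theorem transport_apply_empty {P : Fin k → ZMod 2} {S : Fin k → Finset (Fin n)}
    (hS : IsFamily p P S) (α : SetFun P R) : transport K hS α ∅ = α ∅ := by
  change (transportLin K P S α) _ = _
  rw [transportLin_apply, sum_apply, Finset.sum_eq_single ∅]
  · simp
  · intro T _ hT
    rw [single_apply, if_neg]
    obtain ⟨j, hj⟩ := Finset.nonempty_iff_ne_empty.mpr hT
    obtain ⟨i, hi⟩ := hS.nonempty j
    intro h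
    have : i ∈ T.biUnion S := Finset.mem_biUnion.mpr ⟨j, hj, hi⟩
    rw [← h] at this
    simp at this
  · simp

theorem nilExp_apply_empty {α : SetFun p R} (hα : α ∅ = 0) : nilExp K α ∅ = 1 := by
  have h : ∀ i, (α ^ (i + 1)) ∅ = 0 := fun i => pow_apply_eq_zero hα _ _ (by simp)
  rw [nilExp, nilSeries_eq_sum _ (pow_eq_zero hα), sum_apply, Finset.sum_range_succ']
  simp [h]

end Hom

/-! ### Even set functions -/

section Even

variable {n k : ℕ} {p : Fin n → ZMod 2} {R : Type*} [Ring R] [Algebra K R]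
variable {R' : Type*} [Ring R'] [Algebra K R']

/-- A set function whose value at `T` has the parity of the monomial `ε_T`. -/
def IsEven (π : ZMod 2 → R →ₗ[K] R) (α : SetFun p R) : Prop :=
  ∀ T, π (∑ i ∈ T, p i) (α T) = α T

variable {π : ZMod 2 → R →ₗ[K] R} {π' : ZMod 2 → R' →ₗ[K] R'}

theorem IsEven.add {α β : SetFun p R} (hα : IsEven π α) (hβ : IsEven π β) : IsEven π (α + β) :=
  fun T => by rw [add_apply, map_add, hα, hβ]

theorem IsEven.neg {α : SetFun p R} (hα : IsEven π α) : IsEven π (-α) :=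
  fun T => by rw [neg_apply, map_neg, hα]

theorem IsEven.sub {α β : SetFun p R} (hα : IsEven π α) (hβ : IsEven π β) : IsEven π (α - β) :=
  fun T => by rw [sub_apply, map_sub, hα, hβ]

theorem IsEven.smul {α : SetFun p R} (hα : IsEven π α) (c : K) : IsEven π (c • α) :=
  fun T => by rw [smul_apply, map_smul, hα]

theorem IsEven.sum {ι : Type*} {s : Finset ι} {α : ι → SetFun p R}
    (h : ∀ i ∈ s, IsEven π (α i)) : IsEven π (∑ i ∈ s, α i) :=
  fun T => by rw [sum_apply, map_sum]; exact Finset.sum_congr rfl fun i hi => h i hi T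

theorem IsEven.single {T : Finset (Fin n)} {r : R} (h : π (∑ i ∈ T, p i) r = r) :
    IsEven π (single T r : SetFun p R) := fun U => by
  rw [single_apply]
  split_ifs with h'
  · rw [h', h]
  · simp

theorem IsEven.map {f : R →ₗ[K] R'} (hf : ∀ e r, π e r = r → π' e (f r) = f r) {α : SetFun p R}
    (hα : IsEven π α) : IsEven π' (map p f α) := fun T => hf _ _ (hα T)

theorem IsEven.res {α : SetFun p R} (hα : IsEven π α) (W : Finset (Fin n)) :
    IsEven π (res K W α) := fun T => by
  rw [res_apply]; split_ifs
  · exact hα T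
  · simp

variable (hπ : IsSuperCommutative π)
include hπ

theorem IsEven.one : IsEven π (1 : SetFun p R) := IsEven.single (by simpa using hπ.one)

theorem IsEven.mul {α β : SetFun p R} (hα : IsEven π α) (hβ : IsEven π β) : IsEven π (α * β) := by
  intro S
  rw [mul_apply, map_sum]
  refine Finset.sum_congr rfl fun T _ => ?_
  rw [map_sum]
  refine Finset.sum_congr rfl fun U _ => ?_
  split_ifs with h
  · rw [map_zsmul, ← h.2, Finset.sum_union h.1, hπ.mul _ _ _ _ (hα T) (hβ U)]
  · simp

theorem IsEven.pow {α : SetFun p R} (hα : IsEven π α) (k : ℕ) : IsEven π (α ^ k) := by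
  induction k with
  | zero => rw [pow_zero]; exact IsEven.one hπ
  | succ k ih => rw [pow_succ]; exact ih.mul hπ hα

theorem IsEven.nilSeries {α : SetFun p R} (hα : IsEven π α) (c : ℕ → K) :
    IsEven π (nilSeries c α) :=
  IsEven.sum fun i _ => (hα.pow hπ i).smul (c i)

theorem IsEven.nilExp {α : SetFun p R} (hα : IsEven π α) : IsEven π (nilExp K α) :=
  hα.nilSeries hπ _

theorem IsEven.nilLog {α : SetFun p R} (hα : IsEven π α) : IsEven π (nilLog K α) :=
  (hα.sub (IsEven.one hπ)).nilSeries hπ _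

/-- The sign from reordering ε_T and ε_U cancels the one from reordering their coefficients. This is
what makes the addition theorem for the exponential and its consequences applicable. -/
theorem IsEven.commute {α β : SetFun p R} (hα : IsEven π α) (hβ : IsEven π β) : Commute α β := by
  ext S
  rw [mul_apply, mul_apply, Finset.sum_comm]
  refine Finset.sum_congr rfl fun T _ => Finset.sum_congr rfl fun U _ => ?_
  by_cases h : Disjoint T U ∧ T ∪ U = S
  · rw [if_pos h, if_pos ⟨h.1.symm, (Finset.union_comm U T).trans h.2⟩, hπ.comm _ _ _ _ (hα U) (hβ T), smul_smul, ← crossSign_mul_swap p h.1.symm, ← mul_assoc,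
      crossSign_mul_self, one_mul]
  · rw [if_neg h, if_neg fun h' => h ⟨h'.1.symm, (Finset.union_comm T U).trans h'.2⟩]

end Even

/-! ### The universal even element -/

section Gen

variable {n k : ℕ} {p : Fin n → ZMod 2} {R : Type*} [Ring R] [Algebra K R]
variable {R' : Type*} [Ring R'] [Algebra K R']
variable {π : ZMod 2 → R →ₗ[K] R} {π' : ZMod 2 → R' →ₗ[K] R'}

/-- The element `∑ b j ε_{S j}`. -/
def famGen (S : Fin k → Finset (Fin n)) (b : Fin k → R) : SetFun p R := ∑ j, single (S j) (b j)

/-- The element `∑ a i ε i`. -/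
def gen (a : Fin n → R) : SetFun p R := famGen (fun i => {i}) a

theorem famGen_apply_empty {S : Fin k → Finset (Fin n)} (hS : ∀ i, (S i).Nonempty) (b : Fin k → R) :
    (famGen S b : SetFun p R) ∅ = 0 := by
  rw [famGen, sum_apply]
  exact Finset.sum_eq_zero fun j _ => if_neg (hS j).ne_empty.symm

theorem gen_apply_empty (a : Fin n → R) : (gen a : SetFun p R) ∅ = 0 :=
  famGen_apply_empty (fun i => Finset.singleton_nonempty i) a

theorem isEven_gen {a : Fin n → R} (ha : ∀ i, π (p i) (a i) = a i) :
    IsEven π (gen a : SetFun p R) :=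
  IsEven.sum fun i _ => IsEven.single (by simpa using ha i)

theorem transport_gen {P : Fin k → ZMod 2} {S : Fin k → Finset (Fin n)} (hS : IsFamily p P S)
    (b : Fin k → R) : transport K hS (gen b) = famGen S b := by
  rw [gen, famGen, famGen, map_sum]
  refine Finset.sum_congr rfl fun j _ => ?_
  rw [transport_single]; simp

variable [CharZero K] (hπ : IsSuperCommutative π)
include hπ

/-- The terms a_i ε_i are even, hence commute, and have square zero, so the exponential is the
product of the factors 1 + a_i ε_i. One element thus records all block products with their signs. -/
theorem nilExp_gen {a : Fin n → R} (ha : ∀ i, π (p i) (a i) = a i) :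
    (∀ T, nilExp K (gen a : SetFun p R) T = blockProd T a) ∧
      ∀ T, nilExp K (-gen a : SetFun p R) T = (-1) ^ T.card * blockProd T a := by
  have hz : ∀ i : Fin n, (single {i} (a i) * single {i} (a i) : SetFun p R) = 0 := fun i => by
    rw [single_mul_single, if_neg]; simp
  have hev : ∀ i : Fin n, IsEven π (single {i} (a i) : SetFun p R) := fun i =>
    IsEven.single (by simpa using ha i)
  have hd : ∀ i j : Fin n, i ≠ j → Disjoint ({i} : Finset (Fin n)) {j} := fun i j h => by
    simpa using h
  have hfs : ∀ T : Finset (Fin n), famSign p (fun i => {i}) T = 1 := fun T =>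
    Finset.prod_eq_one fun i _ => Finset.prod_eq_one fun j _ => by
      split_ifs with h
      · exact crossSign_eq_one_of_lt _ (by simpa using h)
      · rfl
  have hbp : ∀ I : Finset (Fin n), blockProd I (fun i => (single {i} (a i) : SetFun p R)) =
      single I (blockProd I a) := fun I => by
    rw [blockProd_single hd, hfs, one_smul]
    congr 1
    ext i; simp
  have h1 := (nilExp_sum_of_mul_self_eq_zero (K := K) hz
    (fun i j => (hev i).commute hπ (hev j)) Finset.univ).2
  have h2 := (nilExp_sum_of_mul_self_eq_zero (K := K)
    (z := fun i => (-single {i} (a i) : SetFun p R)) (fun i => by rw [neg_mul_neg, hz])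
    (fun i j => ((hev i).commute hπ (hev j)).neg_left.neg_right) Finset.univ).2
  rw [Finset.powerset_univ] at h1 h2
  rw [Finset.sum_neg_distrib] at h2
  constructor
  · intro T
    rw [gen, famGen, h1, sum_apply]
    simp [hbp, single_apply]
  · intro T
    rw [gen, famGen, h2, sum_apply]
    have h3 : ∀ I : Finset (Fin n), ((-1) ^ I.card * single I (blockProd I a) : SetFun p R) T =
        if T = I then (-1) ^ I.card * blockProd I a else 0 := by
      intro I
      rcases Nat.even_or_odd I.card with h | h
      · simp [h.neg_one_pow, single_apply]
      · simp only [h.neg_one_pow, neg_mul, one_mul, neg_apply, single_apply]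
        split_ifs <;> simp
    simp only [blockProd_neg, hbp, h3]
    rw [Finset.sum_ite_eq]
    simp

theorem signedKoszul_eq {a : Fin n → R} (ha : ∀ i, π (p i) (a i) = a i) {D : R →ₗ[K] R}
    (hD : D 1 = 0) :
    signedKoszul p D a = (map p D (nilExp K (gen a)) * nilExp K (-gen a) : SetFun p R) Finset.univ := by
  rw [signedKoszul_eq_sum p hD, mul_apply_univ]
  refine Finset.sum_congr rfl fun I _ => ?_
  rw [map_apply, (nilExp_gen hπ ha).1, (nilExp_gen hπ ha).2, smul_comm]
  congr 1
  rcases Nat.even_or_odd Iᶜ.card with h | h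
  · simp [h.neg_one_pow]
  · simp [h.neg_one_pow]

/-- The value of the Koszul bracket on the elements `b j ε_{S j}`. -/
theorem famSign_smul_signedKoszul {P : Fin k → ZMod 2} {S : Fin k → Finset (Fin n)}
    (hS : IsFamily p P S) {b : Fin k → R} (hb : ∀ j, π (P j) (b j) = b j) {D : R →ₗ[K] R}
    (hD : D 1 = 0) :
    famSign p S Finset.univ • signedKoszul P D b =
      (map p D (nilExp K (famGen S b)) * nilExp K (-famGen S b) : SetFun p R) (Finset.univ.biUnion S) := by
  have hn : IsNilpotent (gen b : SetFun P R) := isNilpotent (gen_apply_empty b)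
  rw [signedKoszul_eq hπ hb hD, ← transport_apply_univ (K := K) hS, map_mul, ← map_transport,
    map_nilExp _ hn, map_nilExp _ hn.neg, map_neg, transport_gen]

/-- The value of the cumulant on the elements `b j ε_{S j}`. -/
theorem famSign_smul_signedCumulant {P : Fin k → ZMod 2} {S : Fin k → Finset (Fin n)}
    (hS : IsFamily p P S) {b : Fin k → R} (hb : ∀ j, π (P j) (b j) = b j) {f : R →ₗ[K] R'}
    (hf : f 1 = 1) :
    famSign p S Finset.univ • signedCumulant P f b =
      nilLog K (map p f (nilExp K (famGen S b))) (Finset.univ.biUnion S) := by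
  have hn : IsNilpotent (gen b : SetFun P R) := isNilpotent (gen_apply_empty b)
  rw [signedCumulant_eq hf b (nilExp_gen (p := P) hπ hb).1, ← transport_apply_univ (K := K) hS,
    map_nilLog, ← map_transport, map_nilExp _ hn, transport_gen]
  refine isNilpotent ?_
  rw [sub_apply, map_apply, nilExp_apply_empty (gen_apply_empty b), hf, one_apply_empty, sub_self]

omit [CharZero K] hπ in
theorem isFamily_restrict (I : Finset (Fin n)) :
    IsFamily p (restrict I p) (fun j => {I.orderEmbOfFin rfl j}) where
  disjoint i j h := by simpa using h
  nonempty i := Finset.singleton_nonempty _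
  parity j := by simp [famParity, restrict]

omit [CharZero K] hπ in
theorem famSign_singleton_eq_one (e : Fin k ↪o Fin n) :
    famSign p (fun j => {e j}) Finset.univ = 1 :=
  Finset.prod_eq_one fun i _ => Finset.prod_eq_one fun j _ => by
    split_ifs with h
    · exact crossSign_eq_one_of_lt _ (by simpa using h)
    · rfl

omit [CharZero K] hπ in
theorem biUnion_orderEmbOfFin (I : Finset (Fin n)) :
    Finset.univ.biUnion (fun j => ({I.orderEmbOfFin rfl j} : Finset (Fin n))) = I := by
  rw [Finset.biUnion_singleton, Finset.image_orderEmbOfFin_univ]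

omit [CharZero K] hπ in
theorem res_famGen_singleton {m : ℕ} (ι : Fin m ↪ Fin n) (I : Finset (Fin m)) {W : Finset (Fin n)}
    (hW : ∀ i, ι i ∈ W ↔ i ∈ I) (a : Fin m → R) :
    res K W (famGen (fun i => {ι i}) a : SetFun p R) =
      famGen (fun j => {ι (I.orderEmbOfFin rfl j)}) (restrict I a) := by
  rw [famGen, famGen, map_sum]
  simp only [res_single, Finset.singleton_subset_iff, hW]
  rw [← Finset.sum_filter, Finset.filter_mem_eq_inter, Finset.univ_inter]
  conv_lhs => rw [← Finset.map_orderEmbOfFin_univ I rfl, Finset.sum_map]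
  rfl

theorem signedKoszul_restrict {a : Fin n → R} (ha : ∀ i, π (p i) (a i) = a i) {D : R →ₗ[K] R}
    (hD : D 1 = 0) (I : Finset (Fin n)) :
    signedKoszul (restrict I p) D (restrict I a) =
      (map p D (nilExp K (gen a)) * nilExp K (-gen a) : SetFun p R) I := by
  have hn : IsNilpotent (gen a : SetFun p R) := isNilpotent (gen_apply_empty a)
  have h := famSign_smul_signedKoszul hπ (isFamily_restrict (p := p) I) (b := restrict I a)
    (fun j => ha _) hD
  have hg := res_famGen_singleton (K := K) (p := p) (Function.Embedding.refl _) I (W := I)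
    (fun i => Iff.rfl) a
  change res K I (gen a : SetFun p R) = famGen (fun j => {I.orderEmbOfFin rfl j}) _ at hg
  rw [famSign_singleton_eq_one, one_smul, biUnion_orderEmbOfFin,
    ← hg, ← map_neg, ← map_nilExp _ hn.neg, ← map_nilExp _ hn, map_res, ← map_mul, res_apply,
    if_pos subset_rfl] at h
  exact h

theorem signedCumulant_restrict {a : Fin n → R} (ha : ∀ i, π (p i) (a i) = a i) {f : R →ₗ[K] R'}
    (hf : f 1 = 1) (I : Finset (Fin n)) :
    signedCumulant (restrict I p) f (restrict I a) =
      nilLog K (map p f (nilExp K (gen a))) I := by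
  have hn : IsNilpotent (gen a : SetFun p R) := isNilpotent (gen_apply_empty a)
  have h := famSign_smul_signedCumulant hπ (isFamily_restrict (p := p) I) (b := restrict I a)
    (fun j => ha _) hf
  have hg := res_famGen_singleton (K := K) (p := p) (Function.Embedding.refl _) I (W := I)
    (fun i => Iff.rfl) a
  change res K I (gen a : SetFun p R) = famGen (fun j => {I.orderEmbOfFin rfl j}) _ at hg
  rw [famSign_singleton_eq_one, one_smul, biUnion_orderEmbOfFin,
    ← hg, ← map_nilExp _ hn, map_res, ← map_nilLog, res_apply, if_pos subset_rfl] at h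
  · exact h
  · refine isNilpotent ?_
    rw [sub_apply, map_apply, nilExp_apply_empty (gen_apply_empty a), hf, one_apply_empty, sub_self]

/-! ### Graded symmetry -/

omit hπ in
omit [CharZero K] in
theorem isFamily_block_perm (d : Fin n → ZMod 2) (s : Equiv.Perm (Fin n)) :
    IsFamily (fun i => d (s i)) d (block s) where
  disjoint := block_disjoint _
  nonempty := block_nonempty s.surjective
  parity j := by
    have : block (⇑s) j = {s.symm j} := by
      ext i; simp [block, Equiv.eq_symm_apply]
    simp [famParity, this]

omit hπ [CharZero K] in
theorem famGen_block_perm (s : Equiv.Perm (Fin n)) (a : Fin n → R) :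
    (famGen (block s) a : SetFun p R) = gen (fun i => a (s i)) := by
  have : ∀ j, block (⇑s) j = {s.symm j} := fun j => by
    ext i; simp [block, Equiv.eq_symm_apply]
  rw [gen, famGen, famGen]
  simp only [this]
  rw [← Equiv.sum_comp s]
  simp

/-- A permutation of the arguments renames the variables; the only sign is that of reordering the
top monomial. -/
theorem signedKoszul_perm {d : Fin n → ZMod 2} {a : Fin n → R} (ha : ∀ i, π (d i) (a i) = a i)
    {D : R →ₗ[K] R} (hD : D 1 = 0) (s : Equiv.Perm (Fin n)) :
    signedKoszul (fun i => d (s i)) D (fun i => a (s i)) =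
      koszulSign (fun i => d (s i)) (fun i => s i) • signedKoszul d D a := by
  have h := famSign_smul_signedKoszul hπ (isFamily_block_perm d s) ha hD
  rw [famSign_univ_block, biUnion_block, famGen_block_perm] at h
  rw [h, signedKoszul_eq hπ (fun i => ha (s i)) hD]

theorem signedCumulant_perm {d : Fin n → ZMod 2} {a : Fin n → R} (ha : ∀ i, π (d i) (a i) = a i)
    {f : R →ₗ[K] R'} (hf : f 1 = 1) (s : Equiv.Perm (Fin n)) :
    signedCumulant (fun i => d (s i)) f (fun i => a (s i)) =
      koszulSign (fun i => d (s i)) (fun i => s i) • signedCumulant d f a := by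
  have h := famSign_smul_signedCumulant hπ (isFamily_block_perm d s) ha hf
  rw [famSign_univ_block, biUnion_block, famGen_block_perm] at h
  rw [h, signedCumulant_eq hf _ (nilExp_gen hπ (fun i => ha (s i))).1]

end Gen

end SetFun

end

end DerivedBV

/-! ### Multilinearity and linearization in one additional argument. -/

namespace DerivedBV

noncomputable section

variable {K : Type*} [Field K]

/-! ### Multilinearity of Koszul brackets and cumulants -/

section Multilinear

variable {n : ℕ} {R S : Type*} [Ring R] [Algebra K R] [Ring S] [Algebra K S]

theorem signedKoszul_update_add (p : Fin n → ZMod 2) (D : R →ₗ[K] R) (a : Fin n → R) (i : Fin n)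
    (x y : R) : signedKoszul p D (Function.update a i (x + y)) =
      signedKoszul p D (Function.update a i x) + signedKoszul p D (Function.update a i y) := by
  simp only [signedKoszul, ← blockMultilinear_apply, MultilinearMap.map_update_add, smul_add,
    Finset.sum_add_distrib]

/-- Koszul brackets commute in each argument with multiplications by central constants. -/
theorem signedKoszul_update_map (p : Fin n → ZMod 2) {D T : R →ₗ[K] R}
    (hT : ∀ l x r, T (l * x * r) = l * T x * r) (hD : ∀ x, D (T x) = T (D x)) (a : Fin n → R)
    (i : Fin n) (x : R) : signedKoszul p D (Function.update a i (T x)) =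
      T (signedKoszul p D (Function.update a i x)) := by
  simp only [signedKoszul, map_sum, map_zsmul]
  refine Finset.sum_congr rfl fun I _ => ?_
  congr 1
  by_cases hi : i ∈ I
  · obtain ⟨l, r, h⟩ := exists_blockProd_update hi a
    have hi' : i ∉ Iᶜ := by simpa using hi
    rw [h, h, blockProd_update_of_notMem hi', blockProd_update_of_notMem hi', ← hT, hD]
    have h2 := hT 1 (D (l * x * r)) (blockProd Iᶜ a)
    rw [one_mul, one_mul] at h2
    rw [h2]
  · have hi' : i ∈ Iᶜ := by simpa using hi
    obtain ⟨l, r, h⟩ := exists_blockProd_update hi' a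
    rw [h, h, blockProd_update_of_notMem hi, blockProd_update_of_notMem hi]
    have h2 := hT (D (blockProd I a) * l) x r
    simp only [mul_assoc] at h2 ⊢
    rw [h2]

theorem exists_ofFn_prod_update {k : ℕ} (φ : Fin n → Fin k) (f : R →ₗ[K] S) (a : Fin n → R)
    (i : Fin n) : ∃ (l r : R) (l' r' : S), ∀ x,
      (List.ofFn (fun j => f (blockProd (block φ j) (Function.update a i x)))).prod =
        l' * f (l * x * r) * r' := by
  obtain ⟨l, r, h⟩ := exists_blockProd_update (I := block φ (φ i)) (i := i) (by simp [block]) a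
  obtain ⟨l', r', h'⟩ := exists_blockProd_update (Finset.mem_univ (φ i))
    (fun j => f (blockProd (block φ j) a))
  refine ⟨l, r, l', r', fun x => ?_⟩
  rw [← h, ← h', blockProd_univ]
  congr 2
  funext j
  by_cases hj : j = φ i
  · subst hj; rw [Function.update_self]
  · rw [Function.update_of_ne hj, blockProd_update_of_notMem]
    simpa [block] using Ne.symm hj

theorem signedCumulant_update_add (p : Fin n → ZMod 2) (f : R →ₗ[K] S) (a : Fin n → R) (i : Fin n)
    (x y : R) : signedCumulant p f (Function.update a i (x + y)) =
      signedCumulant p f (Function.update a i x) + signedCumulant p f (Function.update a i y) := by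
  simp only [signedCumulant, ← Finset.sum_add_distrib, ← smul_add]
  refine Finset.sum_congr rfl fun k _ => ?_
  congr 1
  refine Finset.sum_congr rfl fun φ _ => ?_
  obtain ⟨l, r, l', r', h⟩ := exists_ofFn_prod_update φ.1 f a i
  rw [h, h, h, ← add_mul, ← mul_add, ← map_add, ← add_mul, ← mul_add]

/-- Used with T the multiplication by a scalar or by t, and also with T = 0, where it shows that a
zero argument gives zero. -/
theorem signedCumulant_update_map (p : Fin n → ZMod 2) {f : R →ₗ[K] S} {T : R →ₗ[K] R}
    {T' : S →ₗ[K] S} (hT : ∀ l x r, T (l * x * r) = l * T x * r)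
    (hT' : ∀ l x r, T' (l * x * r) = l * T' x * r) (hf : ∀ x, f (T x) = T' (f x)) (a : Fin n → R)
    (i : Fin n) (x : R) : signedCumulant p f (Function.update a i (T x)) =
      T' (signedCumulant p f (Function.update a i x)) := by
  simp only [signedCumulant, map_sum, map_zsmul, map_smul]
  refine Finset.sum_congr rfl fun k _ => ?_
  congr 1
  refine Finset.sum_congr rfl fun φ _ => ?_
  obtain ⟨l, r, l', r', h⟩ := exists_ofFn_prod_update φ.1 f a i
  rw [h, h, hT', ← hf, hT]

theorem proj_update (π : ZMod 2 → R →ₗ[K] R) (p : Fin n → ZMod 2) (a : Fin n → R) (i : Fin n)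
    (x : R) : (fun j => π (p j) (Function.update a i x j)) =
      Function.update (fun j => π (p j) (a j)) i (π (p i) x) :=
  funext fun j => Function.apply_update (fun j => π (p j)) a i x j

theorem koszulBracket_update_add (π : ZMod 2 → R →ₗ[K] R) (D : R →ₗ[K] R) (a : Fin n → R)
    (i : Fin n) (x y : R) : koszulBracket π D n (Function.update a i (x + y)) =
      koszulBracket π D n (Function.update a i x) + koszulBracket π D n (Function.update a i y) := by
  simp only [koszulBracket_eq_sum, proj_update, map_add, signedKoszul_update_add,
    Finset.sum_add_distrib]

theorem koszulBracket_update_map {π : ZMod 2 → R →ₗ[K] R} {D T : R →ₗ[K] R}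
    (hT : ∀ l x r, T (l * x * r) = l * T x * r) (hD : ∀ x, D (T x) = T (D x))
    (hπ : ∀ e x, π e (T x) = T (π e x)) (a : Fin n → R) (i : Fin n) (x : R) :
    koszulBracket π D n (Function.update a i (T x)) =
      T (koszulBracket π D n (Function.update a i x)) := by
  simp only [koszulBracket_eq_sum, proj_update, hπ, signedKoszul_update_map _ hT hD, map_sum]

theorem cumulant_update_add (π : ZMod 2 → R →ₗ[K] R) (f : R →ₗ[K] S) (a : Fin n → R)
    (i : Fin n) (x y : R) : cumulant π f n (Function.update a i (x + y)) =
      cumulant π f n (Function.update a i x) + cumulant π f n (Function.update a i y) := by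
  simp only [cumulant_eq_sum, proj_update, map_add, signedCumulant_update_add,
    Finset.sum_add_distrib]

theorem cumulant_update_map {π : ZMod 2 → R →ₗ[K] R} {f : R →ₗ[K] S} {T : R →ₗ[K] R}
    {T' : S →ₗ[K] S} (hT : ∀ l x r, T (l * x * r) = l * T x * r)
    (hT' : ∀ l x r, T' (l * x * r) = l * T' x * r) (hf : ∀ x, f (T x) = T' (f x))
    (hπ : ∀ e x, π e (T x) = T (π e x)) (a : Fin n → R) (i : Fin n) (x : R) :
    cumulant π f n (Function.update a i (T x)) =
      T' (cumulant π f n (Function.update a i x)) := by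
  simp only [cumulant_eq_sum, proj_update, hπ, signedCumulant_update_map _ hT hT' hf, map_sum]

theorem signedKoszul_eq_zero (p : Fin n → ZMod 2) (D : R →ₗ[K] R) {a : Fin n → R} {i : Fin n}
    (h : a i = 0) : signedKoszul p D a = 0 := by
  have := signedKoszul_update_map p (D := D) (T := 0) (by simp) (by simp) a i 0
  have h1 : Function.update a i 0 = a := by rw [← h, Function.update_eq_self]
  rwa [LinearMap.zero_apply, LinearMap.zero_apply, h1] at this

theorem signedCumulant_eq_zero (p : Fin n → ZMod 2) (f : R →ₗ[K] S) {a : Fin n → R} {i : Fin n}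
    (h : a i = 0) : signedCumulant p f a = 0 := by
  have := signedCumulant_update_map p (f := f) (T := 0) (T' := 0) (by simp) (by simp) (by simp) a i 0
  have h1 : Function.update a i 0 = a := by rw [← h, Function.update_eq_self]
  rwa [LinearMap.zero_apply, LinearMap.zero_apply, h1] at this

theorem koszulBracket_eq_signedKoszul {π : ZMod 2 → R →ₗ[K] R} (hπ : IsSuperCommutative π)
    (D : R →ₗ[K] R) {p : Fin n → ZMod 2} {a : Fin n → R} (ha : ∀ i, π (p i) (a i) = a i) :
    koszulBracket π D n a = signedKoszul p D a := by
  rw [koszulBracket_eq_sum, Finset.sum_eq_single p]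
  · simp only [ha]
  · intro q _ hq
    obtain ⟨i, hi⟩ := Function.ne_iff.mp hq
    refine signedKoszul_eq_zero q D (i := i) ?_
    rw [← ha i, hπ.proj_of_ne _ _ _ hi]
  · simp

theorem cumulant_eq_signedCumulant {π : ZMod 2 → R →ₗ[K] R} (hπ : IsSuperCommutative π)
    (f : R →ₗ[K] S) {p : Fin n → ZMod 2} {a : Fin n → R} (ha : ∀ i, π (p i) (a i) = a i) :
    cumulant π f n a = signedCumulant p f a := by
  rw [cumulant_eq_sum, Finset.sum_eq_single p]
  · simp only [ha]
  · intro q _ hq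
    obtain ⟨i, hi⟩ := Function.ne_iff.mp hq
    refine signedCumulant_eq_zero q f (i := i) ?_
    rw [← ha i, hπ.proj_of_ne _ _ _ hi]
  · simp

end Multilinear

namespace SetFun

/-! ### Adjoining one more variable -/

section Adjoin

variable {n k : ℕ} {p : Fin n → ZMod 2} {R : Type*} [Ring R] [Algebra K R]
variable {R' : Type*} [Ring R'] [Algebra K R']
variable {π : ZMod 2 → R →ₗ[K] R} {π' : ZMod 2 → R' →ₗ[K] R'}

theorem mul_single_apply_eq_zero {β : SetFun p R} {T0 T : Finset (Fin n)} {y : R} (h : ¬ T0 ⊆ T) :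
    (β * single T0 y : SetFun p R) T = 0 := by
  rw [mul_apply]
  refine Finset.sum_eq_zero fun J _ => Finset.sum_eq_zero fun L _ => ?_
  split_ifs with h'
  · rw [single_apply, if_neg, mul_zero, smul_zero]
    rintro rfl
    exact h (h'.2 ▸ Finset.subset_union_right)
  · rfl

theorem mul_eq_zero_of_support {β γ : SetFun p R} {T0 : Finset (Fin n)} (h0 : T0.Nonempty)
    (hβ : ∀ T, ¬ T0 ⊆ T → β T = 0) (hγ : ∀ T, ¬ T0 ⊆ T → γ T = 0) : β * γ = 0 := by
  ext S
  rw [mul_apply]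
  refine Finset.sum_eq_zero fun T _ => Finset.sum_eq_zero fun U _ => ?_
  split_ifs with h
  · by_cases hT : T0 ⊆ T
    · rw [hγ U, mul_zero, smul_zero]
      intro hU
      obtain ⟨i, hi⟩ := h0
      exact Finset.disjoint_left.mp h.1 (hT hi) (hU hi)
    · rw [hβ T hT, zero_mul, smul_zero]
  · rfl

variable {T0 W : Finset (Fin n)}

/-- The factor ε_(T0) uses up T0, so within T0 ∪ W the other factor is only seen on subsets of W. -/
theorem res_mul_single_apply (hd : Disjoint T0 W) (e : SetFun p R) (y : R) {T : Finset (Fin n)}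
    (hT : T ⊆ T0 ∪ W) : (res K W e * single T0 y : SetFun p R) T = (e * single T0 y : SetFun p R) T := by
  refine mul_apply_congr fun J L hJL h => ?_
  by_cases hL : L = T0
  · subst hL
    rw [res_apply, if_pos]
    intro i hi
    have := hT (h ▸ Finset.mem_union_left L hi)
    exact (Finset.mem_union.mp this).resolve_left fun h' => Finset.disjoint_left.mp hJL hi h'
  · simp [single_apply, hL]

theorem map_res_mul_single_mul_res (hd : Disjoint T0 W) (D : R →ₗ[K] R') (e : SetFun p R) (y : R)
    (e' : SetFun p R') :
    (map p D (res K W e * single T0 y) * res K W e') (T0 ∪ W) =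
      (map p D (e * single T0 y) * e') (T0 ∪ W) := by
  refine mul_apply_congr fun T U hTU h => ?_
  rw [map_apply, map_apply, res_mul_single_apply hd _ _ (h ▸ Finset.subset_union_left)]
  by_cases hT : T0 ⊆ T
  · rw [res_apply, if_pos]
    intro i hi
    have := h ▸ Finset.mem_union_right T hi
    exact (Finset.mem_union.mp this).resolve_left fun h' => Finset.disjoint_left.mp hTU (hT h') hi
  · rw [mul_single_apply_eq_zero hT, map_zero, zero_mul, zero_mul]

theorem map_res_mul_res_mul_single (hd : Disjoint T0 W) (D : R →ₗ[K] R) (e : SetFun p R) (y : R)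
    (e' : SetFun p R) :
    (map p D (res K W e) * (res K W e' * single T0 y) : SetFun p R) (T0 ∪ W) =
      (map p D e * (e' * single T0 y) : SetFun p R) (T0 ∪ W) := by
  refine mul_apply_congr fun T U hTU h => ?_
  rw [map_apply, map_apply, res_mul_single_apply hd _ _ (h ▸ Finset.subset_union_right)]
  by_cases hU : T0 ⊆ U
  · rw [res_apply, if_pos]
    intro i hi
    have := h ▸ Finset.mem_union_left U hi
    exact (Finset.mem_union.mp this).resolve_left fun h' => Finset.disjoint_left.mp hTU hi (hU h')
  · rw [mul_single_apply_eq_zero hU, mul_zero, mul_zero]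

theorem res_apply_eq_zero (h0 : T0.Nonempty) (hd : Disjoint T0 W) (α : SetFun p R) :
    res K W α (T0 ∪ W) = 0 := by
  rw [res_apply, if_neg]
  intro h
  obtain ⟨i, hi⟩ := h0
  exact Finset.disjoint_left.mp hd hi (h (Finset.mem_union_left W hi))

theorem single_mul_self (h0 : T0.Nonempty) (y : R) : (single T0 y * single T0 y : SetFun p R) = 0 := by
  rw [single_mul_single, if_neg]
  rw [Finset.disjoint_self_iff_empty]
  exact h0.ne_empty

variable [CharZero K] (hπ : IsSuperCommutative π)
include hπ

/-- Since Y = y ε_(T0) has square zero, e^Y = 1 + Y, and the part of D(e^(x+Y)) e^(-x-Y) linear in Y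
remains. The restriction to W can be dropped from the result because the coefficient at T0 ∪ W does
not see it. The right side is then linear in Y with T0 occurring only there and in the index, so
such terms can be summed over all T0. -/
theorem koszul_adjoin_single (h0 : T0.Nonempty) (hd : Disjoint T0 W) {x : SetFun p R}
    (hx : IsEven π x) (hx0 : x ∅ = 0) {y : R} (hy : π (∑ i ∈ T0, p i) y = y) (D : R →ₗ[K] R) :
    (map p D (nilExp K (single T0 y + res K W x)) * nilExp K (-(single T0 y + res K W x)) :
        SetFun p R) (T0 ∪ W) =
      (map p D (nilExp K x * single T0 y) * nilExp K (-x) : SetFun p R) (T0 ∪ W) -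
        (map p D (nilExp K x) * (nilExp K (-x) * single T0 y) : SetFun p R) (T0 ∪ W) := by
  have hn : IsNilpotent x := isNilpotent hx0
  have hnW : IsNilpotent (res K W x) := hn.map (res K W)
  have hY := single_mul_self (p := p) h0 y
  have hYe : IsEven π (single T0 y : SetFun p R) := IsEven.single hy
  have hc := (hx.res W).commute hπ hYe
  have hYn : IsNilpotent (single T0 y : SetFun p R) := ⟨2, by rw [pow_two, hY]⟩
  have hE := nilExp_of_mul_self_eq_zero (K := K) hY
  have hE' := nilExp_of_mul_self_eq_zero (K := K) (x := (-single T0 y : SetFun p R)) (by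
    rw [neg_mul_neg, hY])
  have hz : map p D (res K W (nilExp K x) * single T0 y) *
      (res K W (nilExp K (-x)) * single T0 y) = 0 :=
    mul_eq_zero_of_support h0
      (fun T hT => by rw [map_apply, mul_single_apply_eq_zero hT, map_zero])
      (fun T hT => mul_single_apply_eq_zero hT)
  rw [add_comm (single T0 y), neg_add, nilExp_add hc hnW hYn, nilExp_add hc.neg_left.neg_right
    hnW.neg hYn.neg, hE, hE', ← map_neg, ← map_nilExp _ hn, ← map_nilExp _ hn.neg]
  simp only [mul_add, add_mul, mul_one, map_add, mul_neg, add_apply, neg_apply]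
  rw [map_res_mul_single_mul_res hd, map_res_mul_res_mul_single hd, map_res, ← map_mul,
    res_apply_eq_zero h0 hd, hz, zero_apply]
  abel

omit [CharZero K] hπ in
theorem map_apply_empty_eq_one {f : R →ₗ[K] R'} (hf : f 1 = 1) {e : SetFun p R} (he : e ∅ = 1) :
    (map p f e - 1) ∅ = 0 := by
  rw [sub_apply, map_apply, he, hf, one_apply_empty, sub_self]

/-- Directional derivative of the logarithm: f(e^(x+Y)) = g(1 + w) with g = f(e^x), w = f(e^x Y)
g^(-1) and w² = 0, so the logarithm changes by w. Restriction to W is again invisible in the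
coefficient considered. -/
theorem cumulant_adjoin_single (hπ' : IsSuperCommutative π') (h0 : T0.Nonempty)
    (hd : Disjoint T0 W) {x : SetFun p R}
    (hx : IsEven π x) (hx0 : x ∅ = 0) {y : R} (hy : π (∑ i ∈ T0, p i) y = y) {f : R →ₗ[K] R'}
    (hf : f 1 = 1) (hfe : ∀ e r, π e r = r → π' e (f r) = f r) {gi : SetFun p R'}
    (hgi : map p f (nilExp K x) * gi = 1) :
    nilLog K (map p f (nilExp K (single T0 y + res K W x))) (T0 ∪ W) =
      (map p f (nilExp K x * single T0 y) * gi) (T0 ∪ W) := by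
  have hn : IsNilpotent x := isNilpotent hx0
  have hnW : IsNilpotent (res K W x) := hn.map (res K W)
  have hY := single_mul_self (p := p) h0 y
  have hYe : IsEven π (single T0 y : SetFun p R) := IsEven.single hy
  have hc := (hx.res W).commute hπ hYe
  have hYn : IsNilpotent (single T0 y : SetFun p R) := ⟨2, by rw [pow_two, hY]⟩
  have hgn : IsNilpotent (map p f (nilExp K x) - 1) :=
    isNilpotent (map_apply_empty_eq_one hf (nilExp_apply_empty hx0))
  have hge : IsEven π' (map p f (nilExp K x)) := (hx.nilExp hπ).map hfe
  have hgie : IsEven π' gi := by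
    have h1 : gi = nilExp K (-nilLog K (map p f (nilExp K x))) := by
      have h2 := nilExp_neg_mul_nilExp (K := K) (isNilpotent_nilLog (K := K) hgn)
      rw [nilExp_nilLog hgn] at h2
      rw [← mul_one (nilExp K (-nilLog K (map p f (nilExp K x)))), ← hgi, ← mul_assoc, h2, one_mul]
    rw [h1]
    exact (hge.nilLog hπ').neg.nilExp hπ'
  have hwe : IsEven π' (map p f (res K W (nilExp K x) * single T0 y)) :=
    (((hx.nilExp hπ).res W).mul hπ hYe).map hfe
  set w := map p f (res K W (nilExp K x) * single T0 y) with hw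
  have hws : ∀ T, ¬ T0 ⊆ T → w T = 0 := fun T hT => by
    rw [hw, map_apply, mul_single_apply_eq_zero hT, map_zero]
  have hwgs : ∀ T, ¬ T0 ⊆ T → (w * res K W gi) T = 0 := fun T hT => by
    rw [mul_apply]
    refine Finset.sum_eq_zero fun U _ => Finset.sum_eq_zero fun V _ => ?_
    split_ifs with h
    · rw [hws U fun hU => hT (hU.trans (h.2 ▸ Finset.subset_union_left)), zero_mul, smul_zero]
    · rfl
  have hgiW : map p f (res K W (nilExp K x)) * res K W gi = 1 := by
    rw [map_res, ← map_mul, hgi, _root_.map_one]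
  have hgWe : IsEven π' (map p f (res K W (nilExp K x))) := ((hx.nilExp hπ).res W).map hfe
  have h1 : map p f (nilExp K (single T0 y + res K W x)) =
      map p f (res K W (nilExp K x)) * (1 + w * res K W gi) := by
    rw [add_comm (single T0 y), nilExp_add hc hnW hYn, nilExp_of_mul_self_eq_zero hY,
      ← map_nilExp _ hn, mul_add, mul_add, mul_one, mul_one, map_add, ← mul_assoc,
      (hgWe.commute hπ' hwe).eq, mul_assoc, hgiW, mul_one]
  have hgWn : IsNilpotent (map p f (res K W (nilExp K x)) - 1) := by
    rw [map_res, ← _root_.map_one (res K W (p := p) (R := R')), ← map_sub]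
    exact hgn.map (res K W)
  rw [h1, nilLog_mul_one_add hgWn (hgWe.commute hπ' (hwe.mul hπ' (hgie.res W)))
    (mul_eq_zero_of_support h0 hwgs hwgs), add_apply, hw, map_res_mul_single_mul_res hd, map_res,
    ← map_nilLog _ hgn, res_apply_eq_zero h0 hd, zero_add]

end Adjoin

end SetFun

end

end DerivedBV

/-! ### An auxiliary odd variable and the composition of coderivations. -/

namespace DerivedBV

noncomputable section

variable {K : Type*} [Field K]

/-- The parities of a tuple with one more argument in front. -/
def consParity {n : ℕ} (e : ZMod 2) (p : Fin n → ZMod 2) : Fin (n + 1) → ZMod 2 := Fin.cons e p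

@[simp] theorem consParity_zero {n : ℕ} (e : ZMod 2) (p : Fin n → ZMod 2) :
    consParity e p 0 = e := rfl

@[simp] theorem consParity_succ {n : ℕ} (e : ZMod 2) (p : Fin n → ZMod 2) (i : Fin n) :
    consParity e p i.succ = p i := rfl

namespace SetFun

/-! ### Adjoining an odd variable in front -/

section Shift

variable {n : ℕ} {p : Fin n → ZMod 2} {R : Type*} [Ring R] [Algebra K R]
variable {R' : Type*} [Ring R'] [Algebra K R']
variable {π : ZMod 2 → R →ₗ[K] R} {π' : ZMod 2 → R' →ₗ[K] R'}

/-- The subset of `Fin (n + 1)` consisting of `0` and the shift of `I`. -/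
def consSet (I : Finset (Fin n)) : Finset (Fin (n + 1)) := insert 0 (I.map (Fin.succEmb n))

theorem zero_notMem_map_succ (I : Finset (Fin n)) : (0 : Fin (n + 1)) ∉ I.map (Fin.succEmb n) := by
  simp [Fin.succ_ne_zero]

theorem sum_map_succ (e : ZMod 2) (I : Finset (Fin n)) :
    ∑ i ∈ I.map (Fin.succEmb n), consParity e p i = ∑ i ∈ I, p i := by
  simp

theorem sum_consSet (e : ZMod 2) (I : Finset (Fin n)) :
    ∑ i ∈ consSet I, consParity e p i = ∑ i ∈ I, p i + e := by
  rw [consSet, Finset.sum_insert (zero_notMem_map_succ I), sum_map_succ, add_comm]; rfl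

theorem crossSign_map_succ (e : ZMod 2) (I J : Finset (Fin n)) :
    crossSign (consParity e p) (I.map (Fin.succEmb n)) (J.map (Fin.succEmb n)) =
      crossSign p I J := by
  simp [crossSign, inversionSign]

theorem crossSign_consSet_left (e : ZMod 2) (I J : Finset (Fin n)) :
    crossSign (consParity e p) (consSet I) (J.map (Fin.succEmb n)) = crossSign p I J := by
  conv_rhs => rw [← crossSign_map_succ e]
  rw [crossSign, consSet, Finset.prod_insert (zero_notMem_map_succ I)]
  rw [Finset.prod_eq_one, one_mul]
  · rfl
  · intro j _; simp [inversionSign]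

/-- The additional sign is the cost of moving the new variable to the front past ε_I. -/
theorem crossSign_consSet_right (e : ZMod 2) (I J : Finset (Fin n)) :
    crossSign (consParity e p) (I.map (Fin.succEmb n)) (consSet J) =
      swapSign (∑ i ∈ I, p i) e * crossSign p I J := by
  rw [← crossSign_map_succ (p := p) e I J, swapSign_sum_left]
  simp only [crossSign, consSet, Finset.prod_insert (zero_notMem_map_succ J),
    Finset.prod_mul_distrib]
  congr 1
  simp [inversionSign]

theorem disjoint_consSet_iff (I J : Finset (Fin n)) :
    Disjoint (consSet I) (J.map (Fin.succEmb n)) ↔ Disjoint I J := by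
  rw [consSet, Finset.disjoint_insert_left, Finset.disjoint_map]
  exact and_iff_right (zero_notMem_map_succ J)

theorem consSet_union (I J : Finset (Fin n)) :
    consSet I ∪ J.map (Fin.succEmb n) = consSet (I ∪ J) := by
  rw [consSet, consSet, Finset.map_union, Finset.insert_union]

theorem consSet_univ : consSet (Finset.univ : Finset (Fin n)) = Finset.univ := by
  ext i
  refine Fin.cases ?_ (fun i => ?_) i <;> simp [consSet]

theorem consSet_nonempty (I : Finset (Fin n)) : (consSet I).Nonempty :=
  ⟨0, Finset.mem_insert_self _ _⟩

theorem consSet_injective : Function.Injective (consSet : Finset (Fin n) → _) := by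
  intro I J h
  have := congrArg (fun S => S.erase 0) h
  simp only [consSet, Finset.erase_insert (zero_notMem_map_succ _)] at this
  exact Finset.map_injective _ this

/-- The multiplication by the new variable. -/
def shift (e : ZMod 2) : SetFun p R →ₗ[K] SetFun (consParity e p) R where
  toFun β := ∑ I, single (consSet I) (β I)
  map_add' β γ := by simp only [add_apply, single_add, Finset.sum_add_distrib]
  map_smul' c β := by simp only [smul_apply, single_smul, Finset.smul_sum, RingHom.id_apply]

theorem shift_eq_sum (e : ZMod 2) (β : SetFun p R) :
    shift (K := K) e β = ∑ I, single (consSet I) (β I) := rfl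

theorem shift_single (e : ZMod 2) (U : Finset (Fin n)) (s : R) :
    shift (K := K) e (single U s : SetFun p R) = single (consSet U) s := by
  rw [shift_eq_sum, Finset.sum_eq_single U]
  · simp
  · intro V _ hV; simp [single_apply, hV]
  · simp

theorem shift_apply_univ (e : ZMod 2) (β : SetFun p R) :
    shift (K := K) e β Finset.univ = β Finset.univ := by
  rw [shift_eq_sum, sum_apply, Finset.sum_eq_single Finset.univ]
  · rw [consSet_univ, single_same]
  · intro V _ hV
    rw [single_apply, if_neg]
    rw [← consSet_univ]
    exact fun h => hV (consSet_injective h).symm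
  · simp

theorem map_shift (e : ZMod 2) (f : R →ₗ[K] R') (β : SetFun p R) :
    map (consParity e p) f (shift (K := K) e β) = shift (K := K) e (map p f β) := by
  simp only [shift_eq_sum, map_sum, map_single, map_apply]

theorem isFamily_succ (e : ZMod 2) (p : Fin n → ZMod 2) :
    IsFamily (consParity e p) p (fun i => {i.succ}) where
  disjoint i j h := by simpa using h
  nonempty i := Finset.singleton_nonempty _
  parity j := by simp [famParity]

variable (K R) in
/-- The inclusion of the set functions that do not involve the new variable. -/
def incl (e : ZMod 2) (p : Fin n → ZMod 2) : SetFun p R →ₐ[K] SetFun (consParity e p) R :=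
  transport K (isFamily_succ e p)

theorem incl_single (e : ZMod 2) (U : Finset (Fin n)) (s : R) :
    incl K R e p (single U s) = single (U.map (Fin.succEmb n)) s := by
  rw [incl, transport_single]
  have h1 : famSign (consParity e p) (fun i : Fin n => {i.succ}) U = 1 :=
    Finset.prod_eq_one fun i _ => Finset.prod_eq_one fun j _ => by
      split_ifs with h
      · exact crossSign_eq_one_of_lt _ (by simpa using h)
      · rfl
  rw [h1, one_smul]
  congr 1
  ext i; simp [eq_comm]

theorem shift_mul_incl (e : ZMod 2) (β γ : SetFun p R) :
    shift (K := K) e β * incl K R e p γ = shift (K := K) e (β * γ) := by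
  rw [eq_sum_single β, eq_sum_single γ]
  simp only [Finset.sum_mul, Finset.mul_sum, map_sum]
  refine Finset.sum_congr rfl fun T _ => Finset.sum_congr rfl fun U _ => ?_
  rw [shift_single, incl_single, single_mul_single, single_mul_single]
  by_cases h : Disjoint U T
  · rw [if_pos h, if_pos ((disjoint_consSet_iff U T).mpr h), shift_single, crossSign_consSet_left,
      consSet_union]
  · rw [if_neg h, if_neg fun h' => h ((disjoint_consSet_iff U T).mp h'), map_zero]

theorem map_incl (e : ZMod 2) (f : R →ₗ[K] R') (β : SetFun p R) :
    map (consParity e p) f (incl K R e p β) = incl K R' e p (map p f β) :=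
  map_transport _ f β

theorem isEven_shift {β : SetFun p R} (e : ZMod 2) (hβ : ∀ T, π (∑ i ∈ T, p i + e) (β T) = β T) :
    IsEven π (shift (K := K) e β) :=
  IsEven.sum fun I _ => IsEven.single (by rw [sum_consSet]; exact hβ I)

theorem isEven_famGen {k : ℕ} {S : Fin k → Finset (Fin n)} {b : Fin k → R}
    (hb : ∀ j, π (∑ i ∈ S j, p i) (b j) = b j) : IsEven π (famGen S b : SetFun p R) :=
  IsEven.sum fun j _ => IsEven.single (hb j)

/-- Odd elements have square zero. -/
theorem incl_mul_shift_self [CharZero K] (hπ : IsSuperCommutative π) {β : SetFun p R}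
    (hβ : ∀ T, π (∑ i ∈ T, p i + 1) (β T) = β T) :
    incl K R 1 p β * shift (K := K) 1 β = 0 := by
  set F : Finset (Fin n) → Finset (Fin n) → SetFun (consParity 1 p) R := fun T U =>
    incl K R 1 p (single T (β T)) * shift (K := K) 1 (single U (β U)) with hF
  have h1 : incl K R 1 p β * shift (K := K) 1 β = ∑ T, ∑ U, F T U := by
    conv_lhs => rw [eq_sum_single β]
    simp only [Finset.sum_mul, Finset.mul_sum, map_sum, hF]
    exact Finset.sum_comm
  -- Exchanging T and U reverses the sign: besides the two monomials and the two odd coefficients,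
  -- the new odd variable has to pass ε_U instead of ε_T. The double sum therefore equals its own
  -- negative, and 2 is invertible.
  have h2 : ∀ T U, F T U = -F U T := by
    intro T U
    simp only [hF, incl_single, shift_single, single_mul_single]
    by_cases h : Disjoint T U
    · rw [if_pos ((disjoint_consSet_iff U T).mpr h.symm).symm,
        if_pos ((disjoint_consSet_iff T U).mpr h).symm, Finset.union_comm, consSet_union, Finset.union_comm _ (consSet T),
        consSet_union, Finset.union_comm U T, crossSign_consSet_right, crossSign_consSet_right,
        ← neg_one_zsmul, ← single_zsmul, hπ.comm _ _ _ _ (hβ T) (hβ U), smul_smul, smul_smul]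
      congr 2
      have h3 := crossSign_mul_swap p h
      have h4 := crossSign_mul_self p T U
      have h5 := swapSign_add_one (∑ i ∈ T, p i) (∑ i ∈ U, p i)
      have h6 := swapSign_mul_self (∑ i ∈ U, p i + 1) (∑ i ∈ T, p i + 1)
      rw [h5, swapSign_comm (∑ i ∈ T, p i + 1), ← h3]
      linear_combination (-swapSign (∑ i ∈ U, p i) 1 * crossSign p U T) * h4 *
        (swapSign (∑ i ∈ U, p i + 1) (∑ i ∈ T, p i + 1) *
          swapSign (∑ i ∈ U, p i + 1) (∑ i ∈ T, p i + 1)) -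
        swapSign (∑ i ∈ U, p i) 1 * crossSign p U T * h6
    · rw [if_neg fun h' => h ((disjoint_consSet_iff U T).mp h'.symm).symm,
        if_neg fun h' => h ((disjoint_consSet_iff T U).mp h'.symm), neg_zero]
  have h3 : ∑ T, ∑ U, F T U = -∑ T, ∑ U, F T U := by
    conv_lhs => rw [Finset.sum_comm]
    rw [← Finset.sum_neg_distrib]
    refine Finset.sum_congr rfl fun T _ => ?_
    rw [← Finset.sum_neg_distrib]
    exact Finset.sum_congr rfl fun U _ => h2 U T
  rw [h1]
  have h4 : (2 : K) • ∑ T, ∑ U, F T U = 0 := by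
    rw [two_smul]
    nth_rewrite 2 [h3]
    exact add_neg_cancel _
  exact (smul_eq_zero.mp h4).resolve_left two_ne_zero

end Shift

theorem nilLog_apply_empty {n : ℕ} {p : Fin n → ZMod 2} {R : Type*} [Ring R]
    [Algebra K R] {g : SetFun p R} (h0 : (g - 1) ∅ = 0) : nilLog K g ∅ = 0 := by
  have h : ∀ i, ((g - 1) ^ (i + 1) : SetFun p R) ∅ = 0 := fun i => pow_apply_eq_zero h0 _ _ (by simp)
  rw [nilLog, nilSeries_eq_sum _ (pow_eq_zero h0), sum_apply, Finset.sum_range_succ']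
  simp [h]

/-! ### Compositions of coderivations -/

section CompCoder

variable {n : ℕ} {p : Fin n → ZMod 2} {R : Type*} [Ring R] [Algebra K R]
variable {R' : Type*} [Ring R'] [Algebra K R']
variable {π : ZMod 2 → R →ₗ[K] R} {π' : ZMod 2 → R' →ₗ[K] R'}

/-- The set `{0} ∪ I` together with the singletons outside of it. -/
def consFamily (I : Finset (Fin n)) : Fin (Iᶜ.card + 1) → Finset (Fin (n + 1)) :=
  Fin.cons (consSet I) (fun j => {(Iᶜ.orderEmbOfFin rfl j).succ})

theorem isFamily_consFamily (e : ZMod 2) (I : Finset (Fin n)) :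
    IsFamily (consParity e p) (consParity (∑ i ∈ I, p i + e) (restrict Iᶜ p)) (consFamily I) where
  disjoint := by
    have h0 : ∀ j, Disjoint (consSet I) ({(Iᶜ.orderEmbOfFin rfl j).succ} : Finset _) := fun j => by
      have := Iᶜ.orderEmbOfFin_mem rfl j
      rw [Finset.mem_compl] at this
      simpa [consSet, Fin.succ_ne_zero] using this
    intro i j
    refine Fin.cases ?_ (fun i => ?_) i <;> refine Fin.cases ?_ (fun j => ?_) j
    · intro h; exact absurd rfl h
    · intro _; exact h0 j
    · intro _; exact (h0 i).symm
    · intro h; simpa [consFamily] using h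
  nonempty i := by
    refine Fin.cases ?_ (fun i => ?_) i
    · exact consSet_nonempty I
    · exact Finset.singleton_nonempty _
  parity j := by
    refine Fin.cases ?_ (fun j => ?_) j
    · exact (sum_consSet e I).symm
    · simp [famParity, consFamily, restrict]

/-- The new variable stands first and causes no sign, so the sign is exactly that of the unshuffle
in `compCoder`. -/
theorem famSign_consFamily (e : ZMod 2) (I : Finset (Fin n)) :
    famSign (consParity e p) (consFamily I) Finset.univ = crossSign p I Iᶜ := by
  rw [famSign, Fin.prod_univ_succ, Finset.prod_eq_one (s := Finset.univ (α := Fin Iᶜ.card)), mul_one]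
  · rw [Fin.prod_univ_succ, if_neg (lt_irrefl _), one_mul]
    rw [← crossSign_consSet_left e]
    simp only [Fin.succ_pos, if_true]
    change ∏ j, crossSign _ (consSet I) {(Iᶜ.orderEmbOfFin rfl j).succ} = _
    unfold crossSign
    rw [Finset.prod_comm]
    refine Finset.prod_congr rfl fun i _ => ?_
    rw [Finset.prod_map]
    conv_rhs => rw [← Finset.map_orderEmbOfFin_univ Iᶜ rfl, Finset.prod_map]
    simp
  · intro i _
    refine Finset.prod_eq_one fun j _ => ?_
    refine Fin.cases ?_ (fun j => ?_) j
    · simp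
    · split_ifs with h
      · exact crossSign_eq_one_of_lt _ (by simpa [consFamily] using h)
      · rfl

theorem biUnion_consFamily (I : Finset (Fin n)) :
    Finset.univ.biUnion (consFamily I) = consSet I ∪ Iᶜ.map (Fin.succEmb n) := by
  ext x
  rw [Finset.mem_biUnion, Finset.mem_union]
  constructor
  · rintro ⟨j, -, hj⟩
    revert hj
    refine Fin.cases (fun hj => Or.inl hj) (fun j hj => Or.inr ?_) j
    have := Iᶜ.orderEmbOfFin_mem rfl j
    have hj' : x = (Iᶜ.orderEmbOfFin rfl j).succ := by simpa [consFamily] using hj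
    rw [hj']
    exact Finset.mem_map_of_mem (Fin.succEmb n) this
  · rintro (h | h)
    · exact ⟨0, Finset.mem_univ _, h⟩
    · obtain ⟨i, hi, rfl⟩ := Finset.mem_map.mp h
      rw [← Finset.map_orderEmbOfFin_univ Iᶜ rfl] at hi
      obtain ⟨j, -, rfl⟩ := Finset.mem_map.mp hi
      exact ⟨j.succ, Finset.mem_univ _, by simp [consFamily]⟩

theorem consSet_union_compl (I : Finset (Fin n)) :
    consSet I ∪ Iᶜ.map (Fin.succEmb n) = Finset.univ := by
  rw [consSet_union, Finset.union_compl, consSet_univ]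

theorem famGen_consFamily (e : ZMod 2) (I : Finset (Fin n)) (y : R) (a : Fin n → R) :
    (famGen (consFamily I) (Fin.cons y (restrict Iᶜ a) : Fin (Iᶜ.card + 1) → R) :
        SetFun (consParity e p) R) =
      single (consSet I) y + res K (Iᶜ.map (Fin.succEmb n)) (incl K R e p (gen a)) := by
  rw [famGen, Fin.sum_univ_succ, incl, transport_gen]
  congr 1
  exact (res_famGen_singleton (Fin.succEmb n) Iᶜ (W := Iᶜ.map (Fin.succEmb n)) (by simp) a).symm

variable [CharZero K] (hπ : IsSuperCommutative π)
include hπ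

omit [CharZero K] hπ in
theorem cons_homogeneous {e : ZMod 2} {I : Finset (Fin n)} {y : R} {a : Fin n → R}
    (ha : ∀ i, π (p i) (a i) = a i) (hy : π (∑ i ∈ I, p i + e) y = y) (j : Fin (Iᶜ.card + 1)) :
    π (consParity (∑ i ∈ I, p i + e) (restrict Iᶜ p) j)
      ((Fin.cons y (restrict Iᶜ a) : Fin (Iᶜ.card + 1) → R) j) =
        (Fin.cons y (restrict Iᶜ a) : Fin (Iᶜ.card + 1) → R) j := by
  refine Fin.cases ?_ (fun j => ?_) j
  · exact hy
  · exact ha _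

/-- The composite is the derivative of D(e^x) e^(-x) in the direction η y, where η is the new odd
variable and y the generating function of the inner operations. Each unshuffle gives the term with y
replaced by one of its monomials, and linearity in y performs the sum. The empty subset is harmless
since y ∅ = 0. -/
theorem compCoder_koszulBracket_eq {a : Fin n → R} (ha : ∀ i, π (p i) (a i) = a i)
    {D : R →ₗ[K] R} (hD : D 1 = 0) {r : (n : ℕ) → (Fin n → R) → R} {y : SetFun p R}
    (hy : ∀ I, π (∑ i ∈ I, p i + 1) (y I) = y I) (hy0 : y ∅ = 0)
    (hr : ∀ I : Finset (Fin n), r I.card (restrict I a) = y I) :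
    compCoder (fun m => koszulBracket π D m) r n p a =
      (map _ D (incl K R 1 p (nilExp K (gen a)) * shift (K := K) 1 y) *
        incl K R 1 p (nilExp K (-gen a)) : SetFun (consParity 1 p) R) Finset.univ -
      (map _ D (incl K R 1 p (nilExp K (gen a))) *
        (incl K R 1 p (nilExp K (-gen a)) * shift (K := K) 1 y) :
          SetFun (consParity 1 p) R) Finset.univ := by
  have hn : IsNilpotent (gen a : SetFun p R) := isNilpotent (gen_apply_empty a)
  have hterm : ∀ I : Finset (Fin n), koszulSign p (unshuffle I) •
      koszulBracket π D (Iᶜ.card + 1) (Fin.cons (r I.card (restrict I a)) (restrict Iᶜ a)) =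
      (map _ D (incl K R 1 p (nilExp K (gen a)) * single (consSet I) (y I)) *
        incl K R 1 p (nilExp K (-gen a)) : SetFun (consParity 1 p) R) Finset.univ -
      (map _ D (incl K R 1 p (nilExp K (gen a))) *
        (incl K R 1 p (nilExp K (-gen a)) * single (consSet I) (y I)) :
          SetFun (consParity 1 p) R) Finset.univ := by
    intro I
    rw [hr I, koszulSign_unshuffle, koszulBracket_eq_signedKoszul hπ D
      (cons_homogeneous ha (hy I)), ← famSign_consFamily 1 I,
      famSign_smul_signedKoszul hπ (isFamily_consFamily 1 I) (cons_homogeneous ha (hy I)) hD,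
      famGen_consFamily (K := K), biUnion_consFamily, koszul_adjoin_single hπ (consSet_nonempty I)
        ((disjoint_consSet_iff I Iᶜ).mpr disjoint_compl_right), ← map_neg,
      ← map_nilExp _ hn, ← map_nilExp _ hn.neg, consSet_union_compl]
    · rw [incl, transport_gen]
      exact isEven_famGen fun j => by simpa using ha j
    · rw [incl, transport_apply_empty, gen_apply_empty]
    · rw [sum_consSet]; exact hy I
  rw [compCoder, Finset.sum_subset (Finset.subset_univ _)]
  · rw [Finset.sum_congr rfl fun I _ => hterm I, Finset.sum_sub_distrib, ← sum_apply, ← sum_apply,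
      ← Finset.sum_mul, ← map_sum, ← Finset.mul_sum, ← Finset.mul_sum, ← Finset.mul_sum]
    rfl
  · intro I _ hI
    have hI' : I = ∅ := by simpa using hI
    rw [hterm I, hI', hy0]
    simp

theorem compCoder_cumulant_eq (hπ' : IsSuperCommutative π') {a : Fin n → R}
    (ha : ∀ i, π (p i) (a i) = a i) {f : R →ₗ[K] R'} (hf : f 1 = 1)
    (hfe : ∀ e r, π e r = r → π' e (f r) = f r) {r : (n : ℕ) → (Fin n → R) → R} {y : SetFun p R}
    (hy : ∀ I, π (∑ i ∈ I, p i + 1) (y I) = y I) (hy0 : y ∅ = 0)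
    (hr : ∀ I : Finset (Fin n), r I.card (restrict I a) = y I) {gi : SetFun p R'}
    (hgi : map p f (nilExp K (gen a)) * gi = 1) :
    compCoder (fun m => cumulant π f m) r n p a =
      (map _ f (incl K R 1 p (nilExp K (gen a)) * shift (K := K) 1 y) *
        incl K R' 1 p gi : SetFun (consParity 1 p) R') Finset.univ := by
  have hn : IsNilpotent (gen a : SetFun p R) := isNilpotent (gen_apply_empty a)
  have hterm : ∀ I : Finset (Fin n), koszulSign p (unshuffle I) •
      cumulant π f (Iᶜ.card + 1) (Fin.cons (r I.card (restrict I a)) (restrict Iᶜ a)) =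
      (map _ f (incl K R 1 p (nilExp K (gen a)) * single (consSet I) (y I)) *
        incl K R' 1 p gi : SetFun (consParity 1 p) R') Finset.univ := by
    intro I
    rw [hr I, koszulSign_unshuffle, cumulant_eq_signedCumulant hπ f
      (cons_homogeneous ha (hy I)), ← famSign_consFamily 1 I,
      famSign_smul_signedCumulant hπ (isFamily_consFamily 1 I) (cons_homogeneous ha (hy I)) hf,
      famGen_consFamily (K := K), biUnion_consFamily,
      cumulant_adjoin_single hπ hπ' (consSet_nonempty I)
        ((disjoint_consSet_iff I Iᶜ).mpr disjoint_compl_right) (gi := incl K R' 1 p gi) ?_ ?_ ?_ hf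
        hfe, ← map_nilExp _ hn, consSet_union_compl]
    · rw [← map_nilExp _ hn, map_incl, ← map_mul, hgi, _root_.map_one]
    · rw [incl, transport_gen]
      exact isEven_famGen fun j => by simpa using ha j
    · rw [incl, transport_apply_empty, gen_apply_empty]
    · rw [sum_consSet]; exact hy I
  rw [compCoder, Finset.sum_subset (Finset.subset_univ _)]
  · rw [Finset.sum_congr rfl fun I _ => hterm I, ← sum_apply,
      ← Finset.sum_mul, ← map_sum, ← Finset.mul_sum]
    rfl
  · intro I _ hI
    have hI' : I = ∅ := by simpa using hI
    rw [hterm I, hI', hy0]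
    simp

/-- The Koszul brackets of the arguments as a set function. -/
theorem koszulBracket_restrict {a : Fin n → R} (ha : ∀ i, π (p i) (a i) = a i) {D : R →ₗ[K] R}
    (hD : D 1 = 0) (I : Finset (Fin n)) :
    koszulBracket π D I.card (restrict I a) =
      (map p D (nilExp K (gen a)) * nilExp K (-gen a) : SetFun p R) I := by
  rw [koszulBracket_eq_signedKoszul hπ D (p := restrict I p) (a := restrict I a) (fun i => ha _),
    signedKoszul_restrict hπ ha hD]

theorem cumulant_restrict {a : Fin n → R} (ha : ∀ i, π (p i) (a i) = a i) {f : R →ₗ[K] R'}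
    (hf : f 1 = 1) (I : Finset (Fin n)) :
    cumulant π f I.card (restrict I a) = nilLog K (map p f (nilExp K (gen a))) I := by
  rw [cumulant_eq_signedCumulant hπ f (p := restrict I p) (a := restrict I a) (fun i => ha _),
    signedCumulant_restrict hπ ha hf]

omit [CharZero K] in
theorem isOdd_map_mul {e e' : SetFun p R} (he : IsEven π e) (he' : IsEven π e') {D : R →ₗ[K] R}
    (hDo : ∀ e r, π e r = r → π (e + 1) (D r) = D r) (I : Finset (Fin n)) :
    π (∑ i ∈ I, p i + 1) ((map p D e * e' : SetFun p R) I) = (map p D e * e' : SetFun p R) I := by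
  rw [mul_apply, map_sum]
  refine Finset.sum_congr rfl fun T _ => ?_
  rw [map_sum]
  refine Finset.sum_congr rfl fun U _ => ?_
  split_ifs with h
  · rw [map_zsmul, ← h.2, Finset.sum_union h.1, add_right_comm, map_apply,
      hπ.mul _ _ _ _ (hDo _ _ (he T)) (he' U)]
  · simp

/-- The Koszul brackets of a differential satisfy the higher Jacobi identities. -/
theorem compCoder_koszulBracket_self {a : Fin n → R} (ha : ∀ i, π (p i) (a i) = a i)
    {D : R →ₗ[K] R} (hD : D 1 = 0) (hDo : ∀ e r, π e r = r → π (e + 1) (D r) = D r)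
    (hDD : ∀ r, D (D r) = 0) :
    compCoder (fun m => koszulBracket π D m) (fun m => koszulBracket π D m) n p a = 0 := by
  have hn : IsNilpotent (gen a : SetFun p R) := isNilpotent (gen_apply_empty a)
  have hge : IsEven π (gen a : SetFun p R) := isEven_gen ha
  have hodd := isOdd_map_mul hπ (hge.nilExp hπ) (hge.neg.nilExp hπ) hDo
  have hince : IsEven π (incl K R 1 p (nilExp K (gen a))) := by
    rw [map_nilExp _ hn, incl, transport_gen]
    exact IsEven.nilExp hπ (isEven_famGen fun j => by simpa using ha j)
  rw [compCoder_koszulBracket_eq hπ ha hD hodd ?_ (fun I => koszulBracket_restrict hπ ha hD I)]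
  -- With y = D(e^x) e^(-x) one has e^x η y = η D(e^x), so the first term contains D(D(e^x)) = 0.
  -- The second one is y times η y, zero because y is odd.
  · rw [(hince.commute hπ (isEven_shift 1 hodd)).eq, shift_mul_incl, mul_assoc,
      nilExp_neg_mul_nilExp hn, mul_one, map_shift]
    have h1 : map p D (map p D (nilExp K (gen a))) = 0 := by ext T; simp [hDD]
    rw [h1, map_zero, zero_mul, map_incl, ← mul_assoc, ← map_mul, incl_mul_shift_self hπ hodd]
    simp
  · rw [mul_apply_empty, map_apply, nilExp_apply_empty (gen_apply_empty a), hD, zero_mul]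

/-- The composition of the cumulants of `f` with the Koszul brackets of `D`. -/
theorem compCoder_cumulant_koszulBracket (hπ' : IsSuperCommutative π') {a : Fin n → R}
    (ha : ∀ i, π (p i) (a i) = a i) {f : R →ₗ[K] R'} (hf : f 1 = 1)
    (hfe : ∀ e r, π e r = r → π' e (f r) = f r)
    {D : R →ₗ[K] R} (hD : D 1 = 0) (hDo : ∀ e r, π e r = r → π (e + 1) (D r) = D r)
    {gi : SetFun p R'} (hgi : map p f (nilExp K (gen a)) * gi = 1) :
    compCoder (fun m => cumulant π f m) (fun m => koszulBracket π D m) n p a =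
      (map p f (map p D (nilExp K (gen a))) * gi) Finset.univ := by
  have hn : IsNilpotent (gen a : SetFun p R) := isNilpotent (gen_apply_empty a)
  have hge : IsEven π (gen a : SetFun p R) := isEven_gen ha
  have hodd := isOdd_map_mul hπ (hge.nilExp hπ) (hge.neg.nilExp hπ) hDo
  have hince : IsEven π (incl K R 1 p (nilExp K (gen a))) := by
    rw [map_nilExp _ hn, incl, transport_gen]
    exact IsEven.nilExp hπ (isEven_famGen fun j => by simpa using ha j)
  rw [compCoder_cumulant_eq hπ hπ' ha hf hfe hodd ?_
    (fun I => koszulBracket_restrict hπ ha hD I) hgi]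
  -- Again e^x η y = η D(e^x), and the top coefficient becomes that of f(D(e^x)) f(e^x)^(-1).
  · rw [(hince.commute hπ (isEven_shift 1 hodd)).eq, shift_mul_incl, mul_assoc,
      nilExp_neg_mul_nilExp hn, mul_one, map_shift, shift_mul_incl, shift_apply_univ]
  · rw [mul_apply_empty, map_apply, nilExp_apply_empty (gen_apply_empty a), hD, zero_mul]

omit [Ring R] [Algebra K R] hπ in
/-- The composition of the Koszul brackets of `D` with a family of even elements. -/
theorem compMorphism_koszulBracket (hπ' : IsSuperCommutative π') {a : Fin n → R}
    {D : R' →ₗ[K] R'} (hD : D 1 = 0) {f : (n : ℕ) → (Fin n → R) → R'} {α : SetFun p R'}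
    (hα : IsEven π' α) (hα0 : α ∅ = 0)
    (hf : ∀ I : Finset (Fin n), I.Nonempty → f I.card (restrict I a) = α I) :
    compMorphism (K := K) (fun m => koszulBracket π' D m) f n p a =
      (map p D (nilExp K α) * nilExp K (-α)) Finset.univ := by
  rw [← sum_signedKoszul hα0 hD, compMorphism]
  refine Finset.sum_congr rfl fun k _ => ?_
  congr 1
  refine Finset.sum_congr rfl fun φ _ => ?_
  congr 1
  have h1 : (fun j => f (block φ.1 j).card (restrict (block φ.1 j) a)) =
      fun j => α (block φ.1 j) := funext fun j => hf _ (block_nonempty φ.2 j)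
  rw [h1]
  exact koszulBracket_eq_signedKoszul hπ' D fun j => hα (block φ.1 j)

/-- With L = log f(e^x) one has e^L = f(e^x) and e^(-L) = f(e^x)^(-1). Comparison with
`compCoder_cumulant_koszulBracket` shows that a map intertwining two differentials has cumulants
intertwining their brackets. -/
theorem compMorphism_koszulBracket_cumulant (hπ' : IsSuperCommutative π') {a : Fin n → R}
    (ha : ∀ i, π (p i) (a i) = a i) {f : R →ₗ[K] R'} (hf : f 1 = 1)
    (hfe : ∀ e r, π e r = r → π' e (f r) = f r) {D : R' →ₗ[K] R'} (hD : D 1 = 0)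
    {gi : SetFun p R'} (hgi : map p f (nilExp K (gen a)) * gi = 1) :
    compMorphism (K := K) (fun m => koszulBracket π' D m) (fun m => cumulant π f m) n p a =
      (map p D (map p f (nilExp K (gen a))) * gi) Finset.univ := by
  have hge : IsEven π (gen a : SetFun p R) := isEven_gen ha
  have hgn : IsNilpotent (map p f (nilExp K (gen a : SetFun p R)) - 1) :=
    isNilpotent (map_apply_empty_eq_one hf (nilExp_apply_empty (gen_apply_empty a)))
  have hLe : IsEven π' (nilLog K (map p f (nilExp K (gen a : SetFun p R)))) :=
    ((hge.nilExp hπ).map hfe).nilLog hπ'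
  have hL0 : nilLog K (map p f (nilExp K (gen a : SetFun p R))) ∅ = 0 :=
    nilLog_apply_empty (K := K) (map_apply_empty_eq_one hf (nilExp_apply_empty (gen_apply_empty a)))
  rw [compMorphism_koszulBracket hπ' hD hLe hL0 (fun I _ => cumulant_restrict hπ ha hf I),
    nilExp_nilLog hgn]
  have h1 : gi = nilExp K (-nilLog K (map p f (nilExp K (gen a)))) := by
    have h2 := nilExp_neg_mul_nilExp (K := K) (isNilpotent_nilLog (K := K) hgn)
    rw [nilExp_nilLog hgn] at h2
    rw [← mul_one (nilExp K (-nilLog K (map p f (nilExp K (gen a))))), ← hgi, ← mul_assoc, h2,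
      one_mul]
  rw [← h1]

end CompCoder

end SetFun

end

end DerivedBV

/-! ### Leibniz rule for brackets and product formula for cumulants. -/

namespace DerivedBV

noncomputable section

variable {K : Type*} [Field K]

namespace SetFun

/-! ### Appending an argument -/

section Append

variable {m n : ℕ} {q : Fin n → ZMod 2} {R : Type*} [Ring R] [Algebra K R]
variable {R' : Type*} [Ring R'] [Algebra K R']
variable {π : ZMod 2 → R →ₗ[K] R} {π' : ZMod 2 → R' →ₗ[K] R'}

/-- A family of points followed by the set `T0`. -/
def snocFamily (ε : Fin m ↪o Fin n) (T0 : Finset (Fin n)) : Fin (m + 1) → Finset (Fin n) :=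
  Fin.snoc (fun j => {ε j}) T0

@[simp] theorem snocFamily_castSucc (ε : Fin m ↪o Fin n) (T0 : Finset (Fin n)) (j : Fin m) :
    snocFamily ε T0 j.castSucc = {ε j} := Fin.snoc_castSucc (α := fun _ => Finset (Fin n)) _ _ _

@[simp] theorem snocFamily_last (ε : Fin m ↪o Fin n) (T0 : Finset (Fin n)) :
    snocFamily ε T0 (Fin.last m) = T0 := Fin.snoc_last (α := fun _ => Finset (Fin n)) _ _

/-- The parities of a family of points followed by the set `T0`. -/
def snocParity (q : Fin n → ZMod 2) (ε : Fin m ↪o Fin n) (T0 : Finset (Fin n)) :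
    Fin (m + 1) → ZMod 2 := Fin.snoc (fun j => q (ε j)) (∑ i ∈ T0, q i)

theorem isFamily_snocFamily (ε : Fin m ↪o Fin n) {T0 : Finset (Fin n)} (h0 : T0.Nonempty)
    (hlt : ∀ j, ∀ t ∈ T0, ε j < t) :
    IsFamily q (snocParity q ε T0) (snocFamily ε T0) where
  disjoint := by
    have h : ∀ j, Disjoint ({ε j} : Finset (Fin n)) T0 := fun j => by
      rw [Finset.disjoint_singleton_left]
      exact fun h => lt_irrefl _ (hlt j _ h)
    intro i j
    refine Fin.lastCases ?_ (fun i => ?_) i <;> refine Fin.lastCases ?_ (fun j => ?_) j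
    · intro h; exact absurd rfl h
    · intro _; simpa using (h j).symm
    · intro _; simpa using h i
    · intro h; simpa using h
  nonempty i := by
    refine Fin.lastCases ?_ (fun i => ?_) i
    · simpa using h0
    · simp
  parity j := by
    refine Fin.lastCases ?_ (fun j => ?_) j <;> simp [snocParity, famParity]

theorem famSign_snocFamily (ε : Fin m ↪o Fin n) {T0 : Finset (Fin n)}
    (hlt : ∀ j, ∀ t ∈ T0, ε j < t) : famSign q (snocFamily ε T0) Finset.univ = 1 :=
  Finset.prod_eq_one fun i _ => Finset.prod_eq_one fun j _ => by
    split_ifs with h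
    · revert h
      refine Fin.lastCases ?_ (fun i => ?_) i
      · intro h; exact absurd h (Fin.le_last j).not_gt
      · refine Fin.lastCases ?_ (fun j => ?_) j
        · intro _
          exact crossSign_eq_one_of_lt _ (by simpa using hlt i)
        · intro h
          exact crossSign_eq_one_of_lt _ (by simpa using h)
    · rfl

theorem biUnion_snocFamily (ε : Fin m ↪o Fin n) (T0 : Finset (Fin n)) :
    Finset.univ.biUnion (snocFamily ε T0) = T0 ∪ Finset.univ.map ε.toEmbedding := by
  ext x
  simp only [Finset.mem_biUnion, Finset.mem_univ, true_and, Finset.mem_union, Finset.mem_map,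
    Fin.exists_fin_succ', snocFamily_castSucc, snocFamily_last, Finset.mem_singleton,
    RelEmbedding.coe_toEmbedding]
  rw [or_comm]
  simp [eq_comm]

theorem famGen_snocFamily (ε : Fin m ↪o Fin n) (T0 : Finset (Fin n)) (a : Fin m → R) (y : R) :
    (famGen (snocFamily ε T0) (Fin.snoc a y : Fin (m + 1) → R) : SetFun q R) =
      single T0 y + famGen (fun j => {ε j}) a := by
  rw [famGen, Fin.sum_univ_castSucc, add_comm, famGen]
  simp

theorem snoc_homogeneous {ε : Fin m ↪o Fin n} {T0 : Finset (Fin n)} {a : Fin m → R} {y : R}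
    (ha : ∀ j, π (q (ε j)) (a j) = a j) (hy : π (∑ i ∈ T0, q i) y = y) (j : Fin (m + 1)) :
    π (snocParity q ε T0 j) ((Fin.snoc a y : Fin (m + 1) → R) j) =
      (Fin.snoc a y : Fin (m + 1) → R) j := by
  refine Fin.lastCases ?_ (fun j => ?_) j <;> simp [snocParity, ha, hy]

theorem disjoint_snoc {ε : Fin m ↪o Fin n} {T0 : Finset (Fin n)}
    (hlt : ∀ j, ∀ t ∈ T0, ε j < t) : Disjoint T0 (Finset.univ.map ε.toEmbedding) := by
  rw [Finset.disjoint_right]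
  intro i hi hi'
  obtain ⟨j, -, rfl⟩ := Finset.mem_map.mp hi
  exact lt_irrefl _ (hlt j _ hi')

section

variable [CharZero K] (hπ : IsSuperCommutative π) {ε : Fin m ↪o Fin n} {T0 : Finset (Fin n)}
  (h0 : T0.Nonempty) (hlt : ∀ j, ∀ t ∈ T0, ε j < t) {a : Fin m → R} {y : R}
  (ha : ∀ j, π (q (ε j)) (a j) = a j) (hy : π (∑ i ∈ T0, q i) y = y) {x : SetFun q R}
  (hx : IsEven π x) (hx0 : x ∅ = 0)
  (hxa : res K (Finset.univ.map ε.toEmbedding) x = famGen (fun j => {ε j}) a)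
include hπ h0 hlt ha hy hx hx0 hxa

/-- The element x only has to restrict to the generating element of the given arguments. This
freedom allows brackets of different subtuples to be compared inside one algebra on n + 2 variables.
-/
theorem koszulBracket_snoc {D : R →ₗ[K] R} (hD : D 1 = 0) :
    koszulBracket π D (m + 1) (Fin.snoc a y) =
      (map q D (nilExp K x * single T0 y) * nilExp K (-x) -
        map q D (nilExp K x) * (nilExp K (-x) * single T0 y) : SetFun q R)
          (T0 ∪ Finset.univ.map ε.toEmbedding) := by
  rw [koszulBracket_eq_signedKoszul hπ D (snoc_homogeneous ha hy), ← one_smul ℤ (signedKoszul _ _ _),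
    ← famSign_snocFamily (q := q) ε hlt, famSign_smul_signedKoszul hπ (isFamily_snocFamily ε h0 hlt)
    (snoc_homogeneous ha hy) hD, famGen_snocFamily, ← hxa, biUnion_snocFamily,
    koszul_adjoin_single hπ h0 (disjoint_snoc hlt) hx hx0 hy, sub_apply]

theorem cumulant_snoc (hπ' : IsSuperCommutative π') {f : R →ₗ[K] R'} (hf : f 1 = 1)
    (hfe : ∀ e r, π e r = r → π' e (f r) = f r) {gi : SetFun q R'}
    (hgi : map q f (nilExp K x) * gi = 1) :
    cumulant π f (m + 1) (Fin.snoc a y) =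
      (map q f (nilExp K x * single T0 y) * gi) (T0 ∪ Finset.univ.map ε.toEmbedding) := by
  rw [cumulant_eq_signedCumulant hπ f (snoc_homogeneous ha hy), ← one_smul ℤ (signedCumulant _ _ _),
    ← famSign_snocFamily (q := q) ε hlt, famSign_smul_signedCumulant hπ
    (isFamily_snocFamily ε h0 hlt) (snoc_homogeneous ha hy) hf, famGen_snocFamily, ← hxa,
    biUnion_snocFamily, cumulant_adjoin_single hπ hπ' h0 (disjoint_snoc hlt) hx hx0 hy hf hfe hgi]

end

theorem mul_single_apply {T0 W : Finset (Fin n)} (hd : Disjoint T0 W) (β : SetFun q R) (y : R) :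
    (β * single T0 y : SetFun q R) (T0 ∪ W) = crossSign q W T0 • (β W * y) := by
  rw [mul_apply, Finset.sum_eq_single W, Finset.sum_eq_single T0]
  · rw [if_pos ⟨hd.symm, Finset.union_comm _ _⟩, single_same]
  · intro U _ hU; rw [single_apply, if_neg hU]; simp
  · simp
  · intro T _ hT
    refine Finset.sum_eq_zero fun U _ => ?_
    split_ifs with h
    · rw [single_apply, if_neg]
      · simp
      · rintro rfl
        refine hT ?_
        have h1 := congrArg (fun S => S \ U) h.2
        simp only [Finset.union_sdiff_right, Finset.union_sdiff_left] at h1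
        rwa [Finset.sdiff_eq_self_of_disjoint h.1, Finset.sdiff_eq_self_of_disjoint hd.symm] at h1
    · rfl
  · simp

theorem mul_apply_eq_zero_of_left {T0 : Finset (Fin n)} {β γ : SetFun q R}
    (hβ : ∀ T, ¬ T0 ⊆ T → β T = 0) (T) (hT : ¬ T0 ⊆ T) : (β * γ) T = 0 := by
  rw [mul_apply]
  refine Finset.sum_eq_zero fun U _ => Finset.sum_eq_zero fun V _ => ?_
  split_ifs with h
  · rw [hβ U fun hU => hT (hU.trans (h.2 ▸ Finset.subset_union_left)), zero_mul, smul_zero]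
  · rfl

theorem apply_univ_eq_zero {W : Finset (Fin n)} (hW : W ≠ Finset.univ) {β : SetFun q R}
    (hβ : res K W β = β) : β Finset.univ = 0 := by
  rw [← hβ, res_apply, if_neg]
  rwa [Finset.univ_subset_iff]

theorem res_famGen_of_subset {k : ℕ} {S : Fin k → Finset (Fin n)} {W : Finset (Fin n)}
    (h : ∀ j, S j ⊆ W) (b : Fin k → R) :
    res K W (famGen S b : SetFun q R) = famGen S b := by
  rw [famGen, map_sum]
  exact Finset.sum_congr rfl fun j _ => by rw [res_single, if_pos (h j)]

end Append

/-! ### The product formulas -/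

section Product

variable {n : ℕ} {p : Fin n → ZMod 2} {R : Type*} [Ring R] [Algebra K R]
variable {R' : Type*} [Ring R'] [Algebra K R']
variable {π : ZMod 2 → R →ₗ[K] R} {π' : ZMod 2 → R' →ₗ[K] R'}

/-- The parities of a tuple followed by two more arguments. -/
def appendParity (p : Fin n → ZMod 2) (i j : ZMod 2) : Fin (n + 2) → ZMod 2 :=
  Fin.snoc (Fin.snoc p i : Fin (n + 1) → ZMod 2) j

/-- The inclusion of the indices below `n` in those below `n + 2`. -/
def castEmb (n : ℕ) : Fin n ↪o Fin (n + 2) := Fin.castSuccOrderEmb.trans Fin.castSuccOrderEmb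

/-- The index `n`. -/
def penult (n : ℕ) : Fin (n + 2) := (Fin.last n).castSucc

@[simp] theorem appendParity_castEmb (i j : ZMod 2) (l : Fin n) :
    appendParity p i j (castEmb n l) = p l := by
  simp [appendParity, castEmb]

@[simp] theorem appendParity_penult (i j : ZMod 2) : appendParity p i j (penult n) = i := by
  simp [appendParity, penult]

@[simp] theorem appendParity_last (i j : ZMod 2) : appendParity p i j (Fin.last (n + 1)) = j := by
  simp [appendParity]

theorem castEmb_lt_penult (l : Fin n) : castEmb n l < penult n := by
  simp [castEmb, penult, Fin.castSucc_lt_last]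

theorem penult_lt_last : penult n < Fin.last (n + 1) := Fin.castSucc_lt_last _

theorem castEmb_lt_last (l : Fin n) : castEmb n l < Fin.last (n + 1) :=
  (castEmb_lt_penult l).trans penult_lt_last

theorem eq_castEmb_or (x : Fin (n + 2)) :
    (∃ l, x = castEmb n l) ∨ x = penult n ∨ x = Fin.last (n + 1) := by
  refine Fin.lastCases (Or.inr (Or.inr rfl)) (fun x => ?_) x
  refine Fin.lastCases (Or.inr (Or.inl rfl)) (fun x => Or.inl ⟨x, rfl⟩) x

/-- The subset of the first `n` indices. -/
def castSet (I : Finset (Fin n)) : Finset (Fin (n + 2)) := I.map (castEmb n).toEmbedding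

theorem castEmb_mem_castSet {I : Finset (Fin n)} {l : Fin n} : castEmb n l ∈ castSet I ↔ l ∈ I :=
  Finset.mem_map' _

theorem penult_notMem_castSet (I : Finset (Fin n)) : penult n ∉ castSet I := by
  intro h
  obtain ⟨l, -, hl⟩ := Finset.mem_map.mp h
  exact (castEmb_lt_penult l).ne hl

theorem last_notMem_castSet (I : Finset (Fin n)) : Fin.last (n + 1) ∉ castSet I := by
  intro h
  obtain ⟨l, -, hl⟩ := Finset.mem_map.mp h
  exact (castEmb_lt_last l).ne hl

theorem map_orderEmbOfFin_trans_castEmb (I : Finset (Fin n)) :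
    Finset.univ.map ((I.orderEmbOfFin rfl).trans (castEmb n)).toEmbedding = castSet I := by
  rw [castSet]
  conv_rhs => rw [← Finset.map_orderEmbOfFin_univ I rfl, Finset.map_map]
  rfl

theorem compl_insert_penult (I : Finset (Fin n)) :
    ({penult n} ∪ castSet I)ᶜ = {Fin.last (n + 1)} ∪ castSet Iᶜ := by
  ext x
  rw [Finset.mem_compl]
  rcases eq_castEmb_or x with ⟨l, rfl⟩ | rfl | rfl
  · simp [castEmb_mem_castSet, (castEmb_lt_penult l).ne, (castEmb_lt_last l).ne]
  · simp [penult_notMem_castSet, penult_lt_last.ne]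
  · simp [last_notMem_castSet, penult_lt_last.ne']

theorem union_castSet_univ :
    ({penult n} ∪ {Fin.last (n + 1)}) ∪ castSet (Finset.univ : Finset (Fin n)) = Finset.univ := by
  ext x
  rcases eq_castEmb_or x with ⟨l, rfl⟩ | rfl | rfl <;> simp [castEmb_mem_castSet]

theorem crossSign_castSet (i j : ZMod 2) (I J : Finset (Fin n)) :
    crossSign (appendParity p i j) (castSet I) (castSet J) = crossSign p I J := by
  simp [crossSign, castSet, inversionSign]

/-- The labels 0, 1, 2 list I, then the argument b, then the complement of I. The argument c is last
in every arrangement and contributes no sign. -/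
theorem crossSign_insert_penult (i j : ZMod 2) (I : Finset (Fin n)) :
    crossSign (appendParity p i j) ({penult n} ∪ castSet I) ({Fin.last (n + 1)} ∪ castSet Iᶜ) =
      koszulSign (Fin.snoc p i : Fin (n + 1) → ZMod 2)
        (Fin.snoc (fun l => if l ∈ I then 0 else 2) 1 : Fin (n + 1) → Fin 3) := by
  have h1 : ∀ l ∈ castSet Iᶜ, l ∉ ({Fin.last (n + 1)} : Finset _) := fun l hl h => by
    rw [Finset.mem_singleton.mp h] at hl
    exact last_notMem_castSet _ hl
  have h2 : Disjoint ({Fin.last (n + 1)} : Finset (Fin (n + 2))) (castSet Iᶜ) :=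
    Finset.disjoint_right.mpr h1
  have h5 : Disjoint ({penult n} : Finset (Fin (n + 2))) (castSet I) := by
    rw [Finset.disjoint_singleton_left]; exact penult_notMem_castSet I
  rw [crossSign_union_right _ h2, crossSign_eq_one_of_lt, one_mul,
    crossSign_union_left _ h5, crossSign_castSet]
  · rw [koszulSign_eq_prod, Fin.prod_univ_castSucc]
    simp only [Fin.prod_univ_castSucc, Fin.snoc_castSucc, Fin.snoc_last]
    rw [← koszulSign_unshuffle, koszulSign_eq_prod, Finset.prod_mul_distrib, mul_comm, mul_assoc]
    congr 1
    · refine Finset.prod_congr rfl fun l _ => Finset.prod_congr rfl fun l' _ => ?_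
      have h3 : (unshuffle I l < unshuffle I l') ↔
          ((if l ∈ I then 0 else 2 : Fin 3) < if l' ∈ I then 0 else 2) := by
        unfold unshuffle; split_ifs <;> simp
      simp only [h3, inversionSign, Fin.snoc_castSucc, Fin.castSucc_lt_castSucc_iff]
    · rw [Finset.prod_eq_one, one_mul]
      · simp only [crossSign, Finset.prod_singleton, castSet, Finset.prod_map]
        rw [if_neg (lt_irrefl _), mul_one, ← Finset.prod_subset (Finset.subset_univ Iᶜ)]
        · refine Finset.prod_congr rfl fun l hl => ?_
          rw [if_neg (Finset.mem_compl.mp hl), if_pos (by decide)]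
          have h4 : castEmb n l < penult n := castEmb_lt_penult l
          simp [inversionSign, h4, Fin.castSucc_lt_last]
        · intro l _ hl
          rw [if_pos (show l ∈ I by simpa using hl)]
          exact if_neg (by decide)
      · intro l _
        simp [inversionSign, (Fin.castSucc_lt_last l).not_gt]
  · intro x hx y hy
    rw [Finset.mem_singleton.mp hy]
    rcases Finset.mem_union.mp hx with h | h
    · rw [Finset.mem_singleton.mp h]; exact penult_lt_last
    · obtain ⟨l, -, rfl⟩ := Finset.mem_map.mp h
      exact castEmb_lt_last l

section Main

variable [CharZero K] {i j : ZMod 2} {a : Fin n → R} {b c : R}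

/-- The generating element of the first `n` arguments. -/
def genBelow (a : Fin n → R) (i j : ZMod 2) : SetFun (appendParity p i j) R :=
  famGen (fun l => {castEmb n l}) a

theorem genBelow_apply_empty : (genBelow a i j : SetFun (appendParity p i j) R) ∅ = 0 :=
  famGen_apply_empty (fun _ => Finset.singleton_nonempty _) a

omit [CharZero K] in
theorem res_genBelow {W : Finset (Fin (n + 2))} (hW : ∀ l, castEmb n l ∈ W) :
    res K W (genBelow a i j : SetFun (appendParity p i j) R) = genBelow a i j :=
  res_famGen_of_subset (fun l => by simpa using hW l) a

theorem famGen_castSucc :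
    (famGen (fun l => {Fin.castSuccOrderEmb l}) (Fin.snoc a b : Fin (n + 1) → R) :
      SetFun (appendParity p i j) R) = single {penult n} b + genBelow a i j := by
  refine (Fin.sum_univ_castSucc _).trans ((add_comm _ _).trans ?_)
  simp [penult, castEmb, genBelow, famGen]

theorem map_castSuccOrderEmb :
    (Finset.univ : Finset (Fin (n + 1))).map Fin.castSuccOrderEmb.toEmbedding =
      {Fin.last (n + 1)}ᶜ := by
  ext x
  rw [Finset.mem_map, Finset.mem_compl, Finset.mem_singleton]
  refine ⟨?_, fun h => ⟨x.castPred h, Finset.mem_univ _, Fin.castSucc_castPred x h⟩⟩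
  rintro ⟨l, -, rfl⟩
  exact (Fin.castSucc_lt_last l).ne

theorem union_compl_last : {Fin.last (n + 1)} ∪ ({Fin.last (n + 1)} : Finset (Fin (n + 2)))ᶜ =
    Finset.univ := Finset.union_compl _

theorem last_union_castSet :
    {Fin.last (n + 1)} ∪ ({penult n} ∪ castSet (Finset.univ : Finset (Fin n))) = Finset.univ := by
  rw [← Finset.union_assoc, Finset.union_comm {Fin.last (n + 1)}, union_castSet_univ]

theorem penult_union_castSet :
    {penult n} ∪ ({Fin.last (n + 1)} ∪ castSet (Finset.univ : Finset (Fin n))) = Finset.univ := by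
  rw [← Finset.union_assoc, union_castSet_univ]

variable (hπ : IsSuperCommutative π) (ha : ∀ l, π (p l) (a l) = a l) (hb : π i b = b)
  (hc : π j c = c)
include hπ ha

omit [CharZero K] hπ in
theorem isEven_genBelow : IsEven π (genBelow a i j : SetFun (appendParity p i j) R) :=
  isEven_famGen fun l => by simpa using ha l

include hb

theorem koszulBracket_snoc_penult {D : R →ₗ[K] R} (hD : D 1 = 0) :
    koszulBracket π D (n + 1) (Fin.snoc a b) =
      (map (appendParity p i j) D (nilExp K (genBelow a i j) * single {penult n} b) *
          nilExp K (-genBelow a i j) -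
        map (appendParity p i j) D (nilExp K (genBelow a i j)) *
          (nilExp K (-genBelow a i j) * single {penult n} b) : SetFun (appendParity p i j) R)
        ({penult n} ∪ castSet Finset.univ) :=
  koszulBracket_snoc hπ (ε := castEmb n) (Finset.singleton_nonempty _)
    (fun l t ht => by rw [Finset.mem_singleton.mp ht]; exact castEmb_lt_penult l)
    (by simpa using ha) (by simpa using hb) (isEven_genBelow ha) genBelow_apply_empty
    (res_genBelow fun l => Finset.mem_map_of_mem _ (Finset.mem_univ _)) hD

omit hb
include hc

theorem koszulBracket_snoc_last {D : R →ₗ[K] R} (hD : D 1 = 0) :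
    koszulBracket π D (n + 1) (Fin.snoc a c) =
      (map (appendParity p i j) D (nilExp K (genBelow a i j) * single {Fin.last (n + 1)} c) *
          nilExp K (-genBelow a i j) -
        map (appendParity p i j) D (nilExp K (genBelow a i j)) *
          (nilExp K (-genBelow a i j) * single {Fin.last (n + 1)} c) :
            SetFun (appendParity p i j) R)
        ({Fin.last (n + 1)} ∪ castSet Finset.univ) :=
  koszulBracket_snoc hπ (ε := castEmb n) (Finset.singleton_nonempty _)
    (fun l t ht => by rw [Finset.mem_singleton.mp ht]; exact castEmb_lt_last l)
    (by simpa using ha) (by simpa using hc) (isEven_genBelow ha) genBelow_apply_empty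
    (res_genBelow fun l => Finset.mem_map_of_mem _ (Finset.mem_univ _)) hD

include hb

omit [CharZero K] ha in
theorem homogeneous_mul : π (∑ l ∈ {penult n} ∪ {Fin.last (n + 1)}, appendParity p i j l) (b * c) =
    b * c := by
  rw [Finset.sum_union (by simpa using penult_lt_last.ne)]
  simpa using hπ.mul _ _ _ _ hb hc

theorem koszulBracket_snoc_mul' {D : R →ₗ[K] R} (hD : D 1 = 0) :
    koszulBracket π D (n + 1) (Fin.snoc a (b * c)) =
      (map (appendParity p i j) D (nilExp K (genBelow a i j) *
            (single {penult n} b * single {Fin.last (n + 1)} c)) * nilExp K (-genBelow a i j) -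
        map (appendParity p i j) D (nilExp K (genBelow a i j)) *
          (nilExp K (-genBelow a i j) * (single {penult n} b * single {Fin.last (n + 1)} c)) :
            SetFun (appendParity p i j) R) Finset.univ := by
  have hs : (single {penult n} b * single {Fin.last (n + 1)} c : SetFun (appendParity p i j) R) =
      single ({penult n} ∪ {Fin.last (n + 1)}) (b * c) := by
    rw [single_mul_single_of_disjoint (by simpa using penult_lt_last.ne), crossSign_eq_one_of_lt,
      one_smul]
    simpa using penult_lt_last
  rw [hs, ← union_castSet_univ]
  refine koszulBracket_snoc hπ (ε := castEmb n) ⟨penult n, by simp⟩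
    (fun l t ht => ?_) (by simpa using ha) (homogeneous_mul hπ hb hc) (isEven_genBelow ha)
    genBelow_apply_empty
    (res_genBelow fun l => Finset.mem_map_of_mem _ (Finset.mem_univ _)) hD
  rcases Finset.mem_union.mp ht with h | h
  · rw [Finset.mem_singleton.mp h]; exact castEmb_lt_penult l
  · rw [Finset.mem_singleton.mp h]; exact castEmb_lt_last l

omit hc in
theorem nilExp_penult_add :
    nilExp K (single {penult n} b + genBelow a i j : SetFun (appendParity p i j) R) =
        nilExp K (genBelow a i j) * (1 + single {penult n} b) ∧
      nilExp K (-(single {penult n} b + genBelow a i j : SetFun (appendParity p i j) R)) =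
        nilExp K (-genBelow a i j) * (1 - single {penult n} b) := by
  have hB : IsEven π (single {penult n} b : SetFun (appendParity p i j) R) :=
    IsEven.single (by simpa using hb)
  have hBB := single_mul_self (p := appendParity p i j) (Finset.singleton_nonempty (penult n)) b
  have hBn : IsNilpotent (single {penult n} b : SetFun (appendParity p i j) R) :=
    ⟨2, by rw [pow_two, hBB]⟩
  have hn : IsNilpotent (genBelow a i j : SetFun (appendParity p i j) R) :=
    isNilpotent genBelow_apply_empty
  have hcomm := (isEven_genBelow (p := p) (i := i) (j := j) ha).commute hπ hB
  constructor
  · rw [add_comm (single _ _) (genBelow _ _ _), nilExp_add hcomm hn hBn, nilExp_of_mul_self_eq_zero hBB]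
  · rw [neg_add_rev, nilExp_add hcomm.neg_left.neg_right hn.neg hBn.neg,
      nilExp_of_mul_self_eq_zero (x := -single {penult n} b) (by rw [neg_mul_neg, hBB]),
      sub_eq_add_neg]

/-- The Koszul brackets satisfy the Leibniz rule up to the next higher bracket. -/
theorem koszulBracket_mul {D : R →ₗ[K] R} (hD : D 1 = 0) :
    koszulBracket π D (n + 1) (Fin.snoc a (b * c)) =
      koszulBracket π D (n + 2) (Fin.snoc (Fin.snoc a b : Fin (n + 1) → R) c) +
        (koszulBracket π D (n + 1) (Fin.snoc a b) * c +
          swapSign i j • (koszulBracket π D (n + 1) (Fin.snoc a c) * b)) := by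
  have hxe := isEven_genBelow (p := p) (i := i) (j := j) ha
  have hB : IsEven π (single {penult n} b : SetFun (appendParity p i j) R) :=
    IsEven.single (by simpa using hb)
  have hC : IsEven π (single {Fin.last (n + 1)} c : SetFun (appendParity p i j) R) :=
    IsEven.single (by simpa using hc)
  have h2 : koszulBracket π D (n + 2) (Fin.snoc (Fin.snoc a b : Fin (n + 1) → R) c) =
      (map (appendParity p i j) D (nilExp K (single {penult n} b + genBelow a i j) *
            single {Fin.last (n + 1)} c) * nilExp K (-(single {penult n} b + genBelow a i j)) -
        map (appendParity p i j) D (nilExp K (single {penult n} b + genBelow a i j)) *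
          (nilExp K (-(single {penult n} b + genBelow a i j)) * single {Fin.last (n + 1)} c) :
            SetFun (appendParity p i j) R) Finset.univ := by
    have h3 := koszulBracket_snoc hπ (ε := Fin.castSuccOrderEmb)
      (q := appendParity p i j) (T0 := {Fin.last (n + 1)}) (a := (Fin.snoc a b : Fin (n + 1) → R))
      (y := c) (x := single {penult n} b + genBelow a i j) (K := K)
      (Finset.singleton_nonempty _)
      (fun l t ht => by rw [Finset.mem_singleton.mp ht]; exact Fin.castSucc_lt_last l)
      (fun l => by
        refine Fin.lastCases ?_ (fun l => ?_) l
        · simpa [appendParity] using hb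
        · simpa [appendParity] using ha l)
      (by simpa using hc) (hB.add hxe)
      (by rw [add_apply, genBelow_apply_empty, single_apply, if_neg (by simp), zero_add])
      (by rw [← famGen_castSucc]; exact res_famGen_of_subset (fun l => Finset.singleton_subset_iff.mpr
        (Finset.mem_map_of_mem _ (Finset.mem_univ _))) _) hD
    rw [h3, map_castSuccOrderEmb, union_compl_last]
  have hCu := mul_single_apply (R := R) (q := appendParity p i j) (T0 := {Fin.last (n + 1)})
    (W := {penult n} ∪ castSet Finset.univ) (by
      rw [Finset.disjoint_singleton_left, Finset.mem_union, Finset.mem_singleton]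
      exact fun h => h.elim penult_lt_last.ne' (last_notMem_castSet _))
  have hBu := mul_single_apply (R := R) (q := appendParity p i j) (T0 := {penult n})
    (W := {Fin.last (n + 1)} ∪ castSet Finset.univ) (by
      rw [Finset.disjoint_singleton_left, Finset.mem_union, Finset.mem_singleton]
      exact fun h => h.elim penult_lt_last.ne (penult_notMem_castSet _))
  have hs1 : crossSign (appendParity p i j) ({penult n} ∪ castSet Finset.univ)
      {Fin.last (n + 1)} = 1 := by
    refine crossSign_eq_one_of_lt _ fun x hx y hy => ?_
    rw [Finset.mem_singleton.mp hy]
    rcases Finset.mem_union.mp hx with h | h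
    · rw [Finset.mem_singleton.mp h]; exact penult_lt_last
    · obtain ⟨l, -, rfl⟩ := Finset.mem_map.mp h
      exact castEmb_lt_last l
  have hs2 : crossSign (appendParity p i j) ({Fin.last (n + 1)} ∪ castSet Finset.univ)
      {penult n} = swapSign i j := by
    have hd : Disjoint ({Fin.last (n + 1)} : Finset (Fin (n + 2))) (castSet Finset.univ) := by
      rw [Finset.disjoint_singleton_left]; exact last_notMem_castSet _
    rw [crossSign_union_left _ hd, crossSign_eq_one_of_lt (T := castSet Finset.univ), mul_one]
    · simp [crossSign, inversionSign, penult_lt_last, swapSign_comm]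
    · intro x hx y hy
      rw [Finset.mem_singleton.mp hy]
      obtain ⟨l, -, rfl⟩ := Finset.mem_map.mp hx
      exact castEmb_lt_penult l
  rw [hs1, last_union_castSet] at hCu
  rw [hs2, penult_union_castSet] at hBu
  simp only [one_smul] at hCu
  rw [koszulBracket_snoc_mul' hπ ha hb hc hD, h2, (nilExp_penult_add hπ ha hb).1,
    (nilExp_penult_add hπ ha hb).2, koszulBracket_snoc_penult (j := j) hπ ha hb hD,
    koszulBracket_snoc_last (i := i) hπ ha hc hD, ← hCu, ← hBu]
  set e := nilExp K (genBelow a i j : SetFun (appendParity p i j) R) with he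
  set e' := nilExp K (-genBelow a i j : SetFun (appendParity p i j) R) with he'
  have hBC := hB.commute hπ hC
  have he'e : IsEven π e' := hxe.neg.nilExp hπ
  have hBe := hB.commute hπ he'e
  set B := (single {penult n} b : SetFun (appendParity p i j) R) with hBdef
  set C := (single {Fin.last (n + 1)} c : SetFun (appendParity p i j) R) with hCdef
  have hsupp : ∀ (y : SetFun (appendParity p i j) R), ∀ T, ¬ {penult n} ⊆ T → (y * B) T = 0 :=
    fun y T hT => mul_single_apply_eq_zero hT
  have hsuppD : ∀ (y z : SetFun (appendParity p i j) R), ∀ T, ¬ {penult n} ⊆ T →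
      (map (appendParity p i j) D (y * B) * z) T = 0 := fun y z => mul_apply_eq_zero_of_left
    fun T hT => by rw [map_apply, hsupp y T hT, map_zero]
  -- Products of two factors both containing the variable of b vanish; these are the second-order
  -- terms in b.
  have hz1 : map (appendParity p i j) D (e * (B * C)) * (e' * B) = 0 := by
    have := mul_eq_zero_of_support (Finset.singleton_nonempty (penult n)) (hsuppD (e * C) 1)
      (hsupp e')
    rwa [mul_one, mul_assoc, ← hBC.eq] at this
  have hz2 : map (appendParity p i j) D (e * B) * (e' * B * C) = 0 := by
    have := mul_eq_zero_of_support (Finset.singleton_nonempty (penult n)) (hsuppD e 1)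
      (hsupp e')
    rw [mul_one] at this
    rw [← mul_assoc, this, zero_mul]
  have hne : ({penult n} : Finset (Fin (n + 2)))ᶜ ≠ Finset.univ := fun h => by
    have := Finset.mem_univ (penult n)
    rw [← h] at this
    simp at this
  have hres : res K {penult n}ᶜ (genBelow a i j : SetFun (appendParity p i j) R) =
      genBelow a i j := res_genBelow fun l => by simpa using (castEmb_lt_penult l).ne
  have hn : IsNilpotent (genBelow a i j : SetFun (appendParity p i j) R) :=
    isNilpotent genBelow_apply_empty
  have hre : res K {penult n}ᶜ e = e := by rw [he, map_nilExp _ hn, hres]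
  have hre' : res K {penult n}ᶜ e' = e' := by rw [he', map_nilExp _ hn.neg, map_neg, hres]
  have hrC : res K {penult n}ᶜ C = C := by
    rw [hCdef, res_single, if_pos]
    simpa using penult_lt_last.ne
  have hu1 : (map (appendParity p i j) D (e * C) * e' : SetFun (appendParity p i j) R)
      Finset.univ = 0 :=
    apply_univ_eq_zero (K := K) hne (by rw [_root_.map_mul, ← map_res, _root_.map_mul, hre, hrC, hre'])
  have hu2 : (map (appendParity p i j) D e * (e' * C) : SetFun (appendParity p i j) R)
      Finset.univ = 0 :=
    apply_univ_eq_zero (K := K) hne (by rw [_root_.map_mul, ← map_res, _root_.map_mul, hre, hrC, hre'])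
  rw [← sub_eq_zero, ← neg_eq_zero]
  rw [← add_apply, ← add_apply, ← sub_apply, ← neg_apply]
  -- After the cancellations the defect of the identity is the first-order term in C alone. It does
  -- not involve the variable of b, so its top coefficient is zero.
  have key : -(map (appendParity p i j) D (e * (B * C)) * e' -
        map (appendParity p i j) D e * (e' * (B * C)) -
      (map (appendParity p i j) D (e * (1 + B) * C) * (e' * (1 - B)) -
        map (appendParity p i j) D (e * (1 + B)) * (e' * (1 - B) * C) +
      ((map (appendParity p i j) D (e * B) * e' - map (appendParity p i j) D e * (e' * B)) * C +
        (map (appendParity p i j) D (e * C) * e' -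
          map (appendParity p i j) D e * (e' * C)) * B))) =
      map (appendParity p i j) D (e * C) * e' - map (appendParity p i j) D e * (e' * C) := by
    have h5 : C * B = B * C := hBC.eq.symm
    simp only [mul_add, add_mul, mul_sub, sub_mul, mul_one, map_add, mul_assoc, h5] at hz1 hz2 ⊢
    rw [hz1, hz2]
    abel
  rw [key, sub_apply, hu1, hu2, sub_zero]

variable (hπ' : IsSuperCommutative π') {f : R →ₗ[K] R'} (hf : f 1 = 1)
  (hfe : ∀ e r, π e r = r → π' e (f r) = f r) {gi : SetFun (appendParity p i j) R'}
  (hgi : map (appendParity p i j) f (nilExp K (genBelow a i j)) * gi = 1)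
include hπ' hf hfe hgi

omit hc in
theorem cumulant_snoc_penult (I : Finset (Fin n)) :
    cumulant π f (I.card + 1) (Fin.snoc (restrict I a) b) =
      (map (appendParity p i j) f (nilExp K (genBelow a i j) * single {penult n} b) * gi :
        SetFun (appendParity p i j) R') ({penult n} ∪ castSet I) := by
  rw [← map_orderEmbOfFin_trans_castEmb]
  refine cumulant_snoc hπ (Finset.singleton_nonempty _)
    (fun l t ht => by rw [Finset.mem_singleton.mp ht]; exact castEmb_lt_penult _)
    (fun l => ?_) (by simpa using hb) (isEven_genBelow ha) genBelow_apply_empty ?_ hπ' hf hfe hgi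
  · change π (appendParity p i j (castEmb n _)) _ = _
    rw [appendParity_castEmb]
    exact ha _
  · rw [map_orderEmbOfFin_trans_castEmb]
    exact res_famGen_singleton (castEmb n).toEmbedding I (fun l => castEmb_mem_castSet) a

omit hb in
theorem cumulant_snoc_last (I : Finset (Fin n)) :
    cumulant π f (I.card + 1) (Fin.snoc (restrict I a) c) =
      (map (appendParity p i j) f (nilExp K (genBelow a i j) * single {Fin.last (n + 1)} c) * gi :
        SetFun (appendParity p i j) R') ({Fin.last (n + 1)} ∪ castSet I) := by
  rw [← map_orderEmbOfFin_trans_castEmb]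
  refine cumulant_snoc hπ (Finset.singleton_nonempty _)
    (fun l t ht => by rw [Finset.mem_singleton.mp ht]; exact castEmb_lt_last _)
    (fun l => ?_) (by simpa using hc) (isEven_genBelow ha) genBelow_apply_empty ?_ hπ' hf hfe hgi
  · change π (appendParity p i j (castEmb n _)) _ = _
    rw [appendParity_castEmb]
    exact ha _
  · rw [map_orderEmbOfFin_trans_castEmb]
    exact res_famGen_singleton (castEmb n).toEmbedding I (fun l => castEmb_mem_castSet) a

theorem cumulant_snoc_mul' :
    cumulant π f (n + 1) (Fin.snoc a (b * c)) =
      (map (appendParity p i j) f (nilExp K (genBelow a i j) *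
        (single {penult n} b * single {Fin.last (n + 1)} c)) * gi :
          SetFun (appendParity p i j) R') Finset.univ := by
  have hs : (single {penult n} b * single {Fin.last (n + 1)} c : SetFun (appendParity p i j) R) =
      single ({penult n} ∪ {Fin.last (n + 1)}) (b * c) := by
    rw [single_mul_single_of_disjoint (by simpa using penult_lt_last.ne), crossSign_eq_one_of_lt,
      one_smul]
    simpa using penult_lt_last
  rw [hs, ← union_castSet_univ]
  refine cumulant_snoc hπ (ε := castEmb n) ⟨penult n, by simp⟩
    (fun l t ht => ?_) (by simpa using ha) (homogeneous_mul hπ hb hc) (isEven_genBelow ha)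
    genBelow_apply_empty
    (res_genBelow fun l => Finset.mem_map_of_mem _ (Finset.mem_univ _)) hπ' hf hfe hgi
  rcases Finset.mem_union.mp ht with h | h
  · rw [Finset.mem_singleton.mp h]; exact castEmb_lt_penult l
  · rw [Finset.mem_singleton.mp h]; exact castEmb_lt_last l

omit hgi in
/-- The product formula for cumulants. -/
theorem cumulant_mul :
    cumulant π f (n + 1) (Fin.snoc a (b * c)) =
      cumulant π f (n + 2) (Fin.snoc (Fin.snoc a b : Fin (n + 1) → R) c) +
        ∑ I : Finset (Fin n), koszulSign (Fin.snoc p i : Fin (n + 1) → ZMod 2)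
          (Fin.snoc (fun l => if l ∈ I then 0 else 2) 1 : Fin (n + 1) → Fin 3) •
          (cumulant π f (I.card + 1) (Fin.snoc (restrict I a) b) *
            cumulant π f (Iᶜ.card + 1) (Fin.snoc (restrict Iᶜ a) c)) := by
  have hxe := isEven_genBelow (p := p) (i := i) (j := j) ha
  have hB : IsEven π (single {penult n} b : SetFun (appendParity p i j) R) :=
    IsEven.single (by simpa using hb)
  have hC : IsEven π (single {Fin.last (n + 1)} c : SetFun (appendParity p i j) R) :=
    IsEven.single (by simpa using hc)
  have hn : IsNilpotent (genBelow a i j : SetFun (appendParity p i j) R) :=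
    isNilpotent genBelow_apply_empty
  set e := nilExp K (genBelow a i j : SetFun (appendParity p i j) R) with he
  set g := map (appendParity p i j) f e with hg
  have hee : IsEven π e := hxe.nilExp hπ
  have hge : IsEven π' g := hee.map hfe
  have hgn : IsNilpotent (g - 1) :=
    isNilpotent (map_apply_empty_eq_one hf (nilExp_apply_empty genBelow_apply_empty))
  have hLn := isNilpotent_nilLog (K := K) hgn
  set gi := nilExp K (-nilLog K g) with hgidef
  have hgie : IsEven π' gi := (hge.nilLog hπ').neg.nilExp hπ'
  have hgi : g * gi = 1 := by
    have := nilExp_mul_nilExp_neg (K := K) hLn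
    rwa [nilExp_nilLog hgn] at this
  have hgi' : gi * g = 1 := by
    have := nilExp_neg_mul_nilExp (K := K) hLn
    rwa [nilExp_nilLog hgn] at this
  have hBC := hB.commute hπ hC
  set B := (single {penult n} b : SetFun (appendParity p i j) R) with hBdef
  set C := (single {Fin.last (n + 1)} c : SetFun (appendParity p i j) R) with hCdef
  set β := map (appendParity p i j) f (e * B) * gi with hβ
  set γ := map (appendParity p i j) f (e * C) * gi with hγ
  set δ := map (appendParity p i j) f (e * (B * C)) * gi with hδ
  have hβe : IsEven π' β := ((hee.mul hπ hB).map hfe).mul hπ' hgie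
  have hγe : IsEven π' γ := ((hee.mul hπ hC).map hfe).mul hπ' hgie
  have hsupp : ∀ (k : Fin (n + 2)) (y : R) (z : SetFun (appendParity p i j) R)
      (w : SetFun (appendParity p i j) R'), ∀ T, ¬ {k} ⊆ T →
      (map (appendParity p i j) f (z * single {k} y) * w) T = 0 := fun k y z w =>
    mul_apply_eq_zero_of_left
      fun T hT => by rw [map_apply, mul_single_apply_eq_zero hT, map_zero]
  have hββ : β * β = 0 := mul_eq_zero_of_support (Finset.singleton_nonempty (penult n))
    (hsupp _ b e gi) (hsupp _ b e gi)
  have hδβ : δ * β = 0 := by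
    have := mul_eq_zero_of_support (Finset.singleton_nonempty (penult n))
      (hsupp _ b (e * C) gi) (hsupp _ b e gi)
    rwa [mul_assoc e, ← hBdef, ← hBC.eq] at this
  have hne : ({penult n} : Finset (Fin (n + 2)))ᶜ ≠ Finset.univ := fun h => by
    have := Finset.mem_univ (penult n)
    rw [← h] at this
    simp at this
  have hres : res K {penult n}ᶜ (genBelow a i j : SetFun (appendParity p i j) R) =
      genBelow a i j := res_genBelow fun l => by simpa using (castEmb_lt_penult l).ne
  have hre : res K {penult n}ᶜ e = e := by rw [he, map_nilExp _ hn, hres]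
  have hrgi : res K {penult n}ᶜ gi = gi := by
    rw [hgidef, map_nilExp _ hLn.neg, map_neg, map_nilLog _ hgn, hg, ← map_res, hre]
  have hrC : res K {penult n}ᶜ C = C := by
    rw [hCdef, res_single, if_pos]
    simpa using penult_lt_last.ne
  have hγ0 : γ Finset.univ = 0 :=
    apply_univ_eq_zero (K := K) hne (by
      rw [hγ, _root_.map_mul, ← map_res, _root_.map_mul, hre, hrC, hrgi])
  have hexp := (nilExp_penult_add (p := p) (j := j) hπ ha hb).1
  -- Adjoining b multiplies g = f(e^x) by 1 + β with β² = 0, so the inverse acquires the factor 1 −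
  -- β.
  have hg2 : map (appendParity p i j) f (nilExp K (B + genBelow a i j)) * (gi * (1 - β)) = 1 := by
    have h1 : map (appendParity p i j) f (nilExp K (B + genBelow a i j)) = (1 + β) * g := by
      rw [hexp, mul_add, mul_one, map_add, add_mul, one_mul, hβ, mul_assoc _ gi g, hgi', mul_one]
    rw [h1, mul_assoc, ← mul_assoc g, hgi, one_mul, mul_sub, mul_one, add_mul, one_mul, hββ,
      add_zero, add_sub_cancel_right]
  have h2 : cumulant π f (n + 2) (Fin.snoc (Fin.snoc a b : Fin (n + 1) → R) c) =
      (δ - β * γ) Finset.univ := by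
    have h3 := cumulant_snoc hπ (ε := Fin.castSuccOrderEmb)
      (q := appendParity p i j) (T0 := {Fin.last (n + 1)}) (a := (Fin.snoc a b : Fin (n + 1) → R))
      (y := c) (x := single {penult n} b + genBelow a i j) (K := K)
      (Finset.singleton_nonempty _)
      (fun l t ht => by rw [Finset.mem_singleton.mp ht]; exact Fin.castSucc_lt_last l)
      (fun l => by
        refine Fin.lastCases ?_ (fun l => ?_) l
        · simpa [appendParity] using hb
        · simpa [appendParity] using ha l)
      (by simpa using hc) (hB.add hxe)
      (by rw [add_apply, genBelow_apply_empty, single_apply, if_neg (by simp), zero_add])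
      (by rw [← famGen_castSucc]; exact res_famGen_of_subset (fun l => Finset.singleton_subset_iff.mpr
        (Finset.mem_map_of_mem _ (Finset.mem_univ _))) _) hπ' hf hfe hg2
    rw [h3, map_castSuccOrderEmb, union_compl_last, ← hBdef, ← hCdef, hexp]
    -- The product δβ vanishes because both factors contain the variable of b. The isolated γ lacks
    -- that variable and has no top coefficient, leaving δ − βγ.
    have h4 : map (appendParity p i j) f (e * (1 + B) * C) * (gi * (1 - β)) =
        γ + (δ - β * γ) := by
      rw [mul_add, mul_one, add_mul, map_add, mul_assoc e B C, ← mul_assoc, add_mul, ← hγ, ← hδ,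
        mul_sub, mul_one, add_mul, hδβ, add_zero, (hγe.commute hπ' hβe).eq]
      abel
    rw [h4, add_apply, hγ0, zero_add]
  rw [h2, cumulant_snoc_mul' hπ ha hb hc hπ' hf hfe hgi, ← hBdef, ← hCdef, ← he, ← hδ, sub_apply,
    sub_add]
  symm
  rw [sub_eq_self, sub_eq_zero, mul_apply_univ]
  symm
  -- A decomposition contributes to βγ only if the first part contains the index of b and the second
  -- that of c; it is then determined by a subset I of the first n indices.
  refine Finset.sum_of_injOn (fun I => {penult n} ∪ castSet I) ?_ ?_ ?_ ?_
  · intro I _ J _ h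
    ext l
    have := congrArg (castEmb n l ∈ ·) h
    simpa [castEmb_mem_castSet, (castEmb_lt_penult l).ne] using this
  · intro I _; exact Finset.mem_coe.mpr (Finset.mem_univ _)
  · intro T _ hT
    by_cases hu : penult n ∈ T
    · by_cases hl : Fin.last (n + 1) ∈ T
      · rw [hsupp _ c e gi Tᶜ (by simpa using hl), mul_zero, smul_zero]
      · refine absurd ?_ hT
        refine ⟨Finset.univ.filter (fun l => castEmb n l ∈ T), by simp, ?_⟩
        ext x
        rcases eq_castEmb_or x with ⟨l, rfl⟩ | rfl | rfl
        · simp [castEmb_mem_castSet, (castEmb_lt_penult l).ne]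
        · simp [hu]
        · simp [hl, penult_lt_last.ne', last_notMem_castSet]
    · rw [hsupp _ b e gi T (by simpa using hu), zero_mul, smul_zero]
  · intro I _
    rw [compl_insert_penult, crossSign_insert_penult,
      cumulant_snoc_penult (j := j) hπ ha hb hπ' hf hfe hgi,
      cumulant_snoc_last (i := i) hπ ha hc hπ' hf hfe hgi]

end Main

end Product

end SetFun

end

end DerivedBV

/-! ### Formal maps and the homological perturbation lemma. -/

namespace DerivedBV

noncomputable section

variable {K : Type*} [Field K]

/-! ### The algebra of formal maps -/

namespace FormalMap

section Algebra

variable {A B C E : Type*} [Ring A] [Algebra K A] [Ring B] [Algebra K B] [Ring C] [Algebra K C]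
  [Ring E] [Algebra K E]

theorem coeff_toPowerSeries (F : FormalMap K A B) (x : A⟦X⟧) (n : ℕ) :
    PowerSeries.coeff n (toPowerSeries F x) =
      ∑ ij ∈ Finset.HasAntidiagonal.antidiagonal n, F ij.1 (PowerSeries.coeff ij.2 x) := by
  simp [toPowerSeries]

theorem coeff_toPowerSeries_C (F : FormalMap K A B) (a : A) (n : ℕ) :
    PowerSeries.coeff n (toPowerSeries F (PowerSeries.C a)) = F n a := by
  rw [coeff_toPowerSeries, Finset.sum_eq_single (n, 0)]
  · simp
  · rintro ⟨i, j⟩ hij hne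
    rw [Finset.HasAntidiagonal.mem_antidiagonal] at hij
    have : j ≠ 0 := by rintro rfl; exact hne (by simpa using hij)
    simp [PowerSeries.coeff_C, this]
  · simp

/-- A formal map is recovered from its values on constant series, so identities between formal maps
can be checked on power series, where composition is composition of functions. -/
theorem toPowerSeries_injective :
    Function.Injective (toPowerSeries : FormalMap K A B → A⟦X⟧ →ₗ[K] B⟦X⟧) := by
  intro F G h
  funext n
  ext a
  rw [← coeff_toPowerSeries_C, h, coeff_toPowerSeries_C]

theorem toPowerSeries_comp (G : FormalMap K B C) (F : FormalMap K A B) (x : A⟦X⟧) :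
    toPowerSeries (comp G F) x = toPowerSeries G (toPowerSeries F x) := by
  ext n
  simp only [coeff_toPowerSeries, comp, LinearMap.sum_apply, LinearMap.comp_apply, map_sum]
  rw [Finset.sum_sigma', Finset.sum_sigma']
  exact Finset.sum_nbij' (fun x => ⟨(x.2.1, x.2.2 + x.1.2), (x.2.2, x.1.2)⟩)
    (fun x => ⟨(x.1.1 + x.2.1, x.2.2), (x.1.1, x.2.1)⟩)
    (by rintro ⟨⟨a, b⟩, c, d⟩; simp; omega) (by rintro ⟨⟨a, b⟩, c, d⟩; simp; omega)
    (by rintro ⟨⟨a, b⟩, c, d⟩; simp)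
    (by rintro ⟨⟨a, b⟩, c, d⟩; simp) (by rintro ⟨⟨a, b⟩, c, d⟩; simp)

theorem toPowerSeries_add (F G : FormalMap K A B) (x : A⟦X⟧) :
    toPowerSeries (F + G) x = toPowerSeries F x + toPowerSeries G x := by
  ext n; simp [coeff_toPowerSeries, Finset.sum_add_distrib]

theorem toPowerSeries_sub (F G : FormalMap K A B) (x : A⟦X⟧) :
    toPowerSeries (F - G) x = toPowerSeries F x - toPowerSeries G x := by
  ext n; simp [coeff_toPowerSeries, Finset.sum_sub_distrib]

theorem toPowerSeries_zero (x : A⟦X⟧) : toPowerSeries (0 : FormalMap K A B) x = 0 := by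
  ext n; simp [coeff_toPowerSeries]

theorem coeff_toPowerSeries_const (f : A →ₗ[K] B) (x : A⟦X⟧) (n : ℕ) :
    PowerSeries.coeff n (toPowerSeries (const f) x) = f (PowerSeries.coeff n x) := by
  rw [coeff_toPowerSeries, Finset.sum_eq_single (0, n)]
  · simp [const]
  · rintro ⟨i, j⟩ hij hne
    rw [Finset.HasAntidiagonal.mem_antidiagonal] at hij
    have : i ≠ 0 := by rintro rfl; exact hne (by simpa using hij)
    simp [const, this]
  · simp

theorem toPowerSeries_const_id (x : A⟦X⟧) :
    toPowerSeries (const (LinearMap.id : A →ₗ[K] A)) x = x := by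
  ext n; rw [coeff_toPowerSeries_const]; rfl

theorem toPowerSeries_const_C (f : A →ₗ[K] B) (a : A) :
    toPowerSeries (const f) (PowerSeries.C a) = PowerSeries.C (f a) := by
  ext n
  rw [coeff_toPowerSeries_const, PowerSeries.coeff_C, PowerSeries.coeff_C]
  split_ifs <;> simp

theorem toPowerSeries_X_mul (F : FormalMap K A B) (x : A⟦X⟧) :
    toPowerSeries F (PowerSeries.X * x) = PowerSeries.X * toPowerSeries F x := by
  ext n
  cases n with
  | zero => simp [coeff_toPowerSeries]
  | succ n =>
    rw [PowerSeries.coeff_succ_X_mul, coeff_toPowerSeries, coeff_toPowerSeries,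
      Finset.Nat.sum_antidiagonal_succ']
    simp [PowerSeries.coeff_succ_X_mul]

theorem comp_assoc (H : FormalMap K C E) (G : FormalMap K B C) (F : FormalMap K A B) :
    comp (comp H G) F = comp H (comp G F) :=
  toPowerSeries_injective (LinearMap.ext fun x => by simp only [toPowerSeries_comp])

theorem comp_id (F : FormalMap K A B) : comp F (const LinearMap.id) = F :=
  toPowerSeries_injective (LinearMap.ext fun x => by
    rw [toPowerSeries_comp, toPowerSeries_const_id])

theorem id_comp (F : FormalMap K A B) : comp (const LinearMap.id) F = F :=
  toPowerSeries_injective (LinearMap.ext fun x => by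
    rw [toPowerSeries_comp, toPowerSeries_const_id])

theorem toPowerSeries_plus (F : FormalMap K A B) (x : A⟦X⟧) :
    toPowerSeries F x = toPowerSeries (const (F 0)) x + toPowerSeries (plus F) x := by
  rw [← toPowerSeries_add]
  congr 2
  funext n
  by_cases h : n = 0 <;> simp [const, plus, h]

/-- Divisibility of the m-th summand by t^m is needed because the truncation of `series` depends on
the coefficient considered; the terms by which the two truncations differ are zero. -/
theorem comp_series (H : FormalMap K B C) {G : ℕ → FormalMap K A B}
    (hG : ∀ m n, n < m → G m n = 0) : comp H (series G) = series fun m => comp H (G m) := by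
  funext n
  simp only [comp, series]
  rw [Finset.sum_comm]
  refine Finset.sum_congr rfl fun ij hij => ?_
  rw [Finset.HasAntidiagonal.mem_antidiagonal] at hij
  have hs : H ij.1 ∘ₗ ∑ m ∈ Finset.range (ij.2 + 1), G m ij.2 =
      ∑ m ∈ Finset.range (ij.2 + 1), H ij.1 ∘ₗ G m ij.2 := by ext; simp
  rw [hs]
  refine Finset.sum_subset (Finset.range_subset_range.mpr (by omega)) fun m _ hm => ?_
  rw [hG m ij.2 (by simpa using hm), LinearMap.comp_zero]

theorem series_comp (H : FormalMap K A B) {G : ℕ → FormalMap K B C}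
    (hG : ∀ m n, n < m → G m n = 0) : comp (series G) H = series fun m => comp (G m) H := by
  funext n
  simp only [comp, series]
  rw [Finset.sum_comm]
  refine Finset.sum_congr rfl fun ij hij => ?_
  rw [Finset.HasAntidiagonal.mem_antidiagonal] at hij
  have hs : (∑ m ∈ Finset.range (ij.1 + 1), G m ij.1) ∘ₗ H ij.2 =
      ∑ m ∈ Finset.range (ij.1 + 1), G m ij.1 ∘ₗ H ij.2 := by ext; simp
  rw [hs]
  refine Finset.sum_subset (Finset.range_subset_range.mpr (by omega)) fun m _ hm => ?_
  rw [hG m ij.1 (by simpa using hm), LinearMap.zero_comp]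

theorem pow_succ_comp (F : FormalMap K A A) (m : ℕ) : pow F (m + 1) = comp (pow F m) F := by
  induction m with
  | zero => change comp F (const LinearMap.id) = comp (const LinearMap.id) F; rw [comp_id, id_comp]
  | succ m ih =>
    change comp F (pow F (m + 1)) = comp (comp F (pow F m)) F
    rw [ih, ← comp_assoc]

/-- The n-th coefficient of F^(n+1) vanishes, so shifting the index of the geometric series costs no
boundary term. -/
theorem series_pow_eq {F : FormalMap K A A} (hF : F 0 = 0) :
    series (pow F) = const LinearMap.id + series fun m => pow F (m + 1) := by
  funext n
  have h : pow F (n + 1) n = 0 := pow_apply_eq_zero hF _ _ (Nat.lt_succ_self n)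
  change ∑ m ∈ Finset.range (n + 1), pow F m n = pow F 0 n + ∑ m ∈ Finset.range (n + 1), pow F (m + 1) n
  rw [Finset.sum_range_succ', Finset.sum_range_succ _ n, h, add_zero, add_comm]

theorem series_pow_eq_comp {F : FormalMap K A A} (hF : F 0 = 0) :
    series (pow F) = const LinearMap.id + comp F (series (pow F)) := by
  rw [comp_series F (pow_apply_eq_zero hF)]
  exact series_pow_eq hF

theorem series_pow_eq_comp' {F : FormalMap K A A} (hF : F 0 = 0) :
    series (pow F) = const LinearMap.id + comp (series (pow F)) F := by
  rw [series_comp F (pow_apply_eq_zero hF), series_pow_eq hF]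
  simp only [pow_succ_comp]

end Algebra

/-! ### Degrees -/

section Degree

variable {A B C : Type*} [Ring A] [Algebra K A] [Ring B] [Algebra K B] [Ring C] [Algebra K C]
  {𝒜 : ℤ → Submodule K A} {ℬ : ℤ → Submodule K B} {𝒞 : ℤ → Submodule K C} {k : ℤ}

/-- A formal map of degree `e`, where `t` has degree `1 - k`. -/
def HasFormalDegree (𝒜 : ℤ → Submodule K A) (ℬ : ℤ → Submodule K B) (k e : ℤ)
    (F : FormalMap K A B) : Prop :=
  ∀ n : ℕ, HasDegree 𝒜 ℬ (e + n * (k - 1)) (F n)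

theorem HasFormalDegree.add {e : ℤ} {F G : FormalMap K A B} (hF : HasFormalDegree 𝒜 ℬ k e F)
    (hG : HasFormalDegree 𝒜 ℬ k e G) : HasFormalDegree 𝒜 ℬ k e (F + G) :=
  fun n i a ha => Submodule.add_mem _ (hF n i a ha) (hG n i a ha)

theorem HasFormalDegree.comp {e e' : ℤ} {G : FormalMap K B C} {F : FormalMap K A B}
    (hG : HasFormalDegree ℬ 𝒞 k e G) (hF : HasFormalDegree 𝒜 ℬ k e' F) :
    HasFormalDegree 𝒜 𝒞 k (e + e') (comp G F) := by
  intro n i a ha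
  rw [FormalMap.comp, LinearMap.sum_apply]
  refine Submodule.sum_mem _ fun ij hij => ?_
  rw [Finset.HasAntidiagonal.mem_antidiagonal] at hij
  have := hG ij.1 _ _ (hF ij.2 i a ha)
  have h : i + (e' + ij.2 * (k - 1)) + (e + ij.1 * (k - 1)) = i + (e + e' + n * (k - 1)) := by
    rw [← hij]; push_cast; ring
  rwa [h] at this

theorem HasFormalDegree.const {e : ℤ} {f : A →ₗ[K] B} (hf : HasDegree 𝒜 ℬ e f) :
    HasFormalDegree 𝒜 ℬ k e (const f) := by
  intro n i a ha
  by_cases h : n = 0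
  · simpa [FormalMap.const, h] using hf i a ha
  · simp [FormalMap.const, h]

theorem HasFormalDegree.plus {e : ℤ} {F : FormalMap K A B} (hF : HasFormalDegree 𝒜 ℬ k e F) :
    HasFormalDegree 𝒜 ℬ k e (plus F) := by
  intro n i a ha
  by_cases h : n = 0
  · simp [FormalMap.plus, h]
  · simpa [FormalMap.plus, h] using hF n i a ha

theorem HasFormalDegree.pow {F : FormalMap K A A} (hF : HasFormalDegree 𝒜 𝒜 k 0 F) (m : ℕ) :
    HasFormalDegree 𝒜 𝒜 k 0 (pow F m) := by
  induction m with
  | zero => exact HasFormalDegree.const fun i a ha => by simpa using ha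
  | succ m ih => exact hF.comp ih

theorem HasFormalDegree.series {e : ℤ} {F : ℕ → FormalMap K A B}
    (hF : ∀ m, HasFormalDegree 𝒜 ℬ k e (F m)) : HasFormalDegree 𝒜 ℬ k e (series F) :=
  fun n i a ha => by
    rw [FormalMap.series, LinearMap.sum_apply]
    exact Submodule.sum_mem _ fun m _ => hF m n i a ha

theorem hasFormalDegree_zero {F : FormalMap K A B} :
    HasFormalDegree 𝒜 ℬ k 0 F ↔ ∀ n : ℕ, HasDegree 𝒜 ℬ (n * (k - 1)) (F n) := by
  simp [HasFormalDegree]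

end Degree

end FormalMap

/-! ### The perturbation lemma -/

section Perturbation

open FormalMap

/-- The homological perturbation lemma for a perturbation `δ` of `d` such that `1 - h δ` has
inverse `P`. -/
theorem perturbation_lemma {M N : Type*} [AddCommGroup M] [Module K M] [AddCommGroup N] [Module K N]
    {d δ h P Q : M →ₗ[K] M} {dB : N →ₗ[K] N} {σ : M →ₗ[K] N} {τ : N →ₗ[K] M}
    (hdd : ∀ x, d (d x) = 0) (hDD : ∀ x, d (δ x) + δ (d x) + δ (δ x) = 0)
    (hσd : ∀ x, σ (d x) = dB (σ x)) (hdτ : ∀ x, d (τ x) = τ (dB x)) (hστ : ∀ x, σ (τ x) = x)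
    (hht : ∀ x, h (d x) + d (h x) = τ (σ x) - x) (hσh : ∀ x, σ (h x) = 0) (hhτ : ∀ x, h (τ x) = 0)
    (hhh : ∀ x, h (h x) = 0) (hP : ∀ x, P x = x + h (δ (P x))) (hP' : ∀ x, P x = x + P (h (δ x)))
    (hQ : ∀ x, Q x = x + δ (h (Q x))) (hQ' : ∀ x, Q x = x + Q (δ (h x))) :
    let D' : N → N := fun y => dB y + σ (δ (P (τ y)))
    (∀ x, σ (Q (d x + δ x)) = D' (σ (Q x))) ∧
    (∀ y, d (P (τ y)) + δ (P (τ y)) = P (τ (D' y))) ∧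
    (∀ y, σ (Q (P (τ y))) = y) ∧
    (∀ x, P (h (d x + δ x)) + (d (P (h x)) + δ (P (h x))) = P (τ (σ (Q x))) - x) ∧
    (∀ x, σ (Q (P (h x))) = 0) ∧ (∀ y, P (h (P (τ y))) = 0) ∧ (∀ x, P (h (P (h x))) = 0) ∧
    (∀ y, D' (D' y) = 0) := by
  -- The push-through identities h(1 − δh)^(-1) = (1 − hδ)^(-1) h and δ(1 − hδ)^(-1) = (1 − δh)^(-1)
  -- δ, obtained by comparing two expansions of the same element.
  have hhQ : ∀ x, h (Q x) = P (h x) := fun x => by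
    have h1 := hP' (h (Q x))
    have h2 := congrArg h (hQ x)
    rw [map_add] at h2
    rw [h2, map_add, ← h2] at h1
    exact (add_right_cancel h1).symm
  have hδP : ∀ x, δ (P x) = Q (δ x) := fun x => by
    have h1 := hQ' (δ (P x))
    have h2 := congrArg δ (hP x)
    rw [map_add] at h2
    rw [h2, map_add, ← h2] at h1
    exact (add_right_cancel h1).symm
  have hhP : ∀ x, h (P x) = h x := fun x => by rw [hP, map_add, hhh, add_zero]
  have hPh : ∀ x, P (h x) = h x + h (δ (P (h x))) := fun x => hP _
  have hσP : ∀ x, σ (P x) = σ x := fun x => by rw [hP, map_add, hσh, add_zero]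
  have hQPh : ∀ x, σ (Q (h x)) = 0 := fun x => by
    rw [hQ', hhh, map_zero, map_zero, add_zero, hσh]
  have hQP : ∀ y, σ (Q (P (τ y))) = y := fun y => by
    rw [hP, map_add, map_add, hQPh, add_zero, hQ', hhτ, map_zero, map_zero, add_zero, hστ]
  have hdδ : ∀ x, d (δ x) = -(δ (d x)) - δ (δ x) := fun x => by
    rw [← sub_eq_zero, ← hDD x]; abel
  have hhd : ∀ x, h (d x) = τ (σ x) - x - d (h x) := fun x => by
    rw [← hht]; abel
  have hDP : ∀ y, d (P (τ y)) + δ (P (τ y)) = P (τ (dB y + σ (δ (P (τ y))))) := fun y => by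
    have h2 := hP (τ y)
    set z := P (τ y) with hz
    have h3 := hhd (δ z)
    -- With z = Pτy this says τD'y = (1 − hδ)(d + δ)z; applying P, the inverse of 1 − hδ, gives the
    -- claim.
    have h1 : τ (dB y + σ (δ z)) = (d z + δ z) - h (δ (d z + δ z)) := by
      rw [map_add, ← hdτ, map_add]
      have h5 : h (δ (d z)) + h (δ (δ z)) = -h (d (δ z)) := by
        rw [hdδ, map_sub, map_neg]; abel
      rw [map_add h, h5, h3]
      have h6 : d (τ y) = d z - d (h (δ z)) := by
        rw [eq_sub_iff_add_eq, ← map_add, ← h2]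
      rw [h6]; abel
    rw [h1, map_sub]
    conv_rhs => rw [hP' (d z + δ z)]
    abel
  have hSD : ∀ x, σ (Q (d x + δ x)) = dB (σ (Q x)) + σ (δ (P (τ (σ (Q x))))) := fun x => by
    -- both sides agree on `x - δ (h x)`, hence on all elements
    have key : ∀ x, σ (Q (d (x - δ (h x)) + δ (x - δ (h x)))) = dB (σ x) + σ (δ (P (τ (σ x)))) :=
      fun x => by
        have h1 : d (x - δ (h x)) + δ (x - δ (h x)) = (d x - δ (h (d x))) + δ (τ (σ x)) := by
          rw [hhd, map_sub, map_sub, map_sub, map_sub, hdδ]; abel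
        have h2 : Q (d x - δ (h (d x))) = d x := by
          rw [map_sub, hQ' (d x)]; abel
        rw [h1, map_add, h2, map_add, hσd, hδP]
    have h3 : Q x - δ (h (Q x)) = x := by rw [sub_eq_iff_eq_add]; exact hQ x
    have := key (Q x)
    rwa [h3] at this
  refine ⟨hSD, hDP, hQP, fun x => ?_, fun x => ?_, fun y => ?_, fun x => ?_, fun y => ?_⟩
  -- This is the homotopy identity multiplied on the left by 1 − hδ and evaluated at (1 − δh)x.
  -- Taking x to be Qx and applying P removes both factors.
  · have key : ∀ x, h (d (x - δ (h x)) + δ (x - δ (h x))) + (d (h x) + δ (h x)) -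
        h (δ (d (h x) + δ (h x))) = τ (σ x) - (x - δ (h x)) + h (δ (x - δ (h x))) := fun x => by
      have h1 : h (d (x - δ (h x)) + δ (x - δ (h x))) = h (d x) + h (δ x) + h (δ (d (h x))) := by
        rw [map_sub, map_sub, hdδ, map_add, map_sub, map_sub, map_sub, map_neg]; abel
      rw [h1, hhd]
      simp only [map_add, map_sub]
      abel
    have h3 : Q x - δ (h (Q x)) = x := by rw [sub_eq_iff_eq_add]; exact hQ x
    have h4 := congrArg P (key (Q x))
    rw [h3, hhQ] at h4
    rw [map_add P, map_sub P, map_add P, map_sub P] at h4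
    have h5 := hP' (d (P (h x)) + δ (P (h x)))
    have h6 := hP' x
    rw [← sub_eq_zero] at h4 ⊢
    rw [← sub_eq_zero] at h5 h6
    have h7 : P (h (d x + δ x)) + (d (P (h x)) + δ (P (h x))) - (P (τ (σ (Q x))) - x) =
        (P (h (d x + δ x)) + P (d (P (h x)) + δ (P (h x))) -
          P (h (δ (d (P (h x)) + δ (P (h x))))) - (P (τ (σ (Q x))) - P x + P (h (δ x)))) -
        (P (d (P (h x)) + δ (P (h x))) - (d (P (h x)) + δ (P (h x)) +
          P (h (δ (d (P (h x)) + δ (P (h x))))))) - (P x - (x + P (h (δ x)))) := by abel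
    rw [h7, h4, h5, h6]; simp
  · rw [hPh, map_add, map_add, hQPh, hQPh, add_zero]
  · rw [hhP, hhτ, map_zero]
  · rw [hhP, hhh, map_zero]
  -- The square of D' is read off from that of d + δ: the perturbed projection intertwines the
  -- differentials and has the perturbed inclusion as right inverse.
  · have h3 : ∀ z, d (d z + δ z) + δ (d z + δ z) = 0 := fun z => by
      rw [map_add, map_add, hdd, zero_add, ← add_assoc, hDD]
    have h2 := hSD (P (τ (dB y + σ (δ (P (τ y))))))
    simp only [hQP] at h2
    rw [← hDP y, h3, map_zero, map_zero, hDP y] at h2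
    exact h2.symm

variable {A B : Type*} [Ring A] [Algebra K A] [Ring B] [Algebra K B]
  {Δ : FormalMap K A A} {dB : B →ₗ[K] B} {σ : A →ₗ[K] B} {τ : B →ₗ[K] A} {h : A →ₗ[K] A}

theorem comp_plus_apply_zero (f : A →ₗ[K] B) : comp (const f) (plus Δ) 0 = 0 := by
  simp [comp, plus]

theorem plus_comp_apply_zero (f : B →ₗ[K] A) : comp (plus Δ) (const f) 0 = 0 := by
  simp [comp, plus]

variable (Δ h) in
/-- The inverse of `1 - h Δ₊`. -/
def leftResolvent : FormalMap K A A := series (pow (comp (const h) (plus Δ)))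

variable (Δ h) in
/-- The inverse of `1 - Δ₊ h`. -/
def rightResolvent : FormalMap K A A := series (pow (comp (plus Δ) (const h)))

theorem perturbedInclusion_eq :
    perturbedInclusion Δ τ h = comp (leftResolvent Δ h) (const τ) :=
  (series_comp _ (pow_apply_eq_zero (comp_plus_apply_zero h))).symm

theorem perturbedHomotopy_eq : perturbedHomotopy Δ h = comp (leftResolvent Δ h) (const h) :=
  (series_comp _ (pow_apply_eq_zero (comp_plus_apply_zero h))).symm

theorem perturbedProjection_eq :
    perturbedProjection Δ σ h = comp (const σ) (rightResolvent Δ h) :=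
  (comp_series _ (pow_apply_eq_zero (plus_comp_apply_zero h))).symm

theorem perturbedDifferential_eq : perturbedDifferential Δ dB σ τ h =
    const dB + comp (const σ) (comp (plus Δ) (perturbedInclusion Δ τ h)) := by
  rw [perturbedDifferential, perturbedInclusion, comp_series, comp_series]
  · intro m n hmn
    refine Finset.sum_eq_zero fun ij hij => ?_
    rw [Finset.HasAntidiagonal.mem_antidiagonal] at hij
    by_cases h0 : ij.2 < m
    · have := pow_apply_eq_zero (comp_plus_apply_zero (Δ := Δ) h) m
      have h1 : comp (pow (comp (const h) (plus Δ)) m) (const τ) ij.2 = 0 :=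
        Finset.sum_eq_zero fun kl hkl => by
          rw [Finset.HasAntidiagonal.mem_antidiagonal] at hkl
          rw [this kl.1 (by omega), LinearMap.zero_comp]
      rw [h1, LinearMap.comp_zero]
    · omega
  · intro m n hmn
    refine Finset.sum_eq_zero fun ij hij => ?_
    rw [Finset.HasAntidiagonal.mem_antidiagonal] at hij
    rw [pow_apply_eq_zero (comp_plus_apply_zero (Δ := Δ) h) m _ (by omega), LinearMap.zero_comp]

theorem leftResolvent_apply (x : A⟦X⟧) : (leftResolvent Δ h).toPowerSeries x =
    x + (const h).toPowerSeries ((plus Δ).toPowerSeries ((leftResolvent Δ h).toPowerSeries x)) := by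
  conv_lhs => rw [leftResolvent, series_pow_eq_comp (comp_plus_apply_zero h)]
  rw [toPowerSeries_add, toPowerSeries_const_id, toPowerSeries_comp, toPowerSeries_comp]; rfl

theorem leftResolvent_apply' (x : A⟦X⟧) : (leftResolvent Δ h).toPowerSeries x =
    x + (leftResolvent Δ h).toPowerSeries ((const h).toPowerSeries ((plus Δ).toPowerSeries x)) := by
  conv_lhs => rw [leftResolvent, series_pow_eq_comp' (comp_plus_apply_zero h)]
  rw [toPowerSeries_add, toPowerSeries_const_id, toPowerSeries_comp, toPowerSeries_comp]; rfl

theorem rightResolvent_apply (x : A⟦X⟧) : (rightResolvent Δ h).toPowerSeries x =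
    x + (plus Δ).toPowerSeries ((const h).toPowerSeries ((rightResolvent Δ h).toPowerSeries x)) := by
  conv_lhs => rw [rightResolvent, series_pow_eq_comp (plus_comp_apply_zero h)]
  rw [toPowerSeries_add, toPowerSeries_const_id, toPowerSeries_comp, toPowerSeries_comp]; rfl

theorem rightResolvent_apply' (x : A⟦X⟧) : (rightResolvent Δ h).toPowerSeries x =
    x + (rightResolvent Δ h).toPowerSeries ((plus Δ).toPowerSeries ((const h).toPowerSeries x)) := by
  conv_lhs => rw [rightResolvent, series_pow_eq_comp' (plus_comp_apply_zero h)]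
  rw [toPowerSeries_add, toPowerSeries_const_id, toPowerSeries_comp, toPowerSeries_comp]; rfl

variable {𝒜 : ℤ → Submodule K A} {ℬ : ℤ → Submodule K B} {k : ℤ}

theorem perturbedDifferential_apply (y : B⟦X⟧) :
    (perturbedDifferential Δ dB σ τ h).toPowerSeries y = (const dB).toPowerSeries y +
      (const σ).toPowerSeries ((plus Δ).toPowerSeries
        ((perturbedInclusion Δ τ h).toPowerSeries y)) := by
  rw [perturbedDifferential_eq, toPowerSeries_add, toPowerSeries_comp, toPowerSeries_comp]

/-- The identities of the given contraction extend coefficientwise to power series, and the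
geometric series of hΔ₊ and Δ₊h supply the resolvents required by `perturbation_lemma`. -/
theorem isFormalContraction_perturbed
    (hdeg : ∀ n : ℕ, HasDegree 𝒜 𝒜 (1 + n * (k - 1)) (Δ n)) (hΔ : comp Δ Δ = 0)
    (hc : IsContraction 𝒜 ℬ (Δ 0) dB σ τ h) :
    IsFormalContraction 𝒜 ℬ k Δ (perturbedDifferential Δ dB σ τ h)
      (perturbedProjection Δ σ h) (perturbedInclusion Δ τ h) (perturbedHomotopy Δ h) := by
  have hdd : ∀ x, (const (Δ 0)).toPowerSeries ((const (Δ 0)).toPowerSeries x) = 0 := fun x => by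
    ext n; simp only [coeff_toPowerSeries_const, map_zero]; exact LinearMap.congr_fun hc.dA_dA _
  have hDD : ∀ x, Δ.toPowerSeries (Δ.toPowerSeries x) = 0 := fun x => by
    rw [← toPowerSeries_comp, hΔ, toPowerSeries_zero]
  have hpert := perturbation_lemma (d := (const (Δ 0)).toPowerSeries)
    (δ := (plus Δ).toPowerSeries) (h := (const h).toPowerSeries)
    (P := (leftResolvent Δ h).toPowerSeries) (Q := (rightResolvent Δ h).toPowerSeries)
    (dB := (const dB).toPowerSeries) (σ := (const σ).toPowerSeries) (τ := (const τ).toPowerSeries)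
    hdd
    (fun x => by
      have := hDD x
      rw [toPowerSeries_plus Δ, toPowerSeries_plus Δ x, map_add, hdd, zero_add, map_add,
        ← add_assoc] at this
      exact this)
    (fun x => by ext n; simp only [coeff_toPowerSeries_const]; exact LinearMap.congr_fun hc.σ_dA _)
    (fun x => by ext n; simp only [coeff_toPowerSeries_const]; exact LinearMap.congr_fun hc.dA_τ _)
    (fun x => by ext n; simp only [coeff_toPowerSeries_const]; exact LinearMap.congr_fun hc.σ_τ _)
    (fun x => by
      ext n
      simp only [coeff_toPowerSeries_const, map_add, map_sub]; exact LinearMap.congr_fun hc.homotopy _)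
    (fun x => by ext n; simp only [coeff_toPowerSeries_const, map_zero]; exact LinearMap.congr_fun hc.σ_h _)
    (fun x => by ext n; simp only [coeff_toPowerSeries_const, map_zero]; exact LinearMap.congr_fun hc.h_τ _)
    (fun x => by ext n; simp only [coeff_toPowerSeries_const, map_zero]; exact LinearMap.congr_fun hc.h_h _)
    leftResolvent_apply leftResolvent_apply' rightResolvent_apply rightResolvent_apply'
  obtain ⟨h1, h2, h3, h4, h5, h6, h7, h8⟩ := hpert
  have hD' : ∀ y, (perturbedDifferential Δ dB σ τ h).toPowerSeries y =
      (const dB).toPowerSeries y + (const σ).toPowerSeries ((plus Δ).toPowerSeries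
        ((leftResolvent Δ h).toPowerSeries ((const τ).toPowerSeries y))) := fun y => by
    rw [perturbedDifferential_apply, perturbedInclusion_eq, toPowerSeries_comp]
  have dh : HasFormalDegree 𝒜 𝒜 k (-1) (const h) := HasFormalDegree.const hc.degree_h
  have dΔ : HasFormalDegree 𝒜 𝒜 k 1 (plus Δ) :=
    HasFormalDegree.plus (show HasFormalDegree 𝒜 𝒜 k 1 Δ from hdeg)
  have dσ : HasFormalDegree 𝒜 ℬ k 0 (const σ) := HasFormalDegree.const hc.degree_σ
  have dτ : HasFormalDegree ℬ 𝒜 k 0 (const τ) := HasFormalDegree.const hc.degree_τ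
  have dP : HasFormalDegree 𝒜 𝒜 k 0 (leftResolvent Δ h) :=
    HasFormalDegree.series fun m => HasFormalDegree.pow (by simpa using dh.comp dΔ) m
  have dQ : HasFormalDegree 𝒜 𝒜 k 0 (rightResolvent Δ h) :=
    HasFormalDegree.series fun m => HasFormalDegree.pow (by simpa using dΔ.comp dh) m
  refine ⟨hdeg, ?_, ?_, ?_, ?_, hΔ, ?_, ?_, ?_, ?_, ?_, ?_, ?_, ?_⟩
  · rw [perturbedDifferential_eq, perturbedInclusion_eq]
    have dT : HasFormalDegree ℬ 𝒜 k 0 (comp (leftResolvent Δ h) (const τ)) := by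
      simpa using dP.comp dτ
    have := dΔ.comp dT
    rw [add_zero] at this
    have := dσ.comp this
    rw [zero_add] at this
    exact (HasFormalDegree.const hc.degree_dB).add this
  · rw [perturbedProjection_eq]
    exact hasFormalDegree_zero.mp (by simpa using dσ.comp dQ)
  · rw [perturbedInclusion_eq]
    exact hasFormalDegree_zero.mp (by simpa using dP.comp dτ)
  · rw [perturbedHomotopy_eq]
    have := dP.comp dh
    rw [zero_add] at this
    exact this
  all_goals refine toPowerSeries_injective (LinearMap.ext fun x => ?_)
  · rw [toPowerSeries_comp, hD' x, hD', toPowerSeries_zero]; exact h8 x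
  · rw [perturbedProjection_eq]
    simp only [toPowerSeries_comp]
    rw [toPowerSeries_plus Δ, hD']; exact h1 x
  · rw [perturbedInclusion_eq]
    simp only [toPowerSeries_comp]
    rw [toPowerSeries_plus Δ, hD']; exact h2 x
  · rw [perturbedInclusion_eq, perturbedProjection_eq]
    simp only [toPowerSeries_comp]
    rw [toPowerSeries_const_id]; exact h3 x
  · rw [perturbedInclusion_eq, perturbedProjection_eq, perturbedHomotopy_eq]
    simp only [toPowerSeries_comp, toPowerSeries_add, toPowerSeries_sub]
    rw [toPowerSeries_const_id, toPowerSeries_plus Δ, toPowerSeries_plus Δ]; exact h4 x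
  · rw [perturbedProjection_eq, perturbedHomotopy_eq]
    simp only [toPowerSeries_comp]
    rw [toPowerSeries_zero]; exact h5 x
  · rw [perturbedInclusion_eq, perturbedHomotopy_eq]
    simp only [toPowerSeries_comp]
    rw [toPowerSeries_zero]; exact h6 x
  · rw [perturbedHomotopy_eq]
    simp only [toPowerSeries_comp]
    rw [toPowerSeries_zero]; exact h7 x

end Perturbation

end

end DerivedBV

/-! ### Parity of formal maps and divisibility by powers of t. -/

namespace DerivedBV

noncomputable section

variable {K : Type*} [Field K]

/-! ### The parity projections -/

section Parity

variable {A B : Type*} [Ring A] [Algebra K A] [Ring B] [Algebra K B]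
  (𝒜 : ℤ → Submodule K A) [GradedAlgebra 𝒜] (ℬ : ℤ → Submodule K B) [GradedAlgebra ℬ]

theorem parityProj_of_mem {i : ℤ} {a : A} (ha : a ∈ 𝒜 i) (e : ZMod 2) :
    parityProj 𝒜 e a = if (i : ZMod 2) = e then a else 0 := by
  simp only [parityProj, LinearMap.comp_apply, LinearEquiv.coe_coe]
  rw [DirectSum.decomposeLinearEquiv_apply, DirectSum.decompose_of_mem _ ha]
  have h : (DFinsupp.filterLinearMap K (fun i => 𝒜 i) (fun i : ℤ => (i : ZMod 2) = e))
      (DirectSum.of (fun i => 𝒜 i) i ⟨a, ha⟩) =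
      if (i : ZMod 2) = e then DirectSum.of (fun i => 𝒜 i) i ⟨a, ha⟩ else 0 := by
    exact DFinsupp.filter_single _ _ _
  rw [h]
  split_ifs
  · exact DirectSum.coeAddMonoidHom_of 𝒜 i ⟨a, ha⟩
  · exact map_zero _

theorem parityProj_cast {i : ℤ} {a : A} (ha : a ∈ 𝒜 i) : parityProj 𝒜 (i : ZMod 2) a = a := by
  rw [parityProj_of_mem 𝒜 ha, if_pos rfl]

theorem parityProj_mem {i : ℤ} {a : A} (ha : a ∈ 𝒜 i) (e : ZMod 2) : parityProj 𝒜 e a ∈ 𝒜 i := by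
  rw [parityProj_of_mem 𝒜 ha]; split_ifs
  · exact ha
  · exact Submodule.zero_mem _

theorem swapSign_cast (i j : ℤ) :
    swapSign (i : ZMod 2) (j : ZMod 2) = (Int.negOnePow (i * j) : ℤ) := by
  have h : ∀ m : ℤ, ((m : ZMod 2) = 1 ↔ Odd m) := fun m => by
    rw [← ZMod.intCast_eq_one_iff_odd]
  unfold swapSign
  simp only [h]
  split_ifs with hij
  · rw [Int.negOnePow_odd _ (hij.1.mul hij.2)]; rfl
  · rw [Int.negOnePow_even]
    · rfl
    · rw [Int.even_mul]
      by_contra hne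
      rw [not_or, Int.not_even_iff_odd, Int.not_even_iff_odd] at hne
      exact hij hne

theorem parityProj_mul (e e' : ZMod 2) (a b : A) :
    parityProj 𝒜 (e + e') (parityProj 𝒜 e a * parityProj 𝒜 e' b) =
      parityProj 𝒜 e a * parityProj 𝒜 e' b := by
  induction a using DirectSum.Decomposition.inductionOn 𝒜 with
  | zero => simp
  | add a a' h h' => rw [map_add, add_mul, map_add, h, h']
  | @homogeneous i a =>
    induction b using DirectSum.Decomposition.inductionOn 𝒜 with
    | zero => simp
    | add a a' h h' => rw [map_add, mul_add, map_add, h, h']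
    | @homogeneous j b =>
      rw [parityProj_of_mem 𝒜 a.2, parityProj_of_mem 𝒜 b.2]
      split_ifs with h1 h2
      · rw [parityProj_of_mem 𝒜 (SetLike.mul_mem_graded a.2 b.2), if_pos]
        rw [← h1, ← h2]; push_cast; rfl
      all_goals simp

variable {𝒜} in
theorem parityProj_mul_comm (h𝒜 : IsGradedCommutative 𝒜) (e e' : ZMod 2) (a b : A) :
    parityProj 𝒜 e a * parityProj 𝒜 e' b =
      swapSign e e' • (parityProj 𝒜 e' b * parityProj 𝒜 e a) := by
  induction a using DirectSum.Decomposition.inductionOn 𝒜 with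
  | zero => simp
  | add a a' h h' => rw [map_add, add_mul, mul_add, smul_add, h, h']
  | @homogeneous i a =>
    induction b using DirectSum.Decomposition.inductionOn 𝒜 with
    | zero => simp
    | add a a' h h' => rw [map_add, mul_add, add_mul, smul_add, h, h']
    | @homogeneous j b =>
      rw [parityProj_of_mem 𝒜 a.2, parityProj_of_mem 𝒜 b.2]
      split_ifs with h1 h2
      · rw [h𝒜 i j _ _ a.2 b.2, ← h1, ← h2, swapSign_cast]
      all_goals simp

variable {𝒜} in
theorem isSuperCommutative_parityProj (h𝒜 : IsGradedCommutative 𝒜) :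
    IsSuperCommutative (parityProj 𝒜) where
  sum_proj a := by
    induction a using DirectSum.Decomposition.inductionOn 𝒜 with
    | zero => simp
    | add a a' h h' => rw [map_add, map_add, add_add_add_comm, h, h']
    | @homogeneous i a =>
      rw [parityProj_of_mem 𝒜 a.2, parityProj_of_mem 𝒜 a.2]
      have : ∀ e : ZMod 2, e = 0 ∨ e = 1 := by decide
      rcases this (i : ZMod 2) with h | h <;> simp [h]
  proj_proj e a := by
    induction a using DirectSum.Decomposition.inductionOn 𝒜 with
    | zero => simp
    | add a a' h h' => rw [map_add, map_add, h, h']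
    | @homogeneous i a =>
      rw [parityProj_of_mem 𝒜 a.2]
      split_ifs with h
      · rw [parityProj_of_mem 𝒜 a.2, if_pos h]
      · simp
  proj_of_ne e e' a hne := by
    induction a using DirectSum.Decomposition.inductionOn 𝒜 with
    | zero => simp
    | add a a' h h' => rw [map_add, map_add, h, h', add_zero]
    | @homogeneous i a =>
      rw [parityProj_of_mem 𝒜 a.2]
      split_ifs with h
      · rw [parityProj_of_mem 𝒜 a.2, if_neg (h.trans_ne hne.symm)]
      · simp
  one := by simpa using parityProj_cast 𝒜 SetLike.GradedOne.one_mem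
  mul e e' a b ha hb := by rw [← ha, ← hb, parityProj_mul]
  comm e e' a b ha hb := by rw [← ha, ← hb, parityProj_mul_comm h𝒜]

theorem coeff_seriesParityProj (e : ZMod 2) (x : A⟦X⟧) (n : ℕ) :
    PowerSeries.coeff n (seriesParityProj 𝒜 e x) = parityProj 𝒜 e (PowerSeries.coeff n x) :=
  FormalMap.coeff_toPowerSeries_const _ _ _

theorem seriesParityProj_C (e : ZMod 2) (a : A) :
    seriesParityProj 𝒜 e (PowerSeries.C a) = PowerSeries.C (parityProj 𝒜 e a) :=
  FormalMap.toPowerSeries_const_C _ _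

theorem seriesParityProj_eq_iff {e : ZMod 2} {x : A⟦X⟧} : seriesParityProj 𝒜 e x = x ↔
    ∀ n, parityProj 𝒜 e (PowerSeries.coeff n x) = PowerSeries.coeff n x := by
  rw [PowerSeries.ext_iff]
  simp only [coeff_seriesParityProj]

variable {𝒜 ℬ}

theorem isSuperCommutative_seriesParityProj (h𝒜 : IsGradedCommutative 𝒜) :
    IsSuperCommutative (seriesParityProj 𝒜) where
  sum_proj a := by
    ext n
    rw [map_add, coeff_seriesParityProj, coeff_seriesParityProj,
      (isSuperCommutative_parityProj h𝒜).sum_proj]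
  proj_proj e a := by
    ext n
    rw [coeff_seriesParityProj, coeff_seriesParityProj,
      (isSuperCommutative_parityProj h𝒜).proj_proj]
  proj_of_ne e e' a hne := by
    ext n
    rw [coeff_seriesParityProj, coeff_seriesParityProj,
      (isSuperCommutative_parityProj h𝒜).proj_of_ne _ _ _ hne, map_zero]
  one := by
    have := seriesParityProj_C 𝒜 0 1
    rwa [(isSuperCommutative_parityProj h𝒜).one, map_one] at this
  mul e e' a b ha hb := by
    rw [seriesParityProj_eq_iff] at ha hb ⊢
    intro n
    rw [PowerSeries.coeff_mul, map_sum]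
    exact Finset.sum_congr rfl fun ij _ =>
      (isSuperCommutative_parityProj h𝒜).mul _ _ _ _ (ha _) (hb _)
  comm e e' a b ha hb := by
    rw [seriesParityProj_eq_iff] at ha hb
    ext n
    rw [map_zsmul, PowerSeries.coeff_mul, PowerSeries.coeff_mul, Finset.smul_sum,
      ← Finset.Nat.sum_antidiagonal_swap]
    exact Finset.sum_congr rfl fun ij _ =>
      (isSuperCommutative_parityProj h𝒜).comm _ _ _ _ (ha _) (hb _)

theorem parityProj_of_hasDegree {d : ℤ} {f : A →ₗ[K] B} (hf : HasDegree 𝒜 ℬ d f) (e : ZMod 2)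
    (a : A) : parityProj ℬ (e + d) (f a) = f (parityProj 𝒜 e a) := by
  induction a using DirectSum.Decomposition.inductionOn 𝒜 with
  | zero => simp
  | add a a' h h' => simp only [map_add, h, h']
  | @homogeneous i a =>
    rw [parityProj_of_mem 𝒜 a.2, parityProj_of_mem ℬ (hf i _ a.2)]
    push_cast
    simp only [add_left_inj]
    split_ifs <;> simp

/-- The coefficient of t^n is shifted in degree by n(k − 1), an even number because k is odd. -/
theorem seriesParityProj_of_hasFormalDegree {k d : ℤ} (hk : Odd k) {F : FormalMap K A B}
    (hF : FormalMap.HasFormalDegree 𝒜 ℬ k d F) (e : ZMod 2) (x : A⟦X⟧)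
    (hx : seriesParityProj 𝒜 e x = x) :
    seriesParityProj ℬ (e + d) (F.toPowerSeries x) = F.toPowerSeries x := by
  rw [seriesParityProj_eq_iff] at hx ⊢
  intro n
  rw [FormalMap.coeff_toPowerSeries, map_sum]
  refine Finset.sum_congr rfl fun ij _ => ?_
  have h1 := parityProj_of_hasDegree (hF ij.1) e (PowerSeries.coeff ij.2 x)
  have h2 : ((d + ij.1 * (k - 1) : ℤ) : ZMod 2) = d := by
    obtain ⟨l, rfl⟩ := hk
    have : (2 : ZMod 2) = 0 := rfl
    push_cast
    rw [add_sub_cancel_right, this]; simp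
  rwa [hx, h2] at h1

end Parity

/-! ### Brackets and cumulants of constant series -/

section Constants

variable {A B : Type*} [Ring A] [Algebra K A] [Ring B] [Algebra K B]
  {𝒜 : ℤ → Submodule K A} [GradedAlgebra 𝒜] {ℬ : ℤ → Submodule K B} [GradedAlgebra ℬ]

/-- Koszul brackets are linear in the operator and may be computed coefficientwise in t; this fails
for cumulants, which are polynomial in the map. -/
theorem coeff_koszulBracket_C (Δ : FormalMap K A A) (n : ℕ) (a : Fin n → A) (m : ℕ) :
    PowerSeries.coeff m
      (koszulBracket (seriesParityProj 𝒜) Δ.toPowerSeries n (fun i => PowerSeries.C (a i))) =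
      koszulBracket (parityProj 𝒜) (Δ m) n a := by
  simp only [koszulBracket, map_sum, map_zsmul, seriesParityProj_C, ← map_blockProd,
    PowerSeries.coeff_mul_C, FormalMap.coeff_toPowerSeries_C]

theorem blockProd_mem {n : ℕ} {d : Fin n → ℤ} {a : Fin n → A} (ha : ∀ i, a i ∈ 𝒜 (d i))
    (I : Finset (Fin n)) : blockProd I a ∈ 𝒜 (∑ i ∈ I, d i) := by
  have h := SetLike.list_prod_map_mem_graded (A := 𝒜) (I.sort (· ≤ ·)) d a fun j _ => ha j
  have h2 : ((I.sort (· ≤ ·)).map d).sum = ∑ i ∈ I, d i := by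
    rw [← Multiset.sum_coe, ← Multiset.map_coe, Finset.sort_eq]; rfl
  rwa [h2] at h

theorem koszulBracket_mem {n : ℕ} {d : Fin n → ℤ} {a : Fin n → A} (ha : ∀ i, a i ∈ 𝒜 (d i))
    {e : ℤ} {D : A →ₗ[K] A} (hD : HasDegree 𝒜 𝒜 e D) :
    koszulBracket (parityProj 𝒜) D n a ∈ 𝒜 (∑ i, d i + e) := by
  refine Submodule.sum_mem _ fun p _ => Submodule.sum_mem _ fun I _ => ?_
  refine zsmul_mem ?_ _
  have ha' : ∀ i, parityProj 𝒜 (p i) (a i) ∈ 𝒜 (d i) := fun i => parityProj_mem 𝒜 (ha i) _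
  have := SetLike.mul_mem_graded (hD _ _ (blockProd_mem ha' I)) (blockProd_mem ha' Iᶜ)
  rwa [add_right_comm, Finset.sum_add_sum_compl] at this

/-- The series whose coefficient of `tᵐ` has degree `e + m (k - 1)`. -/
def IsHomogeneousSeries (ℬ : ℤ → Submodule K B) (k e : ℤ) (y : B⟦X⟧) : Prop :=
  ∀ m : ℕ, PowerSeries.coeff m y ∈ ℬ (e + m * (k - 1))

theorem IsHomogeneousSeries.list_prod {k : ℤ} {ι : Type*} (l : List ι) (e : ι → ℤ) (y : ι → B⟦X⟧)
    (h : ∀ i ∈ l, IsHomogeneousSeries ℬ k (e i) (y i)) :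
    IsHomogeneousSeries ℬ k (l.map e).sum (l.map y).prod := by
  induction l with
  | nil =>
    intro m
    simp only [List.map_nil, List.prod_nil, List.sum_nil, PowerSeries.coeff_one]
    split_ifs with hm
    · subst hm; simpa using SetLike.GradedOne.one_mem
    · exact Submodule.zero_mem _
  | cons i l ih =>
    intro m
    rw [List.map_cons, List.map_cons, List.prod_cons, List.sum_cons, PowerSeries.coeff_mul]
    refine Submodule.sum_mem _ fun ij hij => ?_
    rw [Finset.HasAntidiagonal.mem_antidiagonal] at hij
    have := SetLike.mul_mem_graded (h i List.mem_cons_self ij.1)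
      (ih (fun j hj => h j (List.mem_cons_of_mem _ hj)) ij.2)
    have h2 : e i + ij.1 * (k - 1) + ((l.map e).sum + ij.2 * (k - 1)) =
        e i + (l.map e).sum + m * (k - 1) := by rw [← hij]; push_cast; ring
    rwa [h2] at this

theorem coeff_cumulant_mem {n : ℕ} {d : Fin n → ℤ} {a : Fin n → A} (ha : ∀ i, a i ∈ 𝒜 (d i))
    {k : ℤ} {F : FormalMap K A B} (hF : FormalMap.HasFormalDegree 𝒜 ℬ k 0 F) :
    IsHomogeneousSeries ℬ k (∑ i, d i)
      (cumulant (seriesParityProj 𝒜) F.toPowerSeries n (fun i => PowerSeries.C (a i))) := by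
  have hsmul : ∀ (c : K) (y : B⟦X⟧) (m : ℕ), PowerSeries.coeff m (c • y) =
    c • PowerSeries.coeff m y := fun _ _ _ => rfl
  intro m
  rw [cumulant, map_sum]
  refine Submodule.sum_mem _ fun p _ => ?_
  rw [map_sum]
  refine Submodule.sum_mem _ fun l _ => ?_
  rw [hsmul, map_sum]
  refine Submodule.smul_mem _ _ (Submodule.sum_mem _ fun φ _ => ?_)
  rw [map_zsmul]
  refine zsmul_mem ?_ _
  have ha' : ∀ i, parityProj 𝒜 (p i) (a i) ∈ 𝒜 (d i) := fun i => parityProj_mem 𝒜 (ha i) _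
  have h := IsHomogeneousSeries.list_prod (ℬ := ℬ) (k := k) (List.finRange l)
    (fun j => ∑ i ∈ block φ.1 j, d i)
    (fun j => F.toPowerSeries
      (blockProd (block φ.1 j) (fun i => seriesParityProj 𝒜 (p i) (PowerSeries.C (a i)))))
    (fun j _ m => by
      simp only [seriesParityProj_C, ← map_blockProd, FormalMap.coeff_toPowerSeries_C]
      simpa using hF m _ _ (blockProd_mem ha' (block φ.1 j)))
  have h2 : ((List.finRange l).map fun j => ∑ i ∈ block φ.1 j, d i).sum = ∑ i, d i := by
    rw [← List.ofFn_eq_map, List.sum_ofFn]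
    exact Finset.sum_fiberwise _ _ _
  rw [h2, ← List.ofFn_eq_map] at h
  exact h m

end Constants

/-! ### Multilinear maps of power series and divisibility by powers of the variable -/

section Vanishing

variable {A B : Type*} [Ring A] [Ring B]

/-- A function of `n` power series that is additive in each argument and commutes with the
multiplication of an argument by the variable. -/
structure IsSeriesMultilinear {n : ℕ} (Φ : (Fin n → A⟦X⟧) → B⟦X⟧) : Prop where
  map_add : ∀ (y : Fin n → A⟦X⟧) (i : Fin n) (u v : A⟦X⟧),
    Φ (Function.update y i (u + v)) = Φ (Function.update y i u) + Φ (Function.update y i v)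
  map_X_mul : ∀ (y : Fin n → A⟦X⟧) (i : Fin n) (u : A⟦X⟧),
    Φ (Function.update y i (PowerSeries.X * u)) = PowerSeries.X * Φ (Function.update y i u)

/-- The series `x` is divisible by `tᴺ`. -/
def VanishesBelow (N : ℕ) (x : A⟦X⟧) : Prop := ∀ m, m < N → PowerSeries.coeff m x = 0

theorem VanishesBelow.eq_X_pow_mul {N : ℕ} {x : A⟦X⟧} (h : VanishesBelow N x) :
    x = PowerSeries.X ^ N * PowerSeries.mk (fun m => PowerSeries.coeff (m + N) x) := by
  ext m
  rw [PowerSeries.coeff_X_pow_mul']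
  split_ifs with h'
  · rw [PowerSeries.coeff_mk, Nat.sub_add_cancel h']
  · exact h m (by omega)

variable {n : ℕ} {Φ : (Fin n → A⟦X⟧) → B⟦X⟧} (hΦ : IsSeriesMultilinear Φ)
include hΦ

omit hΦ in
theorem eq_of_forall_update {M N : Type*} {G : (Fin n → M) → N} {ρ : M → M}
    (h : ∀ y i, G y = G (Function.update y i (ρ (y i)))) (y : Fin n → M) :
    G y = G (fun i => ρ (y i)) := by
  have key : ∀ s : Finset (Fin n), G y = G (fun i => if i ∈ s then ρ (y i) else y i) := by
    intro s
    induction s using Finset.induction_on with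
    | empty => simp
    | insert i s hi ih =>
      rw [ih, h _ i]
      congr 1
      funext j
      by_cases hj : j = i
      · subst hj; simp [hi]
      · simp [hj]
  simpa using key Finset.univ

theorem IsSeriesMultilinear.map_X_pow_mul (y : Fin n → A⟦X⟧) (i : Fin n) (u : A⟦X⟧) (m : ℕ) :
    Φ (Function.update y i (PowerSeries.X ^ m * u)) =
      PowerSeries.X ^ m * Φ (Function.update y i u) := by
  induction m with
  | zero => simp
  | succ m ih => rw [pow_succ', mul_assoc, hΦ.map_X_mul, ih, pow_succ', mul_assoc]

theorem IsSeriesMultilinear.map_X_pow_mul_univ (y : Fin n → A⟦X⟧) (m : Fin n → ℕ) :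
    Φ (fun i => PowerSeries.X ^ m i * y i) = PowerSeries.X ^ (∑ i, m i) * Φ y := by
  have key : ∀ s : Finset (Fin n), Φ (fun i => if i ∈ s then PowerSeries.X ^ m i * y i else y i) =
      PowerSeries.X ^ (∑ i ∈ s, m i) * Φ y := by
    intro s
    induction s using Finset.induction_on with
    | empty => simp
    | insert i s hi ih =>
      have h1 : (fun j => if j ∈ insert i s then PowerSeries.X ^ m j * y j else y j) =
          Function.update (fun j => if j ∈ s then PowerSeries.X ^ m j * y j else y j) i
            (PowerSeries.X ^ m i * y i) := by
        funext j
        by_cases hj : j = i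
        · subst hj; simp
        · simp [hj]
      have h2 : Function.update (fun j => if j ∈ s then PowerSeries.X ^ m j * y j else y j) i (y i) =
          (fun j => if j ∈ s then PowerSeries.X ^ m j * y j else y j) := by
        funext j
        by_cases hj : j = i
        · subst hj; simp [hi]
        · simp [hj]
      rw [h1, hΦ.map_X_pow_mul, h2, ih, Finset.sum_insert hi, pow_add, mul_assoc]
  simpa using key Finset.univ

/-- Splitting an argument as a multiple of t plus its constant term, the first part contributes t
times a value that is divisible by t^l, which does not reach the coefficient of t^l. -/
theorem IsSeriesMultilinear.coeff_eq_of_vanishesBelow {l : ℕ}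
    (h : ∀ y, VanishesBelow l (Φ y)) (y : Fin n → A⟦X⟧) :
    PowerSeries.coeff l (Φ y) =
      PowerSeries.coeff l (Φ fun i => PowerSeries.C (PowerSeries.coeff 0 (y i))) := by
  refine eq_of_forall_update (G := fun y => PowerSeries.coeff l (Φ y))
    (ρ := fun z => PowerSeries.C (PowerSeries.coeff 0 z)) (fun y i => ?_) y
  have h1 : y i = PowerSeries.X * PowerSeries.mk (fun p => PowerSeries.coeff (p + 1) (y i)) +
      PowerSeries.C (PowerSeries.coeff 0 (y i)) := by
    rw [PowerSeries.coeff_zero_eq_constantCoeff]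
    exact PowerSeries.eq_X_mul_shift_add_const (y i)
  have h2 : Φ y = Φ (Function.update y i (PowerSeries.X *
      PowerSeries.mk (fun p => PowerSeries.coeff (p + 1) (y i)))) +
        Φ (Function.update y i (PowerSeries.C (PowerSeries.coeff 0 (y i)))) := by
    rw [← hΦ.map_add y i, ← h1, Function.update_eq_self]
  change PowerSeries.coeff l (Φ y) = _
  rw [h2, _root_.map_add, hΦ.map_X_mul, add_eq_right]
  cases l with
  | zero => simp
  | succ l =>
    rw [PowerSeries.coeff_succ_X_mul]
    exact h _ l (Nat.lt_succ_self l)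

/-- The divisibility is raised one power at a time: once all values are divisible by t^l, the
coefficient of t^l depends only on constant terms. -/
theorem IsSeriesMultilinear.vanishesBelow {N : ℕ}
    (h : ∀ a : Fin n → A, VanishesBelow N (Φ fun i => PowerSeries.C (a i))) (y : Fin n → A⟦X⟧) :
    VanishesBelow N (Φ y) := by
  have key : ∀ l ≤ N, ∀ y, VanishesBelow l (Φ y) := by
    intro l
    induction l with
    | zero => intro _ y m hm; omega
    | succ l ih =>
      intro hl y m hm
      rcases Nat.lt_succ_iff_lt_or_eq.mp hm with h' | rfl
      · exact ih (by omega) y m h'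
      · rw [hΦ.coeff_eq_of_vanishesBelow (ih (by omega)) y]
        exact h _ m (by omega)
  exact key N le_rfl y

/-- The powers of t in the arguments are pulled out, and the arguments that remain may be replaced
by their constant terms. -/
theorem IsSeriesMultilinear.leading_coeff {N : ℕ}
    (h : ∀ a : Fin n → A, VanishesBelow N (Φ fun i => PowerSeries.C (a i)))
    {y : Fin n → A⟦X⟧} {m : Fin n → ℕ} (hy : ∀ i, VanishesBelow (m i) (y i)) :
    VanishesBelow (N + ∑ i, m i) (Φ y) ∧ PowerSeries.coeff (N + ∑ i, m i) (Φ y) =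
      PowerSeries.coeff N (Φ fun i => PowerSeries.C (PowerSeries.coeff (m i) (y i))) := by
  have h1 : Φ y = PowerSeries.X ^ (∑ i, m i) *
      Φ (fun i => PowerSeries.mk (fun l => PowerSeries.coeff (l + m i) (y i))) := by
    rw [← hΦ.map_X_pow_mul_univ]
    congr 1
    funext i
    exact (hy i).eq_X_pow_mul
  constructor
  · intro l hl
    rw [h1, PowerSeries.coeff_X_pow_mul']
    split_ifs with h'
    · exact hΦ.vanishesBelow h _ _ (by omega)
    · rfl
  · rw [h1, PowerSeries.coeff_X_pow_mul, hΦ.coeff_eq_of_vanishesBelow (hΦ.vanishesBelow h)]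
    simp

end Vanishing

section Multilinear

variable {A B : Type*} [Ring A] [Algebra K A] [Ring B] [Algebra K B]
  {𝒜 : ℤ → Submodule K A} [GradedAlgebra 𝒜]

theorem X_mul_middle (l x r : A⟦X⟧) :
    LinearMap.mulLeft K PowerSeries.X (l * x * r) = l * LinearMap.mulLeft K PowerSeries.X x * r := by
  simp only [LinearMap.mulLeft_apply]
  rw [← mul_assoc, ← mul_assoc, ← mul_assoc, PowerSeries.X_mul]

theorem isSeriesMultilinear_koszulBracket (Δ : FormalMap K A A) (n : ℕ) :
    IsSeriesMultilinear (koszulBracket (seriesParityProj 𝒜) Δ.toPowerSeries n) where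
  map_add y i u v := koszulBracket_update_add _ _ y i u v
  map_X_mul y i u := by
    have := koszulBracket_update_map (K := K) (π := seriesParityProj 𝒜) (D := Δ.toPowerSeries)
      (T := LinearMap.mulLeft K PowerSeries.X) X_mul_middle
      (fun x => FormalMap.toPowerSeries_X_mul _ x) (fun e x => FormalMap.toPowerSeries_X_mul _ x) y i u
    simpa only [LinearMap.mulLeft_apply] using this

theorem isSeriesMultilinear_cumulant (F : FormalMap K A B) (n : ℕ) :
    IsSeriesMultilinear (cumulant (seriesParityProj 𝒜) F.toPowerSeries n) where
  map_add y i u v := cumulant_update_add _ _ y i u v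
  map_X_mul y i u := by
    have := cumulant_update_map (K := K) (π := seriesParityProj 𝒜) (f := F.toPowerSeries)
      (T := LinearMap.mulLeft K PowerSeries.X) (T' := LinearMap.mulLeft K PowerSeries.X)
      X_mul_middle X_mul_middle
      (fun x => FormalMap.toPowerSeries_X_mul _ x) (fun e x => FormalMap.toPowerSeries_X_mul _ x) y i u
    simpa only [LinearMap.mulLeft_apply] using this

end Multilinear

end

end DerivedBV

/-! ### Leading coefficients, and the passage from derived BV to derived Poisson. -/

namespace DerivedBV

noncomputable section

variable {K : Type*} [Field K]

/-! ### Leading coefficients of compositions -/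

section Leading

variable {A B C : Type*} [Ring A] [Algebra K A] [Ring B] [Algebra K B] [Ring C] [Algebra K C]

theorem coeff_smul_field (c : K) (y : B⟦X⟧) (m : ℕ) :
    PowerSeries.coeff m (c • y) = c • PowerSeries.coeff m y := rfl

theorem C_smul_field (c : K) (b : B) :
    (PowerSeries.C (c • b) : B⟦X⟧) = c • PowerSeries.C b := by
  ext m
  rw [coeff_smul_field, PowerSeries.coeff_C, PowerSeries.coeff_C]
  split_ifs <;> simp

theorem C_comp_update {n : ℕ} (a : Fin n → A) (i : Fin n) (x : A) :
    (fun j => (PowerSeries.C (Function.update a i x j) : A⟦X⟧)) =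
      Function.update (fun j => PowerSeries.C (a j)) i (PowerSeries.C x) := by
  funext j
  by_cases h : j = i
  · subst h; simp
  · simp [h]

theorem C_comp_snoc {n : ℕ} (a : Fin n → A) (x : A) :
    (fun j => (PowerSeries.C ((Fin.snoc a x : Fin (n + 1) → A) j) : A⟦X⟧)) =
      Fin.snoc (fun j => PowerSeries.C (a j)) (PowerSeries.C x) := by
  funext j
  refine Fin.lastCases ?_ (fun j => ?_) j <;> simp

/-- The families of multilinear maps of power series in which the `n`-th one is divisible by
`tⁿ⁻¹`. -/
structure IsDivisibleFamily (Q : (n : ℕ) → (Fin n → A⟦X⟧) → B⟦X⟧) : Prop where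
  multilinear : ∀ n, IsSeriesMultilinear (Q n)
  vanishes : ∀ n (a : Fin n → A), VanishesBelow (n - 1) (Q n fun i => PowerSeries.C (a i))

/-- The coefficients of `tⁿ⁻¹` in a family of maps of power series. -/
def leadingFamily (Q : (n : ℕ) → (Fin n → A⟦X⟧) → B⟦X⟧) (n : ℕ) (a : Fin n → A) : B :=
  PowerSeries.coeff (n - 1) (Q n fun i => PowerSeries.C (a i))

/-- The filtration by t^(n-1) is compatible with composition: a single argument, the inner
operation, is divisible by a power of t, and the leading coefficients compose. -/
theorem coeff_compCoder {Q : (n : ℕ) → (Fin n → A⟦X⟧) → B⟦X⟧} (hQ : IsDivisibleFamily Q)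
    {R : (n : ℕ) → (Fin n → A⟦X⟧) → A⟦X⟧} (hR : IsDivisibleFamily R) (n : ℕ) (p : Fin n → ZMod 2)
    (a : Fin n → A) :
    PowerSeries.coeff (n - 1) (compCoder Q R n p fun i => PowerSeries.C (a i)) =
      compCoder (leadingFamily Q) (leadingFamily R) n p a := by
  rw [compCoder, compCoder, map_sum]
  refine Finset.sum_congr rfl fun I hI => ?_
  rw [map_zsmul]
  congr 1
  have hcard : I.card + Iᶜ.card = n := by
    rw [Finset.card_compl, Fintype.card_fin]
    have := Finset.card_le_univ I
    rw [Fintype.card_fin] at this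
    omega
  have hpos : 0 < I.card := Finset.card_pos.mpr (Finset.mem_filter.mp hI).2
  have h := ((hQ.multilinear (Iᶜ.card + 1)).leading_coeff (hQ.vanishes _)
    (y := Fin.cons (R I.card (restrict I fun i => PowerSeries.C (a i)))
      (restrict Iᶜ fun i => PowerSeries.C (a i)))
    (m := Fin.cons (I.card - 1) fun _ => 0) (fun j => by
      refine Fin.cases ?_ (fun j => ?_) j
      · exact hR.vanishes _ _
      · intro m hm; exact absurd hm (Nat.not_lt_zero m))).2
  -- The outer operation has |Iᶜ| + 1 arguments and the inner one |I| ≥ 1, so the exponents add up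
  -- to |Iᶜ| + (|I| − 1) = n − 1.
  have hsum : Iᶜ.card + 1 - 1 + ∑ i : Fin (Iᶜ.card + 1),
      (Fin.cons (I.card - 1) (fun _ => 0) : Fin (Iᶜ.card + 1) → ℕ) i = n - 1 := by
    rw [Fin.sum_univ_succ]
    simp only [Fin.cons_zero, Fin.cons_succ, Finset.sum_const_zero]
    omega
  rw [hsum] at h
  rw [h, leadingFamily]
  congr 2
  funext j
  refine Fin.cases ?_ (fun j => ?_) j
  · rfl
  · simp [restrict]

theorem sum_card_block {n k : ℕ} (φ : Fin n → Fin k) : ∑ j, (block φ j).card = n := by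
  have := Finset.card_eq_sum_card_fiberwise (f := φ) (s := Finset.univ) (t := Finset.univ)
    (by intro x _; exact Finset.mem_coe.mpr (Finset.mem_univ _))
  rw [Finset.card_univ, Fintype.card_fin] at this
  exact this.symm

theorem sum_card_block_sub_one {n k : ℕ} {φ : Fin n → Fin k} (hφ : Function.Surjective φ)
    (hk : 1 ≤ k) : k - 1 + ∑ j, ((block φ j).card - 1) = n - 1 := by
  have h1 : ∑ j, ((block φ j).card - 1) + k = n := by
    have h3 : ∑ j, ((block φ j).card - 1 + 1) = ∑ j, (block φ j).card :=
      Finset.sum_congr rfl fun j _ => Nat.sub_add_cancel (Finset.card_pos.mpr (block_nonempty hφ j))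
    rw [Finset.sum_add_distrib, sum_card_block] at h3
    simpa using h3
  omega

/-- The exponents k − 1 and |I_j| − 1 add up to n − 1 for every decomposition into k nonempty
blocks, so all terms contribute in the same order of t. -/
theorem coeff_compMorphism {Q : (n : ℕ) → (Fin n → B⟦X⟧) → C⟦X⟧}
    (hQ : ∀ n, IsSeriesMultilinear (Q n))
    (hQ' : ∀ n (a : Fin n → B), VanishesBelow (n - 1) (Q n fun i => PowerSeries.C (a i)))
    {n : ℕ} {k : ℕ} (hk : 1 ≤ k) {φ : Fin n → Fin k} (hφ : Function.Surjective φ)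
    {y : Fin k → B⟦X⟧} (hy : ∀ j, VanishesBelow ((block φ j).card - 1) (y j)) :
    VanishesBelow (n - 1) (Q k y) ∧ PowerSeries.coeff (n - 1) (Q k y) =
      leadingFamily Q k (fun j => PowerSeries.coeff ((block φ j).card - 1) (y j)) := by
  have h := (hQ k).leading_coeff (hQ' k) hy
  rwa [sum_card_block_sub_one hφ hk] at h

omit [Algebra K A] in
theorem coeff_compMorphism_family {Q : (n : ℕ) → (Fin n → B⟦X⟧) → B⟦X⟧} (hQ : IsDivisibleFamily Q)
    {F : (n : ℕ) → (Fin n → A⟦X⟧) → B⟦X⟧} (hF : IsDivisibleFamily F) (n : ℕ) (p : Fin n → ZMod 2)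
    (a : Fin n → A) :
    PowerSeries.coeff (n - 1) (compMorphism (K := K) Q F n p fun i => PowerSeries.C (a i)) =
      compMorphism (K := K) (leadingFamily Q) (leadingFamily F) n p a := by
  rw [compMorphism, compMorphism, map_sum]
  refine Finset.sum_congr rfl fun k hk => ?_
  rw [coeff_smul_field, map_sum]
  congr 1
  refine Finset.sum_congr rfl fun φ _ => ?_
  rw [map_zsmul]
  congr 1
  exact (coeff_compMorphism hQ.multilinear hQ.vanishes (Finset.mem_Icc.mp hk).1 φ.2
    (fun j => hF.vanishes _ (restrict (block φ.1 j) a))).2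

theorem VanishesBelow.coeff_mul {N M : ℕ} {x y : A⟦X⟧} (hx : VanishesBelow N x)
    (hy : VanishesBelow M y) : PowerSeries.coeff (N + M) (x * y) =
      PowerSeries.coeff N x * PowerSeries.coeff M y := by
  rw [PowerSeries.coeff_mul, Finset.sum_eq_single (N, M)]
  · rintro ⟨i, j⟩ hij hne
    rw [Finset.HasAntidiagonal.mem_antidiagonal] at hij
    rcases lt_or_ge i N with h | h
    · rw [hx i h, zero_mul]
    · rcases lt_or_ge j M with h' | h'
      · rw [hy j h', mul_zero]
      · exact absurd (Prod.ext (by dsimp only at hij ⊢; omega) (by dsimp only at hij ⊢; omega)) hne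
  · intro h; simp at h

/-- Multiadditive functions on a superspace are determined by their values on homogeneous
arguments. -/
theorem eq_of_homogeneous {n : ℕ} {π : ZMod 2 → A →ₗ[K] A} (hπ : IsSuperCommutative π) {M : Type*}
    [AddCommGroup M] {F G : (Fin n → A) → M}
    (hF : ∀ a i x y, F (Function.update a i (x + y)) =
      F (Function.update a i x) + F (Function.update a i y))
    (hG : ∀ a i x y, G (Function.update a i (x + y)) =
      G (Function.update a i x) + G (Function.update a i y))
    (h : ∀ (p : Fin n → ZMod 2) a, (∀ i, π (p i) (a i) = a i) → F a = G a) (a : Fin n → A) :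
    F a = G a := by
  have key : ∀ s : Finset (Fin n), ∀ a, (∀ i, i ∉ s → ∃ e, π e (a i) = a i) → F a = G a := by
    intro s
    induction s using Finset.induction_on with
    | empty =>
      intro a ha
      choose p hp using fun i => ha i (Finset.notMem_empty i)
      exact h p a hp
    | insert i s hi ih =>
      intro a ha
      have h1 : a = Function.update a i (π 0 (a i) + π 1 (a i)) := by
        rw [hπ.sum_proj, Function.update_eq_self]
      have h2 : ∀ e, F (Function.update a i (π e (a i))) = G (Function.update a i (π e (a i))) := by
        intro e
        refine ih _ fun j hj => ?_
        by_cases hji : j = i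
        · subst hji
          exact ⟨e, by simp [hπ.proj_proj]⟩
        · obtain ⟨e', he'⟩ := ha j (by simp [hji, hj])
          exact ⟨e', by simpa [hji] using he'⟩
      rw [h1, hF, hG, h2, h2]
  exact key Finset.univ a (by simp)

end Leading

/-! ### Derived BV structures induce derived Poisson structures -/

section Poisson

variable {A B : Type*} [Ring A] [Algebra K A] [Ring B] [Algebra K B]
  {𝒜 : ℤ → Submodule K A} [GradedAlgebra 𝒜] {ℬ : ℤ → Submodule K B} [GradedAlgebra ℬ]
  {k : ℤ} {Δ : FormalMap K A A} {Δ' : FormalMap K B B} {f : FormalMap K A B}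

theorem koszulBracket_zero (π : ZMod 2 → A →ₗ[K] A) (D : A →ₗ[K] A) (a : Fin 0 → A) :
    koszulBracket π D 0 a = 0 := by
  refine Finset.sum_eq_zero fun p _ => Finset.sum_eq_zero fun I hI => ?_
  obtain ⟨i, -⟩ := (Finset.mem_filter.mp hI).2
  exact i.elim0

theorem cumulant_zero (π : ZMod 2 → A →ₗ[K] A) (f : A →ₗ[K] B) (a : Fin 0 → A) :
    cumulant π f 0 a = 0 :=
  Finset.sum_eq_zero fun p _ => by simp

theorem poissonStructure_eq (Δ : FormalMap K A A) : poissonStructure 𝒜 Δ =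
    leadingFamily (fun n => koszulBracket (seriesParityProj 𝒜) Δ.toPowerSeries n) := by
  funext n a
  cases n with
  | zero => rw [leadingFamily, koszulBracket_zero]; rfl
  | succ n => exact (coeff_koszulBracket_C Δ (n + 1) a n).symm

theorem poissonMorphism_eq (f : FormalMap K A B) : poissonMorphism 𝒜 f =
    leadingFamily (fun n => cumulant (seriesParityProj 𝒜) f.toPowerSeries n) := by
  funext n a
  cases n with
  | zero => rw [leadingFamily, cumulant_zero]; rfl
  | succ n => rfl

theorem IsDerivedBV.isDivisibleFamily (hΔ : IsDerivedBV 𝒜 k Δ) :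
    IsDivisibleFamily (fun n => koszulBracket (seriesParityProj 𝒜) Δ.toPowerSeries n) where
  multilinear := isSeriesMultilinear_koszulBracket Δ
  vanishes n a m hm := hΔ.koszul_mod n (by omega) a m hm

omit [GradedAlgebra ℬ] in
theorem IsDerivedBVMorphism.isDivisibleFamily (hf : IsDerivedBVMorphism 𝒜 ℬ k Δ Δ' f) :
    IsDivisibleFamily (fun n => cumulant (seriesParityProj 𝒜) f.toPowerSeries n) where
  multilinear := isSeriesMultilinear_cumulant f
  vanishes n a m hm := hf.cumulant_mod n (by omega) a m hm

theorem toPowerSeries_one_eq_zero (h : ∀ n, Δ n 1 = 0) : Δ.toPowerSeries 1 = 0 := by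
  ext n
  rw [← map_one (PowerSeries.C (R := A)), FormalMap.coeff_toPowerSeries_C, h]
  simp

theorem intCast_homogeneous {n : ℕ} {d : Fin n → ℤ} {a : Fin n → A} (ha : ∀ i, a i ∈ 𝒜 (d i))
    (i : Fin n) : parityProj 𝒜 (d i : ZMod 2) (a i) = a i := parityProj_cast 𝒜 (ha i)

theorem seriesParityProj_C_eq {e : ZMod 2} {a : A} (h : parityProj 𝒜 e a = a) :
    seriesParityProj 𝒜 e (PowerSeries.C a) = PowerSeries.C a := by
  rw [seriesParityProj_C, h]

theorem parity_differential (hk : Odd k)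
    (hΔ : ∀ n : ℕ, HasDegree 𝒜 𝒜 (1 + n * (k - 1)) (Δ n)) (e : ZMod 2) (r : A⟦X⟧)
    (hr : seriesParityProj 𝒜 e r = r) :
    seriesParityProj 𝒜 (e + 1) (Δ.toPowerSeries r) = Δ.toPowerSeries r := by
  have := seriesParityProj_of_hasFormalDegree hk (d := 1) (F := Δ) hΔ e r hr
  rwa [Int.cast_one] at this

theorem parity_morphism (hk : Odd k)
    (hf : ∀ n : ℕ, HasDegree 𝒜 ℬ (n * (k - 1)) (f n)) (e : ZMod 2) (r : A⟦X⟧)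
    (hr : seriesParityProj 𝒜 e r = r) :
    seriesParityProj ℬ e (f.toPowerSeries r) = f.toPowerSeries r := by
  have := seriesParityProj_of_hasFormalDegree hk (FormalMap.hasFormalDegree_zero.mpr hf) e r hr
  rwa [Int.cast_zero, add_zero] at this

variable [CharZero K]

theorem IsDerivedBV.isTaylorFamily (h𝒜 : IsGradedCommutative 𝒜) (hΔ : IsDerivedBV 𝒜 k Δ) :
    IsTaylorFamily 𝒜 𝒜 k 1 (poissonStructure 𝒜 Δ) where
  zero := rfl
  map_add n a i x y := by
    cases n with
    | zero => exact i.elim0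
    | succ n => exact koszulBracket_update_add _ _ a i x y
  map_smul n a i c x := by
    cases n with
    | zero => exact i.elim0
    | succ n =>
      have := koszulBracket_update_map (K := K) (π := parityProj 𝒜) (D := Δ n)
        (T := c • LinearMap.id) (by simp) (by simp) (by simp) a i x
      simpa [poissonStructure] using this
  degree n d a ha := by
    cases n with
    | zero => exact Submodule.zero_mem _
    | succ n =>
      have := koszulBracket_mem ha (hΔ.degree n)
      simpa [poissonStructure] using this
  symm n d a ha s := by
    cases n with
    | zero => exact (smul_zero _).symm
    | succ n =>
      have hπ := isSuperCommutative_parityProj h𝒜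
      simp only [poissonStructure]
      rw [koszulBracket_eq_signedKoszul hπ _ (intCast_homogeneous ha),
        koszulBracket_eq_signedKoszul hπ _ (p := fun i => ((d (s i) : ℤ) : ZMod 2))
          (a := fun i => a (s i)) (fun i => intCast_homogeneous ha (s i)),
        SetFun.signedKoszul_perm hπ (d := fun i => ((d i : ℤ) : ZMod 2)) (intCast_homogeneous ha)
          (hΔ.map_one n)]

/-- The Jacobi identities are the coefficients of t^(n-1) of those for the brackets of Δ. The
Leibniz rule is `SetFun.koszulBracket_mul` for Δ_n: its correction is a coefficient of t^n in a
bracket with n + 2 arguments, which is divisible by t^(n+1). -/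
theorem IsDerivedBV.isDerivedPoisson (h𝒜 : IsGradedCommutative 𝒜) (hk : Odd k)
    (hΔ : IsDerivedBV 𝒜 k Δ) : IsDerivedPoisson 𝒜 k (poissonStructure 𝒜 Δ) where
  taylor := hΔ.isTaylorFamily h𝒜
  jacobi n d a ha := by
    rw [poissonStructure_eq, ← coeff_compCoder hΔ.isDivisibleFamily hΔ.isDivisibleFamily,
      SetFun.compCoder_koszulBracket_self (isSuperCommutative_seriesParityProj h𝒜)
        (fun i => seriesParityProj_C_eq (intCast_homogeneous ha i))
        (toPowerSeries_one_eq_zero hΔ.map_one) (parity_differential hk hΔ.degree)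
        (fun r => by
          rw [← FormalMap.toPowerSeries_comp, hΔ.square_zero, FormalMap.toPowerSeries_zero]),
      map_zero]
  multiderivation n a i j b c hb hc := by
    have hπ := isSuperCommutative_parityProj h𝒜
    have hsn : ∀ (a : Fin n → A) (l : Fin n) (x y : A),
        (Fin.snoc (Function.update a l x) y : Fin (n + 1) → A) =
          Function.update (Fin.snoc a y : Fin (n + 1) → A) l.castSucc x := fun a l x y =>
      (Fin.snoc_update ..)
    -- The rule is demanded for arbitrary first arguments, whereas `SetFun.koszulBracket_mul`
    -- concerns arguments of definite parity; additivity bridges the gap.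
    refine eq_of_homogeneous hπ (F := fun a => poissonStructure 𝒜 Δ (n + 1) (Fin.snoc a (b * c)))
      (G := fun a => poissonStructure 𝒜 Δ (n + 1) (Fin.snoc a b) * c +
        (Int.negOnePow (i * j) : ℤ) • (poissonStructure 𝒜 Δ (n + 1) (Fin.snoc a c) * b))
      ?_ ?_ (fun p a ha => ?_) a
    · intro a l x y
      simp only [hsn]
      exact (hΔ.isTaylorFamily h𝒜).map_add _ _ _ _ _
    · intro a l x y
      simp only [hsn, (hΔ.isTaylorFamily h𝒜).map_add, add_mul, smul_add]
      abel
    · have h1 := SetFun.koszulBracket_mul hπ ha (parityProj_cast 𝒜 hb) (parityProj_cast 𝒜 hc)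
        (hΔ.map_one n)
      have h2 : koszulBracket (parityProj 𝒜) (Δ n) (n + 2)
          (Fin.snoc (Fin.snoc a b : Fin (n + 1) → A) c) = 0 := by
        rw [← coeff_koszulBracket_C]
        exact hΔ.koszul_mod (n + 2) (by omega) _ n (by omega)
      rw [h2, zero_add, swapSign_cast] at h1
      exact h1

theorem IsDerivedBVMorphism.isTaylorFamily (h𝒜 : IsGradedCommutative 𝒜)
    (hf : IsDerivedBVMorphism 𝒜 ℬ k Δ Δ' f) :
    IsTaylorFamily 𝒜 ℬ k 0 (poissonMorphism 𝒜 f) where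
  zero := rfl
  map_add n a i x y := by
    simp only [poissonMorphism_eq, leadingFamily]
    rw [C_comp_update, map_add, cumulant_update_add, map_add, ← C_comp_update, ← C_comp_update]
  map_smul n a i c x := by
    simp only [poissonMorphism_eq, leadingFamily]
    have := cumulant_update_map (K := K) (π := seriesParityProj 𝒜) (f := f.toPowerSeries)
      (T := c • LinearMap.id) (T' := c • LinearMap.id) (by simp) (by simp) (by simp) (by simp)
      (fun j => PowerSeries.C (a j)) i (PowerSeries.C x)
    simp only [LinearMap.smul_apply, LinearMap.id_apply] at this
    rw [C_comp_update, C_smul_field, this, coeff_smul_field, ← C_comp_update]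
  degree n d a ha := by
    cases n with
    | zero => exact Submodule.zero_mem _
    | succ n =>
      have := coeff_cumulant_mem ha (FormalMap.hasFormalDegree_zero.mpr hf.degree) n
      simpa [poissonMorphism] using this
  symm n d a ha s := by
    have hπ := isSuperCommutative_seriesParityProj h𝒜
    have ha' := fun i => seriesParityProj_C_eq (intCast_homogeneous ha i)
    simp only [poissonMorphism_eq, leadingFamily]
    rw [cumulant_eq_signedCumulant hπ _ ha',
      cumulant_eq_signedCumulant hπ _ (p := fun i => ((d (s i) : ℤ) : ZMod 2))
        (a := fun i => PowerSeries.C (a (s i))) (fun i => ha' (s i)),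
      SetFun.signedCumulant_perm hπ (d := fun i => ((d i : ℤ) : ZMod 2))
        (a := fun i => PowerSeries.C (a i)) ha' hf.map_one, map_zsmul]

theorem exists_inverse_cumulant {n : ℕ} {p : Fin n → ZMod 2} {F : A →ₗ[K] B} (hF : F 1 = 1)
    (a : Fin n → A) : ∃ gi : SetFun p B,
      SetFun.map p F (nilExp K (SetFun.gen a)) * gi = 1 := by
  have hgn : IsNilpotent (SetFun.map p F (nilExp K (SetFun.gen a : SetFun p A)) - 1) :=
    SetFun.isNilpotent (SetFun.map_apply_empty_eq_one hF
      (SetFun.nilExp_apply_empty (SetFun.gen_apply_empty a)))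
  have h := nilExp_mul_nilExp_neg (K := K) (isNilpotent_nilLog (K := K) hgn)
  rw [nilExp_nilLog hgn] at h
  exact ⟨_, h⟩

/-- Both compositions have generating functions with the common factor f(e^x)^(-1), and f Δ = Δ' f
equates the other factors. The product rule is the coefficient of t^n in `SetFun.cumulant_mul`, in
which the cumulant with n + 2 arguments has dropped out. -/
theorem IsDerivedBVMorphism.isDerivedPoissonMorphism (h𝒜 : IsGradedCommutative 𝒜)
    (hℬ : IsGradedCommutative ℬ) (hk : Odd k) (hΔ : IsDerivedBV 𝒜 k Δ) (hΔ' : IsDerivedBV ℬ k Δ')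
    (hf : IsDerivedBVMorphism 𝒜 ℬ k Δ Δ' f) :
    IsDerivedPoissonMorphism 𝒜 ℬ k (poissonStructure 𝒜 Δ) (poissonStructure ℬ Δ')
      (poissonMorphism 𝒜 f) where
  taylor := hf.isTaylorFamily h𝒜
  commutes n d a ha := by
    have hπ := isSuperCommutative_seriesParityProj h𝒜
    have hπ' := isSuperCommutative_seriesParityProj hℬ
    have ha' := fun i => seriesParityProj_C_eq (intCast_homogeneous ha i)
    rw [poissonStructure_eq, poissonStructure_eq, poissonMorphism_eq,
      ← coeff_compCoder hf.isDivisibleFamily hΔ.isDivisibleFamily,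
      ← coeff_compMorphism_family hΔ'.isDivisibleFamily hf.isDivisibleFamily]
    obtain ⟨gi, hgi⟩ := exists_inverse_cumulant (p := fun i => ((d i : ℤ) : ZMod 2)) hf.map_one
      (fun i => PowerSeries.C (a i))
    rw [SetFun.compCoder_cumulant_koszulBracket hπ hπ' ha' hf.map_one (parity_morphism hk hf.degree)
        (toPowerSeries_one_eq_zero hΔ.map_one) (parity_differential hk hΔ.degree) hgi,
      SetFun.compMorphism_koszulBracket_cumulant hπ hπ' ha' hf.map_one
        (parity_morphism hk hf.degree) (toPowerSeries_one_eq_zero hΔ'.map_one) hgi]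
    congr 3
    ext T
    simp only [SetFun.map_apply]
    rw [← FormalMap.toPowerSeries_comp, hf.commutes, FormalMap.toPowerSeries_comp]
  multiplicative n d a i j b c ha hb hc := by
    have hπ := isSuperCommutative_seriesParityProj h𝒜
    have hπ' := isSuperCommutative_seriesParityProj hℬ
    have ha' := fun i => seriesParityProj_C_eq (intCast_homogeneous ha i)
    have h1 := SetFun.cumulant_mul hπ ha' (seriesParityProj_C_eq (parityProj_cast 𝒜 hb))
      (seriesParityProj_C_eq (parityProj_cast 𝒜 hc)) hπ' hf.map_one (parity_morphism hk hf.degree)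
    have h2 := congrArg (PowerSeries.coeff n) h1
    rw [map_add, ← C_comp_snoc, ← C_comp_snoc, hf.cumulant_mod (n + 2) (by omega) _ n (by omega),
      zero_add, map_sum, ← map_mul, ← C_comp_snoc] at h2
    refine h2.trans (Finset.sum_congr rfl fun I _ => ?_)
    rw [map_zsmul]
    congr 1
    have hcard : n = I.card + Iᶜ.card := by
      rw [Finset.card_compl, Fintype.card_fin]
      have := Finset.card_le_univ I
      rw [Fintype.card_fin] at this
      omega
    have hr : ∀ (J : Finset (Fin n)) (x : A),
        (Fin.snoc (restrict J fun l => PowerSeries.C (a l)) (PowerSeries.C x) :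
          Fin (J.card + 1) → A⟦X⟧) =
        fun l => PowerSeries.C ((Fin.snoc (restrict J a) x : Fin (J.card + 1) → A) l) :=
      fun J x => (C_comp_snoc _ _).symm
    rw [hr, hr]
    -- The two cumulants are divisible by t^|I| and t^|Iᶜ|, exponents with sum n, so only the
    -- product of their leading coefficients contributes.
    have h3 := VanishesBelow.coeff_mul (hf.isDivisibleFamily.vanishes (I.card + 1)
      (Fin.snoc (restrict I a) b)) (hf.isDivisibleFamily.vanishes (Iᶜ.card + 1)
      (Fin.snoc (restrict Iᶜ a) c))
    rwa [show I.card + 1 - 1 + (Iᶜ.card + 1 - 1) = n from by omega] at h3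

end Poisson

end

end DerivedBV

/-! ### The identity for the logarithm of the perturbed inclusion. -/

namespace DerivedBV

noncomputable section

variable {K : Type*} [Field K]

section NilLog

variable {E : Type*} [Ring E] [Algebra K E]

theorem nilLog_eq_sum {g : E} {N : ℕ} (h : (g - 1) ^ (N + 1) = 0) :
    nilLog K g = ∑ i ∈ Finset.range N, ((-1 : K) ^ i / ((i + 1 : ℕ) : K)) • (g - 1) ^ (i + 1) := by
  rw [nilLog, nilSeries_eq_sum _ h, Finset.sum_range_succ']
  simp

end NilLog

namespace SetFun

/-! ### Homotopy transfer for set functions -/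

section Transfer

variable {n : ℕ} {p : Fin n → ZMod 2} {R : Type*} [Ring R] [Algebra K R]
variable {R' : Type*} [Ring R'] [Algebra K R']
variable {π : ZMod 2 → R →ₗ[K] R} {π' : ZMod 2 → R' →ₗ[K] R'}

/-- Writing the differentiated factor first in both summands absorbs all Koszul signs, so the odd
derivation obeys an unsigned Leibniz rule on even elements, and hence the usual power rule. -/
theorem map_derivation (hπ : IsSuperCommutative π) {d : R →ₗ[K] R}
    (hd : ∀ e a b, π e a = a → d (a * b) = d a * b + swapSign e 1 • (a * d b))
    (hdo : ∀ e a, π e a = a → π (e + 1) (d a) = d a) {α β : SetFun p R} (hα : IsEven π α)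
    (hβ : IsEven π β) : map p d (α * β) = map p d α * β + map p d β * α := by
  ext S
  rw [map_apply, add_apply, mul_apply, mul_apply, mul_apply, map_sum,
    Finset.sum_comm (f := fun T U => if Disjoint T U ∧ T ∪ U = S then
      crossSign p T U • ((map p d β) T * α U) else 0), ← Finset.sum_add_distrib]
  refine Finset.sum_congr rfl fun T _ => ?_
  rw [map_sum, ← Finset.sum_add_distrib]
  refine Finset.sum_congr rfl fun U _ => ?_
  by_cases h : Disjoint T U ∧ T ∪ U = S
  · rw [if_pos h, if_pos h, if_pos ⟨h.1.symm, (Finset.union_comm U T).trans h.2⟩, map_zsmul,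
      hd _ _ _ (hα T), smul_add, map_apply, map_apply,
      hπ.comm _ _ _ _ (hdo _ _ (hβ U)) (hα T), smul_smul, smul_smul]
    congr 2
    have h1 := crossSign_mul_swap p h.1
    have h2 := crossSign_mul_self p U T
    have h3 := swapSign_mul_self (∑ i ∈ U, p i) (∑ i ∈ T, p i)
    rw [swapSign_comm] at h1
    rw [swapSign_add_left, swapSign_comm 1, ← h1]
    linear_combination (-(crossSign p T U * swapSign (∑ i ∈ T, p i) 1)) * h2
  · rw [if_neg h, if_neg h, if_neg fun h' => h ⟨h'.1.symm, (Finset.union_comm T U).trans h'.2⟩,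
      map_zero, add_zero]

theorem map_pow_derivation (hπ : IsSuperCommutative π) {d : R →ₗ[K] R}
    (hd : ∀ e a b, π e a = a → d (a * b) = d a * b + swapSign e 1 • (a * d b))
    (hdo : ∀ e a, π e a = a → π (e + 1) (d a) = d a) {α : SetFun p R} (hα : IsEven π α) (r : ℕ) :
    map p d (α ^ (r + 1)) = ((r + 1 : ℕ) : K) • (map p d α * α ^ r) := by
  induction r with
  | zero => simp
  | succ r ih =>
    rw [pow_succ' α (r + 1), map_derivation hπ hd hdo hα (hα.pow hπ _), ih, smul_mul_assoc,
      mul_assoc, ← pow_succ]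
    push_cast
    module

theorem map_mul_eq_zero {H : R →ₗ[K] R} (hH : ∀ a b, H a = 0 → H b = 0 → H (a * b) = 0)
    {α β : SetFun p R} (hα : map p H α = 0) (hβ : map p H β = 0) : map p H (α * β) = 0 := by
  ext S
  rw [map_apply, mul_apply, map_sum]
  refine Finset.sum_eq_zero fun T _ => ?_
  rw [map_sum]
  refine Finset.sum_eq_zero fun U _ => ?_
  split_ifs
  · rw [map_zsmul, hH _ _ (congrArg (fun γ : SetFun p R => γ T) hα)
      (congrArg (fun γ : SetFun p R => γ U) hβ), smul_zero]
  · exact map_zero _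

theorem map_mul_of_ker {H : R →ₗ[K] R} {s : R →ₗ[K] R'}
    (hs : ∀ a b, H a = 0 → H b = 0 → s (a * b) = s a * s b)
    {α β : SetFun p R} (hα : map p H α = 0) (hβ : map p H β = 0) :
    map p s (α * β) = map p s α * map p s β := by
  ext S
  rw [map_apply, mul_apply, mul_apply, map_sum]
  refine Finset.sum_congr rfl fun T _ => ?_
  rw [map_sum]
  refine Finset.sum_congr rfl fun U _ => ?_
  split_ifs
  · rw [map_zsmul, hs _ _ (congrArg (fun γ : SetFun p R => γ T) hα)
      (congrArg (fun γ : SetFun p R => γ U) hβ)]; rfl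
  · exact map_zero _

/-- The perturbed inclusion and the perturbed differential of a contraction, with the properties
that determine their cumulants and Koszul brackets. -/
structure IsPerturbedContraction (π : ZMod 2 → R →ₗ[K] R) (π' : ZMod 2 → R' →ₗ[K] R')
    (d δ H : R →ₗ[K] R) (dB D' : R' →ₗ[K] R') (s : R →ₗ[K] R') (t T : R' →ₗ[K] R) : Prop where
  d_one : d 1 = 0
  d_mul : ∀ e a b, π e a = a → d (a * b) = d a * b + swapSign e 1 • (a * d b)
  d_odd : ∀ e a, π e a = a → π (e + 1) (d a) = d a
  T_one : T 1 = 1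
  T_even : ∀ e y, π' e y = y → π e (T y) = T y
  H_T : ∀ y, H (T y) = 0
  s_T : ∀ y, s (T y) = y
  d_T : ∀ y, d (T y) = T (D' y) - δ (T y)
  H_d : ∀ a, H a = 0 → a = t (s a) - H (d a)
  s_d : ∀ a, s (d a) = dB (s a)
  H_mul : ∀ a b, H a = 0 → H b = 0 → H (a * b) = 0
  s_mul : ∀ a b, H a = 0 → H b = 0 → s (a * b) = s a * s b

variable [CharZero K] {d δ H : R →ₗ[K] R} {dB D' : R' →ₗ[K] R'} {s : R →ₗ[K] R'}
  {t T : R' →ₗ[K] R}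

/-- Let c = T(e^x) and u = c − 1. Since ker H is closed under products, all powers of u lie in it
and are reconstructed from their images under s and H d. As d is a derivation, the logarithmic
series then gives the first formula; applying s d to it termwise gives the second. -/
theorem perturbed_eq (hπ : IsSuperCommutative π) (hπ' : IsSuperCommutative π')
    (hP : IsPerturbedContraction π π' d δ H dB D' s t T)
    {x : SetFun p R'} (hx : IsEven π' x) (hx0 : x ∅ = 0) :
    nilLog K (map p T (nilExp K x)) = map p t x +
        map p H (map p δ (map p T (nilExp K x)) * nilExp K (-nilLog K (map p T (nilExp K x)))) ∧
      map p D' (nilExp K x) * nilExp K (-x) = map p dB x +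
        map p s (map p δ (map p T (nilExp K x)) * nilExp K (-nilLog K (map p T (nilExp K x)))) := by
  set E := nilExp K x with hE
  set c := map p T E with hc
  have hEe : IsEven π' E := hx.nilExp hπ'
  have hce : IsEven π c := hEe.map hP.T_even
  have hxn : IsNilpotent x := isNilpotent hx0
  have hc0 : (c - 1) ∅ = 0 := map_apply_empty_eq_one hP.T_one (nilExp_apply_empty hx0)
  have hE0 : (E - 1) ∅ = 0 := by
    rw [sub_apply, hE, nilExp_apply_empty hx0, one_apply_empty, sub_self]
  set u := c - 1 with hu
  have hue : IsEven π u := hce.sub (IsEven.one hπ)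
  have hun : u ^ (n + 1) = 0 := pow_eq_zero hc0
  have hun' : u ^ (n + 1 + 1) = 0 := by rw [pow_succ, hun, zero_mul]
  have hEn : (E - 1) ^ (n + 1 + 1) = 0 := by rw [pow_succ, pow_eq_zero hE0, zero_mul]
  have hunil : IsNilpotent (c - 1) := ⟨_, hun⟩
  set L := nilLog K c with hL
  have hLn : IsNilpotent L := isNilpotent_nilLog hunil
  set ci := nilExp K (-L) with hci
  have hcc : c * ci = 1 := by
    have := nilExp_mul_nilExp_neg (K := K) hLn
    rwa [hL, nilExp_nilLog hunil] at this
  have hEE : E * nilExp K (-x) = 1 := nilExp_mul_nilExp_neg hxn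
  have hEE' : nilExp K (-x) * E = 1 := nilExp_neg_mul_nilExp hxn
  have hH1 : map p H (1 : SetFun p R) = 0 := by
    rw [one_def, map_single, ← hP.T_one, hP.H_T, single_zero]
  have hs1 : map p s (1 : SetFun p R) = 1 := map_one (by rw [← hP.T_one, hP.s_T])
  have hHT : ∀ α : SetFun p R', map p H (map p T α) = 0 := fun α => by ext S; simp [hP.H_T]
  have hsT : ∀ α : SetFun p R', map p s (map p T α) = α := fun α => by ext S; simp [hP.s_T]
  have hHu : map p H u = 0 := by rw [hu, map_sub, hH1, hc, hHT, sub_zero]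
  have hsu : map p s u = E - 1 := by rw [hu, map_sub, hs1, hc, hsT]
  have hHpow : ∀ r, map p H (u ^ r) = 0 := fun r => by
    induction r with
    | zero => rw [pow_zero, hH1]
    | succ r ih => rw [pow_succ]; exact map_mul_eq_zero hP.H_mul ih hHu
  have hspow : ∀ r, map p s (u ^ r) = (E - 1) ^ r := fun r => by
    induction r with
    | zero => rw [pow_zero, pow_zero, hs1]
    | succ r ih => rw [pow_succ, map_mul_of_ker hP.s_mul (hHpow r) hHu, ih, hsu, pow_succ]
  have hdu : map p d u = map p T (map p D' E) - map p δ c := by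
    rw [hu, map_sub, map_one_eq_zero hP.d_one, sub_zero]
    ext S
    simp [hc, hP.d_T]
  have hdpow := map_pow_derivation hπ hP.d_mul hP.d_odd hue
  -- In du = T(D'(e^x)) − δ(c) the first summand stays in ker H after multiplication by powers of u,
  -- so H kills it. Only the δ-part survives, with the factor r + 1 from the power rule.
  have hpow : ∀ r, u ^ (r + 1) = map p t ((E - 1) ^ (r + 1)) +
      ((r + 1 : ℕ) : K) • map p H (map p δ c * u ^ r) := fun r => by
    have h1 : u ^ (r + 1) = map p t (map p s (u ^ (r + 1))) - map p H (map p d (u ^ (r + 1))) := by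
      ext S
      exact hP.H_d _ (congrArg (fun γ : SetFun p R => γ S) (hHpow (r + 1)))
    have h2 : map p H (map p T (map p D' E) * u ^ r) = 0 :=
      map_mul_eq_zero hP.H_mul (hHT _) (hHpow r)
    rw [h1, hspow, hdpow, hdu, sub_mul, map_smul, map_sub, h2, zero_sub, smul_neg, sub_neg_eq_add]
  have hcisum := sum_log_derivative (K := K) hcc hun
  have hLsum : L = ∑ i ∈ Finset.range (n + 1), ((-1 : K) ^ i / ((i + 1 : ℕ) : K)) • u ^ (i + 1) :=
    nilLog_eq_sum hun'
  have hxsum : x = ∑ i ∈ Finset.range (n + 1),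
      ((-1 : K) ^ i / ((i + 1 : ℕ) : K)) • (E - 1) ^ (i + 1) := by
    rw [← nilLog_eq_sum hEn, nilLog_nilExp hxn]
  -- Summation with the coefficients of the logarithm: the factors r + 1 turn the logarithmic series
  -- in u into the series of c^(-1).
  have hLeq : L = map p t x + map p H (map p δ c * ci) := by
    rw [← hcisum]
    conv_lhs => rw [hLsum]
    conv_rhs => rw [hxsum]
    rw [map_sum, Finset.mul_sum, map_sum, ← Finset.sum_add_distrib]
    refine Finset.sum_congr rfl fun i _ => ?_
    rw [hpow, smul_add, smul_smul, map_smul, mul_smul_comm, map_smul]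
  refine ⟨hLeq, ?_⟩
  have hsL : map p s L = x := by
    rw [hLsum, map_sum]
    conv_rhs => rw [hxsum]
    exact Finset.sum_congr rfl fun i _ => by rw [map_smul, hspow]
  have hdL : map p d L = map p d u * ci := by
    rw [← hcisum, Finset.mul_sum]
    conv_lhs => rw [hLsum]
    rw [map_sum]
    exact Finset.sum_congr rfl fun i _ => by rw [map_smul, hdpow, mul_smul_comm, smul_smul]
  have hHci : map p H ci = 0 := by
    rw [← hcisum, map_sum]
    exact Finset.sum_eq_zero fun i _ => by rw [map_smul]; erw [hHpow i]; rw [smul_zero]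
  have hsci : map p s ci = nilExp K (-x) := by
    have h1 := map_mul_of_ker hP.s_mul (hHT E) hHci
    rw [← hc, hcc, hs1, hc, hsT] at h1
    rw [← one_mul (map p s ci), ← hEE', mul_assoc, ← h1, mul_one]
  -- On one side s d L = dB s L = dB x. On the other dL = (T(D'(e^x)) − δ(c)) c^(-1), and
  -- multiplicativity of s on ker H turns the first part into D'(e^x) e^(-x).
  have h1 : map p s (map p d L) = map p dB x := by
    rw [← hsL]; ext S; simp [hP.s_d]
  rw [hdL, hdu, sub_mul, map_sub, map_mul_of_ker hP.s_mul (hHT _) hHci, hsT, hsci] at h1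
  rw [← h1, sub_add_cancel]

end Transfer

end SetFun

end

end DerivedBV

/-! ### The kernel of a semifull homotopy as a subalgebra. -/

namespace DerivedBV

noncomputable section

variable {K : Type*} [Field K]

/-! ### Semifull contractions -/

section Semifull

variable {A B : Type*} [Ring A] [Algebra K A] [Ring B] [Algebra K B]
  {𝒜 : ℤ → Submodule K A} [GradedAlgebra 𝒜] {ℬ : ℤ → Submodule K B} [GradedAlgebra ℬ]
  {d : A →ₗ[K] A} {dB : B →ₗ[K] B} {σ : A →ₗ[K] B} {τ : B →ₗ[K] A} {h : A →ₗ[K] A}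

omit [GradedAlgebra 𝒜] [GradedAlgebra ℬ] in
theorem IsContraction.eq_of_ker (hc : IsContraction 𝒜 ℬ d dB σ τ h) {a : A} (ha : h a = 0) :
    a = τ (σ a) - h (d a) := by
  have := LinearMap.congr_fun hc.homotopy a
  simp only [LinearMap.add_apply, LinearMap.sub_apply, LinearMap.comp_apply, LinearMap.id_apply,
    ha, map_zero, add_zero] at this
  rw [this, sub_sub_cancel]

/-- The axioms treat the factors in the order h(a) τ(x) only; graded commutativity on homogeneous
elements gives the other order. -/
theorem map_mul_comm_eq_zero (h𝒜 : IsGradedCommutative 𝒜) (hc : IsContraction 𝒜 ℬ d dB σ τ h)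
    {M : Type*} [AddCommGroup M] [Module K M] {F : A →ₗ[K] M}
    (hF : ∀ (a : A) (x : B), F (h a * τ x) = 0) (x : B) (a : A) : F (τ x * h a) = 0 := by
  induction a using DirectSum.Decomposition.inductionOn 𝒜 with
  | zero => simp
  | add a a' h1 h2 => rw [map_add, mul_add, map_add, h1, h2, add_zero]
  | @homogeneous i a =>
    induction x using DirectSum.Decomposition.inductionOn ℬ with
    | zero => simp
    | add a a' h1 h2 => rw [map_add, add_mul, map_add, h1, h2, add_zero]
    | @homogeneous j x =>
      rw [h𝒜 _ _ _ _ (hc.degree_τ _ _ x.2) (hc.degree_h _ _ a.2), map_zsmul, hF, smul_zero]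

namespace IsSemifullDGContraction

/-- Elements of ker h have the form τ(y) − h(b). The semifull axioms say precisely how h and σ act
on products of such elements: h kills them all, and σ retains only the product of the τ-parts. -/
theorem map_mul_ker (h𝒜 : IsGradedCommutative 𝒜) (hc : IsSemifullDGContraction 𝒜 ℬ d dB σ τ h)
    {a b : A} (ha : h a = 0) (hb : h b = 0) : h (a * b) = 0 ∧ σ (a * b) = σ a * σ b := by
  have h1 := map_mul_comm_eq_zero h𝒜 hc.toIsContraction hc.h_hτ
  have h2 := map_mul_comm_eq_zero h𝒜 hc.toIsContraction hc.σ_hτ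
  have h3 : a * b = (τ (σ a) - h (d a)) * (τ (σ b) - h (d b)) := by
    rw [← hc.eq_of_ker ha, ← hc.eq_of_ker hb]
  rw [h3, sub_mul, mul_sub, mul_sub]
  constructor
  · simp only [map_sub, hc.h_ττ, hc.h_hτ, hc.h_hh, h1, sub_zero]
  · simp only [map_sub, hc.σ_ττ, hc.σ_hτ, hc.σ_hh, h2, sub_zero]

omit [GradedAlgebra 𝒜] [GradedAlgebra ℬ] in
theorem τ_one (hc : IsSemifullDGContraction 𝒜 ℬ d dB σ τ h) : τ 1 = 1 := by
  have := hc.eq_of_ker hc.h_one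
  rw [hc.dA_one, map_zero, sub_zero, hc.σ_one] at this
  exact this.symm

end IsSemifullDGContraction

theorem IsGradedDerivation.map_mul_parity (hd : IsGradedDerivation 𝒜 d) {e : ZMod 2} {a : A}
    (ha : parityProj 𝒜 e a = a) (b : A) : d (a * b) = d a * b + swapSign e 1 • (a * d b) := by
  rw [← ha]
  clear ha
  induction a using DirectSum.Decomposition.inductionOn 𝒜 with
  | zero => simp
  | add a a' h1 h2 =>
    rw [map_add, add_mul, map_add, h1, h2, map_add, add_mul, add_mul, smul_add]; abel
  | @homogeneous i a =>
    rw [parityProj_of_mem 𝒜 a.2]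
    split_ifs with he
    · have := swapSign_cast i 1
      rw [Int.cast_one, he, mul_one] at this
      rw [hd i _ _ a.2, this]
    · simp

end Semifull

-- From T = τ + hΔ₊T and the side conditions, T takes values in ker h and is a section of σ; it
-- preserves 1 because τ does and Δ₊(1) = 0. The remaining properties hold coefficientwise or are
-- part of the perturbation lemma.
open FormalMap in
theorem isPerturbedContraction_perturbed {A B : Type*} [Ring A] [Algebra K A] [Ring B]
    [Algebra K B] {𝒜 : ℤ → Submodule K A} [GradedAlgebra 𝒜] {ℬ : ℤ → Submodule K B}
    [GradedAlgebra ℬ] (h𝒜 : IsGradedCommutative 𝒜) {k : ℤ} (hk : Odd k) {Δ : FormalMap K A A}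
    (hΔ : IsDerivedBV 𝒜 k Δ) {dB : B →ₗ[K] B} {σ : A →ₗ[K] B} {τ : B →ₗ[K] A} {h : A →ₗ[K] A}
    (hc : IsSemifullDGContraction 𝒜 ℬ (Δ 0) dB σ τ h) :
    SetFun.IsPerturbedContraction (seriesParityProj 𝒜) (seriesParityProj ℬ)
      (const (Δ 0)).toPowerSeries (plus Δ).toPowerSeries (const h).toPowerSeries
      (const dB).toPowerSeries (perturbedDifferential Δ dB σ τ h).toPowerSeries
      (const σ).toPowerSeries (const τ).toPowerSeries (perturbedInclusion Δ τ h).toPowerSeries := by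
  have hF := isFormalContraction_perturbed hΔ.degree hΔ.square_zero hc.toIsContraction
  have hT : ∀ y, (perturbedInclusion Δ τ h).toPowerSeries y = (const τ).toPowerSeries y +
      (const h).toPowerSeries ((plus Δ).toPowerSeries
        ((perturbedInclusion Δ τ h).toPowerSeries y)) := fun y => by
    rw [perturbedInclusion_eq, toPowerSeries_comp]
    exact leftResolvent_apply _
  have hker : ∀ {y : A⟦X⟧}, (const h).toPowerSeries y = 0 → ∀ n, h (PowerSeries.coeff n y) = 0 :=
    fun hy n => by rw [← coeff_toPowerSeries_const, hy, map_zero]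
  have hδ1 : (plus Δ).toPowerSeries (1 : A⟦X⟧) = 0 := toPowerSeries_one_eq_zero fun n => by
    rw [plus]; split_ifs
    · rfl
    · exact hΔ.map_one n
  refine ⟨?_, ?_, ?_, ?_, ?_, ?_, ?_, ?_, ?_, ?_, ?_, ?_⟩
  · refine toPowerSeries_one_eq_zero fun n => ?_
    rw [const]; split_ifs
    · exact hc.dA_one
    · rfl
  · intro e a b ha
    rw [seriesParityProj_eq_iff] at ha
    ext n
    simp only [map_add, map_zsmul, coeff_toPowerSeries_const, PowerSeries.coeff_mul, map_sum,
      Finset.smul_sum]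
    rw [← Finset.sum_add_distrib]
    exact Finset.sum_congr rfl fun ij _ => hc.derivation.map_mul_parity (ha _) _
  · intro e a ha
    have := seriesParityProj_of_hasFormalDegree hk (HasFormalDegree.const hc.degree_dA) e a ha
    rwa [Int.cast_one] at this
  · rw [perturbedInclusion_eq, toPowerSeries_comp, ← map_one (PowerSeries.C (R := B)),
      toPowerSeries_const_C, hc.τ_one, map_one, leftResolvent_apply', hδ1, map_zero, map_zero,
      add_zero]
  · exact parity_morphism hk hF.degree_u
  · intro y
    rw [hT]
    ext n
    simp only [map_add, coeff_toPowerSeries_const, map_zero]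
    have h1 := LinearMap.congr_fun hc.h_τ (PowerSeries.coeff n y)
    have h2 := LinearMap.congr_fun hc.h_h (PowerSeries.coeff n ((plus Δ).toPowerSeries
        ((perturbedInclusion Δ τ h).toPowerSeries y)))
    simp only [LinearMap.comp_apply, LinearMap.zero_apply] at h1 h2
    rw [h1, h2, add_zero]
  · intro y
    rw [hT]
    ext n
    simp only [map_add, coeff_toPowerSeries_const]
    have h1 := LinearMap.congr_fun hc.σ_τ (PowerSeries.coeff n y)
    have h2 := LinearMap.congr_fun hc.σ_h (PowerSeries.coeff n ((plus Δ).toPowerSeries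
        ((perturbedInclusion Δ τ h).toPowerSeries y)))
    simp only [LinearMap.comp_apply, LinearMap.zero_apply, LinearMap.id_apply] at h1 h2
    rw [h1, h2, add_zero]
  · intro y
    rw [← toPowerSeries_comp _ (perturbedDifferential Δ dB σ τ h), ← hF.D_u, toPowerSeries_comp,
      toPowerSeries_plus Δ, add_sub_cancel_right]
  · intro a ha
    ext n
    simp only [map_sub, coeff_toPowerSeries_const]
    exact hc.eq_of_ker (hker ha n)
  · intro a
    ext n
    simp only [coeff_toPowerSeries_const]
    exact LinearMap.congr_fun hc.σ_dA _
  · intro a b ha hb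
    ext n
    simp only [coeff_toPowerSeries_const, PowerSeries.coeff_mul, map_sum, map_zero]
    exact Finset.sum_eq_zero fun ij _ => (hc.map_mul_ker h𝒜 (hker ha _) (hker hb _)).1
  · intro a b ha hb
    ext n
    simp only [coeff_toPowerSeries_const, PowerSeries.coeff_mul, map_sum]
    exact Finset.sum_congr rfl fun ij _ => (hc.map_mul_ker h𝒜 (hker ha _) (hker hb _)).2

end

end DerivedBV

/-! ### The recursion satisfied by the cumulants, ordered by powers of t. -/

namespace DerivedBV

noncomputable section

variable {K : Type*} [Field K]

/-! ### Recursion for brackets and cumulants -/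

section Decompose

variable {n : ℕ} {R S : Type*} [Ring R] [Algebra K R] [Ring S] [Algebra K S]
  {π : ZMod 2 → R →ₗ[K] R}

theorem cumulant_eq_sum_proj (hπ : IsSuperCommutative π) (f : R →ₗ[K] S) (a : Fin n → R) :
    cumulant π f n a = ∑ p : Fin n → ZMod 2, cumulant π f n fun i => π (p i) (a i) := by
  rw [cumulant_eq_sum]
  exact Finset.sum_congr rfl fun p _ =>
    (cumulant_eq_signedCumulant hπ f fun i => hπ.proj_proj _ _).symm

theorem koszulBracket_eq_sum_proj (hπ : IsSuperCommutative π) (D : R →ₗ[K] R) (a : Fin n → R) :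
    koszulBracket π D n a = ∑ p : Fin n → ZMod 2, koszulBracket π D n fun i => π (p i) (a i) := by
  rw [koszulBracket_eq_sum]
  exact Finset.sum_congr rfl fun p _ =>
    (koszulBracket_eq_signedKoszul hπ D fun i => hπ.proj_proj _ _).symm

end Decompose

section Recursion

variable {A B : Type*} [Ring A] [Algebra K A] [Ring B] [Algebra K B]

theorem sum_Icc_one_add_two {M : Type*} [AddCommMonoid M] (f : ℕ → M) (n : ℕ) :
    ∑ k ∈ Finset.Icc 1 (n + 2), f k = f 1 + ∑ m ∈ Finset.range (n + 1), f (m + 2) := by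
  rw [show Finset.Icc 1 (n + 2) = Finset.Ico 1 (n + 3) from rfl, Finset.sum_Ico_eq_sum_range,
    show n + 3 - 1 = n + 1 + 1 from rfl, Finset.sum_range_succ', add_comm]
  congr 1
  exact Finset.sum_congr rfl fun m _ => congrArg f (by omega)

theorem SetFun.gen_apply_univ {n : ℕ} {p : Fin (n + 2) → ZMod 2} (a : Fin (n + 2) → A) :
    (SetFun.gen a : SetFun p A) Finset.univ = 0 := by
  rw [SetFun.gen, SetFun.famGen, SetFun.sum_apply]
  refine Finset.sum_eq_zero fun i _ => ?_
  rw [SetFun.single_apply, if_neg]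
  intro h
  have := congrArg Finset.card h
  simp at this

theorem VanishesBelow.add {N : ℕ} {x y : A⟦X⟧} (hx : VanishesBelow N x) (hy : VanishesBelow N y) :
    VanishesBelow N (x + y) := fun m hm => by rw [map_add, hx m hm, hy m hm, add_zero]

theorem VanishesBelow.sum {ι : Type*} {N : ℕ} {s : Finset ι} {x : ι → A⟦X⟧}
    (hx : ∀ i ∈ s, VanishesBelow N (x i)) : VanishesBelow N (∑ i ∈ s, x i) := fun m hm => by
  rw [map_sum]; exact Finset.sum_eq_zero fun i hi => hx i hi m hm

theorem VanishesBelow.zsmul {N : ℕ} {x : A⟦X⟧} (hx : VanishesBelow N x) (c : ℤ) :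
    VanishesBelow N (c • x) := fun m hm => by rw [map_zsmul, hx m hm, smul_zero]

theorem VanishesBelow.smul {N : ℕ} {x : A⟦X⟧} (hx : VanishesBelow N x) (c : K) :
    VanishesBelow N (c • x) := fun m hm => by rw [coeff_smul_field, hx m hm, smul_zero]

theorem VanishesBelow.mono {N M : ℕ} (h : M ≤ N) {x : A⟦X⟧} (hx : VanishesBelow N x) :
    VanishesBelow M x := fun m hm => hx m (by omega)

theorem VanishesBelow.map_const {N : ℕ} {x : A⟦X⟧} (hx : VanishesBelow N x) (f : A →ₗ[K] B) :
    VanishesBelow N ((FormalMap.const f).toPowerSeries x) := fun m hm => by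
  rw [FormalMap.coeff_toPowerSeries_const, hx m hm, map_zero]

/-- The unary term is separated from those with at least two blocks. The latter involve only shorter
tuples and start at t^(n+1) with an explicit coefficient. The former contains the full tuple, but
the extra divisibility of Q 1 by t improves its order from N to N + 1. -/
theorem compMorphism_add_two {M : Type*} {Q : (n : ℕ) → (Fin n → A⟦X⟧) → A⟦X⟧}
    (hQ : ∀ n, IsSeriesMultilinear (Q n))
    (hQ' : ∀ n (a : Fin n → A), VanishesBelow (n - 1) (Q n fun i => PowerSeries.C (a i)))
    (hQ1 : ∀ a : Fin 1 → A, VanishesBelow 1 (Q 1 fun i => PowerSeries.C (a i)))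
    {F : (n : ℕ) → (Fin n → M) → A⟦X⟧} {n : ℕ} {p : Fin (n + 2) → ZMod 2}
    {x : Fin (n + 2) → M} {N : ℕ}
    (hF : ∀ I : Finset (Fin (n + 2)), I.card < n + 2 → VanishesBelow (I.card - 1)
      (F I.card (restrict I x)))
    (hF' : ∀ I : Finset (Fin (n + 2)), I.card = n + 2 → VanishesBelow N (F I.card (restrict I x))) :
    ∃ u v : A⟦X⟧, compMorphism (K := K) Q F (n + 2) p x = u + v ∧ VanishesBelow (N + 1) u ∧
      VanishesBelow (n + 1) v ∧ PowerSeries.coeff (n + 1) v =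
        ∑ m ∈ Finset.range (n + 1), (1 / ((m + 2).factorial : K)) •
          ∑ φ : {φ : Fin (n + 2) → Fin (m + 2) // Function.Surjective φ}, koszulSign p φ.1 •
            leadingFamily Q (m + 2) (fun j => PowerSeries.coeff ((block φ.1 j).card - 1)
              (F (block φ.1 j).card (restrict (block φ.1 j) x))) := by
  refine ⟨_, _, sum_Icc_one_add_two _ n, ?_, ?_, ?_⟩
  · refine VanishesBelow.smul (VanishesBelow.sum fun φ _ => VanishesBelow.zsmul ?_ _) _
    have hb : ∀ j, block φ.1 j = Finset.univ := fun j =>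
      Finset.filter_true_of_mem fun i _ => Subsingleton.elim _ _
    have h := ((hQ 1).leading_coeff hQ1
      (y := fun j => F (block φ.1 j).card (restrict (block φ.1 j) x)) (m := fun _ => N)
      fun j => hF' _ (by rw [hb]; simp)).1
    exact h.mono (by simp [add_comm])
  · refine VanishesBelow.sum fun m _ => VanishesBelow.smul
      (VanishesBelow.sum fun φ _ => VanishesBelow.zsmul ?_ _) _
    exact (coeff_compMorphism hQ hQ' (by omega) φ.2 fun j => hF _ (card_block_lt φ j)).1
  · rw [map_sum]
    refine Finset.sum_congr rfl fun m _ => ?_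
    rw [coeff_smul_field, map_sum]
    congr 1
    refine Finset.sum_congr rfl fun φ _ => ?_
    rw [map_zsmul]
    congr 1
    exact (coeff_compMorphism hQ hQ' (by omega) φ.2 fun j => hF _ (card_block_lt φ j)).2

end Recursion

section Transfer

open FormalMap

variable [CharZero K] {A B : Type*} [Ring A] [Algebra K A] [Ring B] [Algebra K B]
  {π : ZMod 2 → A →ₗ[K] A} {π' : ZMod 2 → B →ₗ[K] B}
  {d δ H : A →ₗ[K] A} {dB D' : B →ₗ[K] B} {s : A →ₗ[K] B} {t T : B →ₗ[K] A}

/-- The cumulants of the perturbed inclusion and the Koszul brackets of the perturbed differential,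
in terms of the Koszul brackets of the perturbation. -/
theorem cumulant_perturbed (hπ : IsSuperCommutative π) (hπ' : IsSuperCommutative π')
    (hP : SetFun.IsPerturbedContraction π π' d δ H dB D' s t T) (hδ : δ 1 = 0) (hD' : D' 1 = 0)
    {n : ℕ} {p : Fin n → ZMod 2} {x : Fin n → B} (hx : ∀ i, π' (p i) (x i) = x i) :
    cumulant π' T n x = t ((SetFun.gen x : SetFun p B) Finset.univ) +
        H (compMorphism (K := K) (fun m => koszulBracket π δ m) (fun m => cumulant π' T m) n p x) ∧
      koszulBracket π' D' n x = dB ((SetFun.gen x : SetFun p B) Finset.univ) +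
        s (compMorphism (K := K) (fun m => koszulBracket π δ m)
          (fun m => cumulant π' T m) n p x) := by
  have hgn : IsNilpotent (SetFun.map p T (nilExp K (SetFun.gen x : SetFun p B)) - 1) :=
    SetFun.isNilpotent (SetFun.map_apply_empty_eq_one hP.T_one
      (SetFun.nilExp_apply_empty (SetFun.gen_apply_empty x)))
  have hgi := nilExp_mul_nilExp_neg (K := K) (isNilpotent_nilLog (K := K) hgn)
  rw [nilExp_nilLog hgn] at hgi
  have h := SetFun.perturbed_eq hπ hπ' hP (SetFun.isEven_gen hx) (SetFun.gen_apply_empty x)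
  have hQ := SetFun.compMorphism_koszulBracket_cumulant hπ' hπ hx hP.T_one hP.T_even hδ hgi
  have hL := SetFun.signedCumulant_eq hP.T_one x (SetFun.nilExp_gen (K := K) hπ' hx).1
  have h1 := congrArg (fun α : SetFun p A => α Finset.univ) h.1
  have h2 := congrArg (fun α : SetFun p B => α Finset.univ) h.2
  rw [hQ]
  exact ⟨(cumulant_eq_signedCumulant hπ' T hx).trans (hL.trans h1),
    (koszulBracket_eq_signedKoszul hπ' D' hx).trans ((SetFun.signedKoszul_eq hπ' hx hD').trans h2)⟩

end Transfer

end

end DerivedBV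

/-! ### Divisibility and comparison with homotopy transfer. -/

namespace DerivedBV

noncomputable section

variable {K : Type*} [Field K]

/-! ### The transferred structure is a derived BV algebra -/

section Plus

open FormalMap

variable {A : Type*} [Ring A] [Algebra K A] {𝒜 : ℤ → Submodule K A} [GradedAlgebra 𝒜]
  {k : ℤ} {Δ : FormalMap K A A}

theorem koszulBracket_zero_map {n : ℕ} (π : ZMod 2 → A →ₗ[K] A) (a : Fin n → A) :
    koszulBracket π 0 n a = 0 := by
  simp [koszulBracket]

theorem coeff_zero_koszulBracket_plus {n : ℕ} (a : Fin n → A) : PowerSeries.coeff 0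
    (koszulBracket (seriesParityProj 𝒜) (plus Δ).toPowerSeries n fun i => PowerSeries.C (a i)) =
      0 := by
  rw [coeff_koszulBracket_C, plus, if_pos rfl, koszulBracket_zero_map]

theorem coeff_succ_koszulBracket_plus {n : ℕ} (a : Fin n → A) (m : ℕ) : PowerSeries.coeff (m + 1)
    (koszulBracket (seriesParityProj 𝒜) (plus Δ).toPowerSeries n fun i => PowerSeries.C (a i)) =
      koszulBracket (parityProj 𝒜) (Δ (m + 1)) n a := by
  rw [coeff_koszulBracket_C, plus, if_neg (Nat.succ_ne_zero m)]

theorem IsDerivedBV.vanishesBelow_koszulBracket_plus (hΔ : IsDerivedBV 𝒜 k Δ) (n : ℕ)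
    (a : Fin n → A) : VanishesBelow (n - 1) (koszulBracket (seriesParityProj 𝒜)
      (plus Δ).toPowerSeries n fun i => PowerSeries.C (a i)) := by
  intro m hm
  cases m with
  | zero => exact coeff_zero_koszulBracket_plus a
  | succ m =>
    rw [coeff_succ_koszulBracket_plus, ← coeff_koszulBracket_C]
    exact hΔ.koszul_mod n (by omega) a _ hm

/-- With at least two arguments the leading exponent is positive, so discarding Δ_0 changes nothing;
the unary operation is the only one affected. -/
theorem leadingFamily_koszulBracket_plus (m : ℕ) (a : Fin (m + 2) → A) :
    leadingFamily (fun n => koszulBracket (seriesParityProj 𝒜) (plus Δ).toPowerSeries n) (m + 2) a =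
      poissonStructure 𝒜 Δ (m + 2) a :=
  coeff_succ_koszulBracket_plus a m

end Plus

section One

open FormalMap

variable {A B : Type*} [Ring A] [Algebra K A] [Ring B] [Algebra K B]

theorem sum_proj_one {π : ZMod 2 → A →ₗ[K] A} (hπ : IsSuperCommutative π) (f : A →ₗ[K] B) (a : A) :
    ∑ p : Fin 1 → ZMod 2, f (π (p 0) a) = f a := by
  refine ((Equiv.funUnique (Fin 1) (ZMod 2)).sum_comp fun e => f (π e a)).trans ?_
  refine (Fin.sum_univ_two _).trans ?_
  rw [← map_add]
  exact congrArg f (hπ.sum_proj a)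

theorem koszulBracket_one {π : ZMod 2 → A →ₗ[K] A} (hπ : IsSuperCommutative π) (D : A →ₗ[K] A)
    (a : Fin 1 → A) : koszulBracket π D 1 a = D (a 0) := by
  rw [← sum_proj_one hπ D (a 0)]
  refine Finset.sum_congr rfl fun p _ => ?_
  have h1 : (Finset.univ.filter fun I : Finset (Fin 1) => I.Nonempty) = {{0}} := by decide
  have h2 : koszulSign p (unshuffle {0}) = 1 := by simp [koszulSign]
  rw [h1, Finset.sum_singleton, h2]
  have h3 : ({0} : Finset (Fin 1))ᶜ = ∅ := by decide
  simp [blockProd, h3]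

theorem cumulant_one {π : ZMod 2 → A →ₗ[K] A} (hπ : IsSuperCommutative π) (f : A →ₗ[K] B)
    (a : Fin 1 → A) : cumulant π f 1 a = f (a 0) := by
  rw [← sum_proj_one hπ f (a 0)]
  refine Finset.sum_congr rfl fun p _ => ?_
  have hφ : ∀ φ : Fin 1 → Fin 1, block φ 0 = {0} := fun φ => by
    ext i; simp [block, Subsingleton.elim i 0, Subsingleton.elim (φ 0) 0]
  have h2 : ∀ φ : Fin 1 → Fin 1, koszulSign p φ = 1 := fun φ => by simp [koszulSign]
  have : Unique {φ : Fin 1 → Fin 1 // Function.Surjective φ} :=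
    ⟨⟨⟨id, Function.surjective_id⟩⟩, fun φ => Subtype.ext (Subsingleton.elim _ _)⟩
  rw [Finset.Icc_self, Finset.sum_singleton, Fintype.sum_unique, h2]
  simp [hφ, blockProd]

variable {Δ : FormalMap K A A} {dB : B →ₗ[K] B} {σ : A →ₗ[K] B} {τ : B →ₗ[K] A} {h : A →ₗ[K] A}

theorem perturbedInclusion_apply_zero : perturbedInclusion Δ τ h 0 = τ := by
  simp [perturbedInclusion, series, comp, pow, const]

theorem perturbedDifferential_apply_zero : perturbedDifferential Δ dB σ τ h 0 = dB := by
  simp [perturbedDifferential, series, comp, plus, const]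

end One

namespace PerturbedBV

open FormalMap

variable [CharZero K] {A B : Type*} [Ring A] [Algebra K A] [Ring B] [Algebra K B]
  {𝒜 : ℤ → Submodule K A} [GradedAlgebra 𝒜] {ℬ : ℤ → Submodule K B} [GradedAlgebra ℬ]
  (h𝒜 : IsGradedCommutative 𝒜) (hℬ : IsGradedCommutative ℬ) {k : ℤ} (hk : Odd k)
  {Δ : FormalMap K A A} (hΔ : IsDerivedBV 𝒜 k Δ)
  {dB : B →ₗ[K] B} {σ : A →ₗ[K] B} {τ : B →ₗ[K] A} {h : A →ₗ[K] A}
  (hc : IsSemifullDGContraction 𝒜 ℬ (Δ 0) dB σ τ h)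
include h𝒜 hk hΔ hc

omit [CharZero K] in
theorem differential_one : (perturbedDifferential Δ dB σ τ h).toPowerSeries 1 = 0 := by
  rw [perturbedDifferential_apply, (isPerturbedContraction_perturbed h𝒜 hk hΔ hc).T_one,
    toPowerSeries_one_eq_zero fun n => ?_, toPowerSeries_one_eq_zero fun n => ?_, map_zero, add_zero]
  · rw [plus]; split_ifs
    · rfl
    · exact hΔ.map_one n
  · rw [const]; split_ifs
    · exact hc.dB_one
    · rfl

include hℬ

/-- The inner family is regarded as a function of tuples in B, embedded as constant series, so that
inductive statements about subtuples in B apply directly. -/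
theorem homogeneous_eq {n : ℕ} {p : Fin n → ZMod 2} {x : Fin n → B}
    (hx : ∀ i, parityProj ℬ (p i) (x i) = x i) :
    cumulant (seriesParityProj ℬ) (perturbedInclusion Δ τ h).toPowerSeries n
        (fun i => PowerSeries.C (x i)) = (const τ).toPowerSeries
          ((SetFun.gen (fun i => PowerSeries.C (x i)) : SetFun p B⟦X⟧) Finset.univ) +
        (const h).toPowerSeries (compMorphism (K := K)
          (fun m => koszulBracket (seriesParityProj 𝒜) (plus Δ).toPowerSeries m)
          (fun m => fun x : Fin m → B => cumulant (seriesParityProj ℬ)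
            (perturbedInclusion Δ τ h).toPowerSeries m fun i => PowerSeries.C (x i)) n p x) ∧
    koszulBracket (seriesParityProj ℬ) (perturbedDifferential Δ dB σ τ h).toPowerSeries n
        (fun i => PowerSeries.C (x i)) = (const dB).toPowerSeries
          ((SetFun.gen (fun i => PowerSeries.C (x i)) : SetFun p B⟦X⟧) Finset.univ) +
        (const σ).toPowerSeries (compMorphism (K := K)
          (fun m => koszulBracket (seriesParityProj 𝒜) (plus Δ).toPowerSeries m)
          (fun m => fun x : Fin m → B => cumulant (seriesParityProj ℬ)
            (perturbedInclusion Δ τ h).toPowerSeries m fun i => PowerSeries.C (x i)) n p x) :=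
  cumulant_perturbed (isSuperCommutative_seriesParityProj h𝒜)
    (isSuperCommutative_seriesParityProj hℬ) (isPerturbedContraction_perturbed h𝒜 hk hΔ hc)
    (toPowerSeries_one_eq_zero fun n => by
      rw [plus]; split_ifs
      · rfl
      · exact hΔ.map_one n)
    (differential_one h𝒜 hk hΔ hc) fun i => seriesParityProj_C_eq (hx i)

/-- The outer induction on the number of arguments controls the terms with at least two blocks. The
cumulant itself recurs in the unary term, and the inner induction on N uses the power of t gained
there to raise its divisibility up to t^(n+1). -/
theorem vanishesBelow_cumulant_homogeneous (n : ℕ) (p : Fin n → ZMod 2) (x : Fin n → B)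
    (hx : ∀ i, parityProj ℬ (p i) (x i) = x i) :
    VanishesBelow (n - 1) (cumulant (seriesParityProj ℬ) (perturbedInclusion Δ τ h).toPowerSeries n
      fun i => PowerSeries.C (x i)) := by
  induction n using Nat.strong_induction_on with
  | _ n ih =>
    obtain hn | ⟨n, rfl⟩ : n - 1 = 0 ∨ ∃ m, n = m + 2 := by
      rcases n with _ | _ | n
      · exact Or.inl rfl
      · exact Or.inl rfl
      · exact Or.inr ⟨n, rfl⟩
    · intro m hm; omega
    -- The length is kept as a variable l = n + 2 because the full subtuple has length `I.card`,
    -- equal to n + 2 only propositionally.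
    · have key : ∀ N ≤ n + 1, ∀ (l : ℕ), l = n + 2 → ∀ (p : Fin l → ZMod 2) (x : Fin l → B),
          (∀ i, parityProj ℬ (p i) (x i) = x i) → VanishesBelow N (cumulant (seriesParityProj ℬ)
            (perturbedInclusion Δ τ h).toPowerSeries l fun i => PowerSeries.C (x i)) := by
        intro N
        induction N with
        | zero => intro _ l _ p x _ m hm; omega
        | succ N ihN =>
          rintro hN l rfl p x hx
          obtain ⟨u, v, huv, hu, hv, -⟩ := compMorphism_add_two (K := K)
            (isSeriesMultilinear_koszulBracket (𝒜 := 𝒜) (plus Δ))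
            hΔ.vanishesBelow_koszulBracket_plus
            (fun a m hm => by
              obtain rfl : m = 0 := by omega
              exact coeff_zero_koszulBracket_plus a)
            (F := fun m => fun x : Fin m → B => cumulant (seriesParityProj ℬ)
              (perturbedInclusion Δ τ h).toPowerSeries m fun i => PowerSeries.C (x i))
            (p := p) (x := x) (N := N)
            (fun I hI => ih _ hI (restrict I p) _ fun i => hx _)
            (fun I hI => ihN (by omega) _ hI (restrict I p) _ fun i => hx _)
          rw [(homogeneous_eq h𝒜 hℬ hk hΔ hc hx).1, SetFun.gen_apply_univ, map_zero, zero_add, huv]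
          exact (hu.add (hv.mono hN)).map_const h
      exact key (n + 1) le_rfl _ rfl p x hx

/-- The transfer recursion on homogeneous arguments. -/
theorem homogeneous_leading {n : ℕ} {p : Fin (n + 2) → ZMod 2} {x : Fin (n + 2) → B}
    (hx : ∀ i, parityProj ℬ (p i) (x i) = x i) :
    (PowerSeries.coeff (n + 1) (cumulant (seriesParityProj ℬ)
        (perturbedInclusion Δ τ h).toPowerSeries (n + 2) fun i => PowerSeries.C (x i)) =
      ∑ m ∈ Finset.range (n + 1), (1 / ((m + 2).factorial : K)) •
        ∑ φ : {φ : Fin (n + 2) → Fin (m + 2) // Function.Surjective φ}, koszulSign p φ.1 •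
          h (poissonStructure 𝒜 Δ (m + 2) fun j => poissonMorphism ℬ (perturbedInclusion Δ τ h)
            (block φ.1 j).card (restrict (block φ.1 j) x))) ∧
    VanishesBelow (n + 1) (koszulBracket (seriesParityProj ℬ)
      (perturbedDifferential Δ dB σ τ h).toPowerSeries (n + 2) fun i => PowerSeries.C (x i)) ∧
    (PowerSeries.coeff (n + 1) (koszulBracket (seriesParityProj ℬ)
      (perturbedDifferential Δ dB σ τ h).toPowerSeries (n + 2) fun i => PowerSeries.C (x i)) =
      ∑ m ∈ Finset.range (n + 1), (1 / ((m + 2).factorial : K)) •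
        ∑ φ : {φ : Fin (n + 2) → Fin (m + 2) // Function.Surjective φ}, koszulSign p φ.1 •
          σ (poissonStructure 𝒜 Δ (m + 2) fun j => poissonMorphism ℬ (perturbedInclusion Δ τ h)
            (block φ.1 j).card (restrict (block φ.1 j) x))) := by
  have hv0 := vanishesBelow_cumulant_homogeneous h𝒜 hℬ hk hΔ hc
  obtain ⟨u, v, huv, hu, hv, hv'⟩ := compMorphism_add_two (K := K)
    (isSeriesMultilinear_koszulBracket (𝒜 := 𝒜) (plus Δ))
    hΔ.vanishesBelow_koszulBracket_plus
    (fun a m hm => by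
      obtain rfl : m = 0 := by omega
      exact coeff_zero_koszulBracket_plus a)
    (F := fun m => fun x : Fin m → B => cumulant (seriesParityProj ℬ)
      (perturbedInclusion Δ τ h).toPowerSeries m fun i => PowerSeries.C (x i))
    (p := p) (x := x) (N := n + 1)
    (fun I _ => hv0 _ (restrict I p) _ fun i => hx _)
    (fun I hI => by
      have := hv0 _ (restrict I p) (restrict I x) fun i => hx _
      rwa [show I.card - 1 = n + 1 from by omega] at this)
  have hlead : ∀ (m : ℕ) (x : Fin m → B), PowerSeries.coeff (m - 1) (cumulant (seriesParityProj ℬ)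
      (perturbedInclusion Δ τ h).toPowerSeries m fun i => PowerSeries.C (x i)) =
        poissonMorphism ℬ (perturbedInclusion Δ τ h) m x := fun m x => by
    rw [poissonMorphism_eq]; rfl
  simp only [leadingFamily_koszulBracket_plus, hlead] at hv'
  -- The cumulant is now known to be divisible by t^(n+1), so the unary term starts at t^(n+2) and
  -- is absent from the leading coefficient. The terms with at least two blocks form the transfer
  -- formula.
  have huv' := hu (n + 1) (by omega)
  rw [(homogeneous_eq h𝒜 hℬ hk hΔ hc hx).1, (homogeneous_eq h𝒜 hℬ hk hΔ hc hx).2,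
    SetFun.gen_apply_univ, map_zero, map_zero, zero_add, zero_add, huv]
  refine ⟨?_, ((hu.mono (by omega)).add hv).map_const σ, ?_⟩
  · rw [coeff_toPowerSeries_const, map_add, huv', zero_add, hv']
    simp only [map_sum, map_smul, map_zsmul]
  · rw [coeff_toPowerSeries_const, map_add, huv', zero_add, hv']
    simp only [map_sum, map_smul, map_zsmul]

theorem vanishesBelow_cumulant (n : ℕ) (x : Fin n → B) :
    VanishesBelow (n - 1) (cumulant (seriesParityProj ℬ) (perturbedInclusion Δ τ h).toPowerSeries n
      fun i => PowerSeries.C (x i)) := by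
  rw [cumulant_eq_sum_proj (isSuperCommutative_seriesParityProj hℬ)]
  simp only [seriesParityProj_C]
  exact VanishesBelow.sum fun p _ => vanishesBelow_cumulant_homogeneous h𝒜 hℬ hk hΔ hc n p _
    fun i => (isSuperCommutative_parityProj hℬ).proj_proj _ _

theorem vanishesBelow_koszulBracket (n : ℕ) (x : Fin n → B) :
    VanishesBelow (n - 1) (koszulBracket (seriesParityProj ℬ)
      (perturbedDifferential Δ dB σ τ h).toPowerSeries n fun i => PowerSeries.C (x i)) := by
  rw [koszulBracket_eq_sum_proj (isSuperCommutative_seriesParityProj hℬ)]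
  simp only [seriesParityProj_C]
  refine VanishesBelow.sum fun p _ => ?_
  rcases n with _ | _ | n
  · intro m hm; omega
  · intro m hm; omega
  · exact (homogeneous_leading h𝒜 hℬ hk hΔ hc fun i =>
      (isSuperCommutative_parityProj hℬ).proj_proj _ _).2.1

theorem isDerivedBV : IsDerivedBV ℬ k (perturbedDifferential Δ dB σ τ h) where
  degree := (isFormalContraction_perturbed hΔ.degree hΔ.square_zero hc.toIsContraction).degree_D'
  map_one n := by
    rw [← coeff_toPowerSeries_C, map_one, differential_one h𝒜 hk hΔ hc, map_zero]
  square_zero := (isFormalContraction_perturbed hΔ.degree hΔ.square_zero hc.toIsContraction).D'_D'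
  koszul_mod n _ a m hm := vanishesBelow_koszulBracket h𝒜 hℬ hk hΔ hc n a m hm

theorem isDerivedBVMorphism : IsDerivedBVMorphism ℬ 𝒜 k (perturbedDifferential Δ dB σ τ h) Δ
    (perturbedInclusion Δ τ h) where
  degree := (isFormalContraction_perturbed hΔ.degree hΔ.square_zero hc.toIsContraction).degree_u
  map_one := (isPerturbedContraction_perturbed h𝒜 hk hΔ hc).T_one
  commutes := (isFormalContraction_perturbed hΔ.degree hΔ.square_zero hc.toIsContraction).D_u.symm
  cumulant_mod n _ a m hm := vanishesBelow_cumulant h𝒜 hℬ hk hΔ hc n a m hm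

/-- Both families start with τ and obey the same recursion, the inner values being taken on strictly
smaller blocks. -/
theorem poissonMorphism_perturbed : poissonMorphism ℬ (perturbedInclusion Δ τ h) =
    transferMorphism ℬ (poissonStructure 𝒜 Δ) τ h := by
  funext n
  induction n using Nat.strong_induction_on with
  | _ n ih =>
    funext x
    rcases n with _ | _ | n
    · rw [transferMorphism]; rfl
    · rw [transferMorphism]
      change PowerSeries.coeff 0 (cumulant (seriesParityProj ℬ) _ 1 _) = τ (x 0)
      rw [cumulant_one (isSuperCommutative_seriesParityProj hℬ), coeff_toPowerSeries_C,
        perturbedInclusion_apply_zero]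
    · rw [transferMorphism, poissonMorphism]
      beta_reduce
      rw [cumulant_eq_sum_proj (isSuperCommutative_seriesParityProj hℬ), map_sum]
      refine Finset.sum_congr rfl fun p _ => ?_
      simp only [seriesParityProj_C]
      rw [(homogeneous_leading h𝒜 hℬ hk hΔ hc fun i =>
        (isSuperCommutative_parityProj hℬ).proj_proj _ _).1]
      simp only [fun (m : ℕ) (φ : {φ : Fin (n + 2) → Fin (m + 2) // Function.Surjective φ}) j =>
        ih _ (card_block_lt φ j)]

theorem poissonStructure_perturbed : poissonStructure ℬ (perturbedDifferential Δ dB σ τ h) =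
    transferStructure ℬ (poissonStructure 𝒜 Δ) dB σ τ h := by
  funext n x
  rcases n with _ | _ | n
  · rfl
  · change koszulBracket (parityProj ℬ) _ 1 x = dB (x 0)
    rw [koszulBracket_one (isSuperCommutative_parityProj hℬ), perturbedDifferential_apply_zero]
  · rw [transferStructure, poissonStructure_eq, leadingFamily, koszulBracket_eq_sum_proj
      (isSuperCommutative_seriesParityProj hℬ), map_sum]
    refine Finset.sum_congr rfl fun p _ => ?_
    simp only [seriesParityProj_C]
    rw [← poissonMorphism_perturbed h𝒜 hℬ hk hΔ hc]
    exact (homogeneous_leading h𝒜 hℬ hk hΔ hc fun i =>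
      (isSuperCommutative_parityProj hℬ).proj_proj _ _).2.2

end PerturbedBV

end

end DerivedBV

/-! ### The theorem. -/

open DerivedBV in
theorem mainTheorem1 {K : Type*} [Field K] [CharZero K]
    {A B : Type*} [Ring A] [Algebra K A] [Ring B] [Algebra K B]
    (𝒜 : ℤ → Submodule K A) [GradedAlgebra 𝒜] (ℬ : ℤ → Submodule K B) [GradedAlgebra ℬ]
    (h𝒜 : IsGradedCommutative 𝒜) (hℬ : IsGradedCommutative ℬ)
    (k : ℤ) (hk : Odd k)
    (Δ : FormalMap K A A) (hΔ : IsDerivedBV 𝒜 k Δ)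
    (dB : B →ₗ[K] B) (σ : A →ₗ[K] B) (τ : B →ₗ[K] A) (h : A →ₗ[K] A)
    (hc : IsSemifullDGContraction 𝒜 ℬ (Δ 0) dB σ τ h) :
    IsFormalContraction 𝒜 ℬ k Δ (perturbedDifferential Δ dB σ τ h)
        (perturbedProjection Δ σ h) (perturbedInclusion Δ τ h) (perturbedHomotopy Δ h) ∧
      IsDerivedBV ℬ k (perturbedDifferential Δ dB σ τ h) ∧
      IsDerivedBVMorphism ℬ 𝒜 k (perturbedDifferential Δ dB σ τ h) Δ
        (perturbedInclusion Δ τ h) ∧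
      IsDerivedPoisson 𝒜 k (poissonStructure 𝒜 Δ) ∧
      IsDerivedPoisson ℬ k (poissonStructure ℬ (perturbedDifferential Δ dB σ τ h)) ∧
      IsDerivedPoissonMorphism ℬ 𝒜 k
        (poissonStructure ℬ (perturbedDifferential Δ dB σ τ h)) (poissonStructure 𝒜 Δ)
        (poissonMorphism ℬ (perturbedInclusion Δ τ h)) ∧
      poissonStructure ℬ (perturbedDifferential Δ dB σ τ h) =
        transferStructure ℬ (poissonStructure 𝒜 Δ) dB σ τ h ∧
      poissonMorphism ℬ (perturbedInclusion Δ τ h) =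
        transferMorphism ℬ (poissonStructure 𝒜 Δ) τ h := by
  have hBV := PerturbedBV.isDerivedBV h𝒜 hℬ hk hΔ hc
  have hM := PerturbedBV.isDerivedBVMorphism h𝒜 hℬ hk hΔ hc
  exact ⟨isFormalContraction_perturbed hΔ.degree hΔ.square_zero hc.toIsContraction, hBV, hM,
    hΔ.isDerivedPoisson h𝒜 hk, hBV.isDerivedPoisson hℬ hk,
    hM.isDerivedPoissonMorphism hℬ h𝒜 hk hBV hΔ,
    PerturbedBV.poissonStructure_perturbed h𝒜 hℬ hk hΔ hc,
    PerturbedBV.poissonMorphism_perturbed h𝒜 hℬ hk hΔ hc⟩
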